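/- Let $k$ be an algebraically closed field (of any characteristic) and let $\mathcal{P}$ be a polynomial functor of degree $d\ge 0$, i.e. a functor from finite dimensional $k$-vector spaces to finite dimensional $k$-vector spaces such that all the maps $\operatorname{Hom}(V,W)\to\operatorname{Hom}(\mathcal{P}V,\mathcal{P}W)$ are polynomial and $\mathcal{P}(c\cdot\mathrm{id}_V)=c^d\cdot\mathrm{id}_{\mathcal{P}V}$ for all $c\in k$ and all $V$. For $n\ge 1$ let $\Omega$ be the cotangent sheaf of the projective space $\mathbf{P}^{n-1}$ of lines in $k^n$, and for $e\in\mathbf{Z}$ let $\mathcal{P}(\Omega)(e)=\mathcal{P}(\Omega)\otimes\mathcal{O}(e)$, where $\mathcal{P}(\Omega)$ is the vector bundle obtained by applying $\mathcal{P}$ to $\Omega$ fibrewise. (A) Triviality of the action and vanishing for negative twists. 1. The group $\mathrm{GL}_n(k)$ acts trivially on $H^j(\mathbf{P}^{n-1},\mathcal{P}(\Omega))$ for all $j<n-1$. 2. If $d\le n-1$, then $\mathrm{GL}_n(k)$ acts trivially on $H^{n-1}(\mathbf{P}^{n-1},\mathcal{P}(\Omega))$. 3. If $e<0$, then $H^j(\mathbf{P}^{n-1},\mathcal{P}(\Omega)(e))=0$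 for all $j<n-1$. 4. If $d-n+1\le e\le -1$, then $H^{n-1}(\mathbf{P}^{n-1},\mathcal{P}(\Omega)(e))=0$. (B) Stabilization. For $1\le m\le n$, let $\iota:\mathbf{P}^{m-1}\hookrightarrow\mathbf{P}^{n-1}$ be the embedding as the subspace where the last $n-m$ coordinates vanish, and consider the pullback map $\iota^*:H^j(\mathbf{P}^{n-1},\mathcal{P}(\Omega))\to H^j(\mathbf{P}^{m-1},\mathcal{P}(\Omega))$ (restriction to $\mathbf{P}^{m-1}$ followed by the map induced by $\iota^*\Omega_{\mathbf{P}^{n-1}}\to\Omega_{\mathbf{P}^{m-1}}$). 1. If $j<m-1$, then $\iota^*$ is an isomorphism in degree $j$; so for fixed $j$ the group $H^j(\mathbf{P}^{n-1},\mathcal{P}(\Omega))$ is independent of $n$ as long as $j<n-1$. 2. If $d\le m-1$, then $\iota^*$ is an isomorphism in every degree $j$; so all the groups $H^j(\mathbf{P}^{n-1},\mathcal{P}(\Omega))$ are independent of $n$ as long as $d\le n-1$. 3. $H^j(\mathbf{P}^{n-1},\mathcal{P}(\Omega))=0$ for all $j>d$ and all $n\ge 1$. -/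

import Mathlib

open CategoryTheory

universe u

namespace PolyOmega

section PolynomialMaps

variable (k : Type u) [Field k]

/-- The algebra of polynomial functions on a `k`-vector space `E`: the subalgebra of all functions
`E → k` generated by the linear forms. -/
def polyFun (E : Type u) [AddCommGroup E] [Module k E] : Subalgebra k (E → k) :=
  Algebra.adjoin k (Set.range fun φ : Module.Dual k E => (φ : E → k))

/-- A map `f : E → W` into a finite dimensional vector space is polynomial if its composite with
every linear functional on `W` (equivalently, every coordinate of `f`) is a polynomial function. -/
def IsPolyMap {E W : Type u} [AddCommGroup E] [Module k E] [AddCommGroup W] [Module k W]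
    (f : E → W) : Prop :=
  ∀ ψ : Module.Dual k W, (fun v => ψ (f v)) ∈ polyFun k E

/-- A functor from finite dimensional vector spaces to finite dimensional vector spaces is a
polynomial functor, homogeneous of degree `d`, if all the maps `Hom(V, W) → Hom(P V, P W)` are
polynomial and `P (c • id) = c ^ d • id` for every scalar `c`. -/
structure IsPolynomialFunctor (P : FGModuleCat.{u} k ⥤ FGModuleCat.{u} k) (d : ℕ) : Prop where
  polynomial : ∀ V W : FGModuleCat.{u} k, IsPolyMap k (fun f : V ⟶ W => P.map f)
  homogeneous : ∀ (V : FGModuleCat.{u} k) (c : k), P.map (c • 𝟙 V) = c ^ d • 𝟙 (P.obj V)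

end PolynomialMaps

section PolyMapLemmas

variable {k : Type u} [Field k] {E F W W' : Type u} [AddCommGroup E] [Module k E]
  [AddCommGroup F] [Module k F] [AddCommGroup W] [Module k W] [AddCommGroup W'] [Module k W']

lemma polyFun_comp (φ : E →ₗ[k] F) {h : F → k} (hh : h ∈ polyFun k F) :
    (fun v => h (φ v)) ∈ polyFun k E := by
  let c : (F → k) →ₐ[k] (E → k) :=
    { toFun := fun g v => g (φ v), map_one' := rfl, map_mul' := fun _ _ => rfl, map_zero' := rfl,
      map_add' := fun _ _ => rfl, commutes' := fun _ => rfl }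
  have : polyFun k F ≤ (polyFun k E).comap c := by
    refine Algebra.adjoin_le ?_
    rintro _ ⟨ℓ, rfl⟩
    exact Algebra.subset_adjoin ⟨ℓ.comp φ, rfl⟩
  exact this hh

lemma IsPolyMap.zero : IsPolyMap k (fun _ : E => (0 : W)) := fun ψ => by
  simp only [map_zero]
  exact (polyFun k E).zero_mem

lemma IsPolyMap.add {f g : E → W} (hf : IsPolyMap k f) (hg : IsPolyMap k g) :
    IsPolyMap k (fun v => f v + g v) := fun ψ => by
  simp only [map_add]
  exact (polyFun k E).add_mem (hf ψ) (hg ψ)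

lemma IsPolyMap.mul {h : E → k} {f : E → W} (hh : h ∈ polyFun k E) (hf : IsPolyMap k f) :
    IsPolyMap k (fun v => h v • f v) := fun ψ => by
  simp only [map_smul]
  exact (polyFun k E).mul_mem hh (hf ψ)

lemma IsPolyMap.smul (a : k) {f : E → W} (hf : IsPolyMap k f) :
    IsPolyMap k (fun v => a • f v) := fun ψ => by
  simp only [map_smul]
  exact (polyFun k E).smul_mem (hf ψ) a

lemma IsPolyMap.pull {f : F → W} (hf : IsPolyMap k f) (φ : E →ₗ[k] F) (T : W →ₗ[k] W') :
    IsPolyMap k (fun v => T (f (φ v))) := fun ψ =>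
  polyFun_comp φ (hf (ψ.comp T))

/-- The (cone over the) intersection of the affine open sets `D₊(ℓ i) ⊆ ℙ`, the complements of the
hyperplanes `ℓ i = 0`. It is empty if some `ℓ i` is the zero form. -/
def inter {p : ℕ} (ℓ : Fin (p + 1) → Module.Dual k E) : Set E := {v | ∀ i, ℓ i v ≠ 0}

lemma inter_face {p : ℕ} (ℓ : Fin (p + 2) → Module.Dual k E) (i : Fin (p + 2)) :
    inter ℓ ⊆ inter (fun j => ℓ (i.succAbove j)) := fun _ hv j => hv (i.succAbove j)

end PolyMapLemmas

noncomputable section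

variable {k : Type u} [Field k] (P : FGModuleCat.{u} k ⥤ FGModuleCat.{u} k) (d : ℕ) (e : ℤ)

/-- The linear map `P(f) : P(V) → P(W)`. -/
def mapLin {V W : Type u} [AddCommGroup V] [Module k V] [Module.Finite k V]
    [AddCommGroup W] [Module k W] [Module.Finite k W] (f : V →ₗ[k] W) :
    P.obj (FGModuleCat.of k V) →ₗ[k] P.obj (FGModuleCat.of k W) :=
  (P.map (FGModuleCat.ofHom f)).hom.hom

lemma mapLin_id (V : Type u) [AddCommGroup V] [Module k V] [Module.Finite k V] :
    mapLin P (LinearMap.id : V →ₗ[k] V) = LinearMap.id := by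
  have h : P.map (FGModuleCat.ofHom (LinearMap.id : V →ₗ[k] V)) = 𝟙 _ :=
    P.map_id (FGModuleCat.of k V)
  unfold mapLin
  rw [h]
  rfl

lemma mapLin_comp {V W X : Type u} [AddCommGroup V] [Module k V] [Module.Finite k V]
    [AddCommGroup W] [Module k W] [Module.Finite k W]
    [AddCommGroup X] [Module k X] [Module.Finite k X] (g : W →ₗ[k] X) (f : V →ₗ[k] W) :
    mapLin P (g.comp f) = (mapLin P g).comp (mapLin P f) := by
  have h : P.map (FGModuleCat.ofHom (g.comp f)) =
      P.map (FGModuleCat.ofHom f) ≫ P.map (FGModuleCat.ofHom g) :=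
    P.map_comp (FGModuleCat.ofHom f) (FGModuleCat.ofHom g)
  unfold mapLin
  rw [h]
  rfl

lemma mapLin_comp_apply {V W X : Type u} [AddCommGroup V] [Module k V] [Module.Finite k V]
    [AddCommGroup W] [Module k W] [Module.Finite k W]
    [AddCommGroup X] [Module k X] [Module.Finite k X] (g : W →ₗ[k] X) (f : V →ₗ[k] W)
    (x : P.obj (FGModuleCat.of k V)) :
    mapLin P (g.comp f) x = mapLin P g (mapLin P f x) := by
  rw [mapLin_comp]; rfl

section Sheaf

variable (E : Type u) [AddCommGroup E] [Module k E] [Module.Finite k E]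

/-- The vector space `P(E^∨)`, where `E^∨ = H⁰(ℙ, 𝒪(1))` is the space of linear forms on `E`. -/
abbrev Val : Type u := P.obj (FGModuleCat.of k (Module.Dual k E))

variable {E}

/-- The covectors that vanish at `v`. For `v ≠ 0` this is the fibre at `[v]` of
`Ω ⊗ 𝒪(1) = ker (E^∨ ⊗ 𝒪 → 𝒪(1))`. -/
def conormal (v : E) : Submodule k (Module.Dual k E) :=
  LinearMap.ker (Module.Dual.eval k E v)

/-- `P(v^⊥)`, as a subspace of `P(E^∨)`. (The inclusion `v^⊥ → E^∨` is split, so `P` of it is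
injective.) -/
def fibre (v : E) : Submodule k (Val P E) :=
  LinearMap.range
    (mapLin P (V := conormal (k := k) v) (W := Module.Dual k E) (conormal (k := k) v).subtype)

/-- The sheaf `P(Ω)(e)` on the projective space `ℙ` of lines through `0` in `E`, for a polynomial
functor `P` of degree `d`. An open subset of `ℙ` is given by the cone `U ⊆ E ∖ {0}` over it.

A section of `Ω` over it is a regular 1-form on `U` that descends to `ℙ`: by the Euler sequence
`0 → Ω → E^∨ ⊗ 𝒪(-1) → 𝒪 → 0` this is a regular function `s : U → E^∨`, homogeneous of degree `-1`,
with `s v ∈ v^⊥` for all `v`. Hence `P(Ω) ⊆ P(E^∨) ⊗ 𝒪(-d)` is the subbundle with fibres `P(v^⊥)`,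
and a section of `P(Ω)(e)` is a regular function `s : U → P(E^∨)`, homogeneous of degree `e - d`,
with `s v ∈ P(v^⊥)` for all `v`. Here `s` is regular if locally it is a quotient of polynomials. -/
def sections (U : Set E) : Submodule k (U → Val P E) where
  carrier := {s |
    (∀ v : U, ∃ h ∈ polyFun k E, ∃ f : E → Val P E, IsPolyMap k f ∧ h v ≠ 0 ∧
      ∀ w : U, h w ≠ 0 → h w • s w = f w) ∧
    (∀ (c : kˣ) (v w : U), (w : E) = (c : k) • (v : E) → s w = ((c : k) ^ (e - (d : ℤ))) • s v) ∧
    (∀ v : U, s v ∈ fibre P (v : E))}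
  add_mem' := by
    rintro s t ⟨hs, hs', hs''⟩ ⟨ht, ht', ht''⟩
    refine ⟨fun v => ?_, fun c v w h => ?_, fun v => (fibre P (v : E)).add_mem (hs'' v) (ht'' v)⟩
    · obtain ⟨h, hh, f, hf, h0, H⟩ := hs v
      obtain ⟨h', hh', f', hf', h0', H'⟩ := ht v
      refine ⟨h * h', (polyFun k E).mul_mem hh hh', fun v => h' v • f v + h v • f' v,
        (IsPolyMap.mul hh' hf).add (IsPolyMap.mul hh hf'), mul_ne_zero h0 h0', fun w hw => ?_⟩
      have hw' := mul_ne_zero_iff.1 hw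
      simp only [Pi.add_apply, Pi.mul_apply, ← H w hw'.1, ← H' w hw'.2]
      module
    · rw [Pi.add_apply, Pi.add_apply, hs' c v w h, ht' c v w h, smul_add]
  zero_mem' := by
    refine ⟨fun v => ⟨1, (polyFun k E).one_mem, fun _ => 0, IsPolyMap.zero, ?_, ?_⟩, ?_, ?_⟩
    · exact one_ne_zero
    · intro w _; simp
    · intro c v w h; simp
    · intro v; exact (fibre P (v : E)).zero_mem
  smul_mem' := by
    rintro a s ⟨hs, hs', hs''⟩
    refine ⟨fun v => ?_, fun c v w h => ?_, fun v => (fibre P (v : E)).smul_mem a (hs'' v)⟩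
    · obtain ⟨h, hh, f, hf, h0, H⟩ := hs v
      refine ⟨h, hh, fun v => a • f v, hf.smul a, h0, fun w hw => ?_⟩
      simp only [Pi.smul_apply, ← H w hw]
      rw [smul_comm]
    · rw [Pi.smul_apply, Pi.smul_apply, hs' c v w h, smul_comm]

/-- Restriction of sections. -/
def restrict {U U' : Set E} (h : U' ⊆ U) : sections P d e U →ₗ[k] sections P d e U' where
  toFun s := ⟨fun v => s.1 ⟨v, h v.2⟩, by
    obtain ⟨s, hs, hs', hs''⟩ := s
    refine ⟨fun v => ?_, fun c v w hvw => hs' c ⟨v, h v.2⟩ ⟨w, h w.2⟩ hvw,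
      fun v => hs'' ⟨v, h v.2⟩⟩
    obtain ⟨g, hg, f, hf, h0, H⟩ := hs ⟨v, h v.2⟩
    exact ⟨g, hg, f, hf, h0, fun w => H ⟨w, h w.2⟩⟩⟩
  map_add' _ _ := rfl
  map_smul' _ _ := rfl

variable (E)

/-- The Čech `p`-cochains of `P(Ω)(e)` for the affine open cover of `ℙ` by all the sets `D₊(ℓ)`,
where `ℓ` runs over the linear forms on `E`. The general linear group permutes this cover. -/
def Cochain (p : ℕ) : Type u :=
  ∀ ℓ : Fin (p + 1) → Module.Dual k E, sections P d e (inter ℓ)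

instance (p : ℕ) : AddCommGroup (Cochain P d e E p) :=
  inferInstanceAs (AddCommGroup (∀ ℓ : Fin (p + 1) → Module.Dual k E, sections P d e (inter ℓ)))

instance (p : ℕ) : Module k (Cochain P d e E p) :=
  inferInstanceAs (Module k (∀ ℓ : Fin (p + 1) → Module.Dual k E, sections P d e (inter ℓ)))

/-- The Čech differential `(δ c)_{ℓ₀ … ℓ_{p+1}} = ∑ᵢ (-1)^i c_{ℓ₀ … ℓ̂ᵢ … ℓ_{p+1}}`. -/
def delta (p : ℕ) : Cochain P d e E p →ₗ[k] Cochain P d e E (p + 1) where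
  toFun c ℓ := ∑ i : Fin (p + 2), ((-1 : k) ^ (i : ℕ)) •
    restrict P d e (inter_face ℓ i) (c fun j => ℓ (i.succAbove j))
  map_add' c c' := by
    funext ℓ
    change ∑ i : Fin (p + 2), _ • restrict P d e (inter_face ℓ i)
      ((c fun j => ℓ (i.succAbove j)) + (c' fun j => ℓ (i.succAbove j))) = _ + _
    simp only [map_add, smul_add, Finset.sum_add_distrib]
  map_smul' a c := by
    funext ℓ
    change ∑ i : Fin (p + 2), _ • restrict P d e (inter_face ℓ i)
      (a • (c fun j => ℓ (i.succAbove j))) = a • _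
    simp only [map_smul, Finset.smul_sum]
    exact Finset.sum_congr rfl fun i _ => smul_comm _ _ _

/-- Čech coboundaries. -/
def coboundaries : ∀ p : ℕ, Submodule k (Cochain P d e E p)
  | 0 => ⊥
  | p + 1 => LinearMap.range (delta P d e E p)

/-- The cohomology `H^p(ℙ, P(Ω)(e))`, `ℙ` the projective space of lines in `E`, as the Čech
cohomology of the coherent sheaf `P(Ω)(e)` with respect to the affine open cover of the separated
scheme `ℙ` by the complements of all hyperplanes. -/
abbrev H (p : ℕ) : Type u :=
  LinearMap.ker (delta P d e E p) ⧸
    (coboundaries P d e E p).submoduleOf (LinearMap.ker (delta P d e E p))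

end Sheaf

section Pullback

variable {E F : Type u} [AddCommGroup E] [Module k E] [Module.Finite k E]
  [AddCommGroup F] [Module k F] [Module.Finite k F]

/-- Pullback of sections along the linear embedding `ℙ(E) → ℙ(F)` given by a linear map
`φ : E → F`: it is pullback of differential forms, with `P` applied to it, so
`(φ^* s) v = P(φ^∨) (s (φ v))`. -/
def pullSection (φ : E →ₗ[k] F) {U : Set E} {U' : Set F} (h : ∀ v ∈ U, φ v ∈ U') :
    sections P d e U' →ₗ[k] sections P d e U where
  toFun s := ⟨fun v => mapLin P φ.dualMap (s.1 ⟨φ v, h v v.2⟩), by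
    obtain ⟨s, hs, hs', hs''⟩ := s
    refine ⟨fun v => ?_, fun c v w hvw => ?_, fun v => ?_⟩
    · obtain ⟨g, hg, f, hf, h0, H⟩ := hs ⟨φ v, h v v.2⟩
      refine ⟨fun v => g (φ v), polyFun_comp φ hg, fun v => mapLin P φ.dualMap (f (φ v)),
        hf.pull φ _, h0, fun w hw => ?_⟩
      have := H ⟨φ w, h w w.2⟩ hw
      dsimp only at this ⊢
      rw [← this, map_smul]
    · have := hs' c ⟨φ v, h v v.2⟩ ⟨φ w, h w w.2⟩ (by simp [hvw])
      dsimp only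
      rw [this, map_smul]
    · obtain ⟨x, hx⟩ := hs'' ⟨φ v, h v v.2⟩
      have hr : ∀ ξ ∈ conormal (k := k) (φ v), φ.dualMap ξ ∈ conormal (k := k) (v : E) :=
        fun ξ hξ => hξ
      refine ⟨mapLin P (φ.dualMap.restrict hr) x, ?_⟩
      dsimp only
      rw [← hx, ← mapLin_comp_apply, ← mapLin_comp_apply]
      rfl⟩
  map_add' s t := by ext v; exact map_add _ _ _
  map_smul' a s := by ext v; exact map_smul _ _ _

/-- Pullback of Čech cochains along the linear embedding `ℙ(E) → ℙ(F)` given by `φ : E → F`. A left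
inverse `r` of `φ` extends a linear form `ℓ` on `E` to the linear form `ℓ ∘ r` on `F`, and `D₊(ℓ)` is
the preimage of `D₊(ℓ ∘ r)`. -/
def pullCochain (φ : E →ₗ[k] F) (r : F →ₗ[k] E) (hr : r.comp φ = LinearMap.id) (p : ℕ) :
    Cochain P d e F p →ₗ[k] Cochain P d e E p :=
  LinearMap.pi fun ℓ =>
    (pullSection P d e φ (U := inter ℓ) (U' := inter fun i => (ℓ i).comp r) (fun v hv i => by
      have h : r (φ v) = v := LinearMap.congr_fun hr v
      rw [LinearMap.comp_apply, h]
      exact hv i)).comp (LinearMap.proj fun i => (ℓ i).comp r)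

lemma delta_apply {p : ℕ} (c : Cochain P d e E p) (ℓ : Fin (p + 2) → Module.Dual k E)
    (v : inter ℓ) :
    (delta P d e E p c ℓ).1 v = ∑ i : Fin (p + 2), ((-1 : k) ^ (i : ℕ)) •
      (c (fun j => ℓ (i.succAbove j))).1 ⟨v, inter_face ℓ i v.2⟩ := by
  change (∑ i : Fin (p + 2), ((-1 : k) ^ (i : ℕ)) •
    restrict P d e (inter_face ℓ i) (c fun j => ℓ (i.succAbove j)) : sections P d e _).1 v = _
  rw [AddSubmonoidClass.coe_finsetSum, Finset.sum_apply]
  rfl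

lemma delta_pullCochain (φ : E →ₗ[k] F) (r : F →ₗ[k] E) (hr : r.comp φ = LinearMap.id) (p : ℕ)
    (c : Cochain P d e F p) :
    delta P d e E p (pullCochain P d e φ r hr p c) =
      pullCochain P d e φ r hr (p + 1) (delta P d e F p c) := by
  funext ℓ
  ext v
  rw [delta_apply]
  change _ = mapLin P φ.dualMap ((delta P d e F p c _).1 _)
  rw [delta_apply, map_sum]
  refine Finset.sum_congr rfl fun i _ => ?_
  rw [map_smul]
  rfl

/-- Pullback of Čech cocycles. -/
def pullCocycle (φ : E →ₗ[k] F) (r : F →ₗ[k] E) (hr : r.comp φ = LinearMap.id) (p : ℕ) :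
    LinearMap.ker (delta P d e F p) →ₗ[k] LinearMap.ker (delta P d e E p) :=
  (pullCochain P d e φ r hr p).restrict fun c hc => by
    rw [LinearMap.mem_ker] at hc ⊢
    rw [delta_pullCochain, hc, map_zero]

/-- The pullback map `H^p(ℙ(F), P(Ω)(e)) → H^p(ℙ(E), P(Ω)(e))` along the linear embedding
`ℙ(E) → ℙ(F)` given by a linear map `φ : E → F` with left inverse `r`. -/
def pullH (φ : E →ₗ[k] F) (r : F →ₗ[k] E) (hr : r.comp φ = LinearMap.id) (p : ℕ) :
    H P d e F p →ₗ[k] H P d e E p :=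
  Submodule.mapQ _ _ (pullCocycle P d e φ r hr p) (by
    rintro ⟨c, hc⟩ hcb
    change c ∈ coboundaries P d e F p at hcb
    change pullCochain P d e φ r hr p c ∈ coboundaries P d e E p
    cases p with
    | zero =>
      have h0 : c = 0 := hcb
      rw [h0, map_zero]
      exact Submodule.zero_mem _
    | succ p =>
      obtain ⟨b, rfl⟩ := hcb
      exact ⟨pullCochain P d e φ r hr p b, delta_pullCochain P d e φ r hr p b⟩)

lemma pullH_id (φ r : E →ₗ[k] E) (hr : r.comp φ = LinearMap.id) (hφ : φ = LinearMap.id)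
    (hr' : r = LinearMap.id) (p : ℕ) : pullH P d e φ r hr p = LinearMap.id := by
  subst hφ hr'
  refine LinearMap.ext fun x => ?_
  obtain ⟨⟨c, hc⟩, rfl⟩ := Submodule.Quotient.mk_surjective _ x
  refine congrArg Submodule.Quotient.mk (Subtype.ext ?_)
  funext ℓ
  ext v
  exact LinearMap.congr_fun (mapLin_id P (Module.Dual k E)) _

lemma pullH_comp {G : Type u} [AddCommGroup G] [Module k G] [Module.Finite k G]
    (φ : E →ₗ[k] F) (r : F →ₗ[k] E) (hr : r.comp φ = LinearMap.id)
    (φ' : F →ₗ[k] G) (r' : G →ₗ[k] F) (hr' : r'.comp φ' = LinearMap.id)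
    (φ'' : E →ₗ[k] G) (r'' : G →ₗ[k] E) (hr'' : r''.comp φ'' = LinearMap.id)
    (hφ : φ'' = φ'.comp φ) (hrr : r'' = r.comp r') (p : ℕ) :
    pullH P d e φ'' r'' hr'' p = (pullH P d e φ r hr p).comp (pullH P d e φ' r' hr' p) := by
  subst hφ hrr
  refine LinearMap.ext fun x => ?_
  obtain ⟨⟨c, hc⟩, rfl⟩ := Submodule.Quotient.mk_surjective _ x
  refine congrArg Submodule.Quotient.mk (Subtype.ext ?_)
  funext ℓ
  ext v
  exact mapLin_comp_apply P φ.dualMap φ'.dualMap _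

end Pullback

section ProjectiveSpace

/-- The action of `GL_n(k)` on `H^j(ℙ^{n-1}, P(Ω)(e))`, where `ℙ^{n-1}` is the space of lines in
`k^n`: the matrix `g` acts by pullback along the automorphism of `ℙ^{n-1}` induced by `g⁻¹`. -/
def action (n j : ℕ) :
    Representation k (Matrix.GeneralLinearGroup (Fin n) k) (H P d e (Fin n → k) j) where
  toFun g := pullH P d e (Matrix.mulVecLin (g⁻¹).1) (Matrix.mulVecLin g.1)
    (by rw [← Matrix.mulVecLin_mul, Units.mul_inv, Matrix.mulVecLin_one]) j
  map_one' := pullH_id P d e _ _ _ (by simp) (by simp) j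
  map_mul' g h := by
    refine pullH_comp P d e _ _ _ _ _ _ _ _ _ ?_ ?_ j
    · rw [mul_inv_rev, ← Matrix.mulVecLin_mul]; rfl
    · rw [← Matrix.mulVecLin_mul]; rfl

/-- The pullback map `H^j(ℙ^{n-1}, P(Ω)) → H^j(ℙ^{m-1}, P(Ω))` along the embedding
`ℙ^{m-1} → ℙ^{n-1}` as the coordinate subspace where the last `n - m` coordinates vanish. -/
def coordPull {m n : ℕ} (hmn : m ≤ n) (j : ℕ) :
    H P d e (Fin n → k) j →ₗ[k] H P d e (Fin m → k) j :=
  pullH P d e (Function.ExtendByZero.linearMap k (Fin.castLE hmn))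
    (LinearMap.funLeft k k (Fin.castLE hmn))
    (by
      refine LinearMap.ext fun v => funext fun i => ?_
      exact (Fin.castLE_injective hmn).extend_apply v 0 i) j

end ProjectiveSpace

end

end PolyOmega

/-! The diagonal torus acts on everything, so the Čech complex for the n coordinate open sets splits
into pieces indexed by weights a ∈ ℤ^n with ∑ a_i = e. A section of weight a, over the locus where
the coordinates in I are invertible, is determined by its value x at (1, …, 1). If x = ∑ x_b is the
decomposition into torus weights b ∈ ℕ^n of P((k^n)^∨), the section is v ↦ ∑ v^(a-b) x_b
(`weightSection`). It is regular as soon as x_b = 0 whenever b_i > a_i for some i ∉ I, and all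
regular sections are finite sums of such (`IsSec.exists_coeffs`). The weight a complex therefore
consists of subspaces `coeffSpace` of the fibre at (1, …, 1).

The heart is `exists_altSum_eq_of_supported`: fix ν and take weight a cochains supported on tuples
that contain ν. The components x_b leave the fibre, but pushing them back with the projection ξ ↦ ξ
- ξ(1) x_ν changes weights only triangularly away from ν. So the complex can be treated one b at a
time. If b_i ≤ a_i for some i ≠ ν, inserting i in front of a tuple is a contracting homotopy. If b_i
> a_i for all i ≠ ν, then b contributes only to tuples using every index, so not below degree n - 1.
It contributes nowhere if d < e - a_ν + n - 1, since a contribution forces b_ν = 0 and ∑ b_i = d.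

If a_ν < 0, all weight a cochains are supported on tuples containing ν, because b_ν ≥ 0. For e < 0
every weight has such a ν, which gives the vanishing. For e = 0 only the weight a = 0 can survive,
so the torus acts trivially; the kernel of the GL_n action is then a normal subgroup containing all
diagonal matrices, hence everything. For a hyperplane, weight zero sections over opens not involving
the last index do not see the last coordinate. The remaining tuples contain the last index and form
an exact complex by the same lemma, which yields stabilization. For j > d one either has more
degrees than open sets, or stabilizes down to ℙ^d, where this is the case.

The cohomology is defined by the cover by all hyperplane complements. `isCob_of_restrict` and
`exists_cocycle_extension` pass to the coordinate cover, by partitions of unity that vanish to high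
order along the coordinate hyperplanes. -/

namespace PolyOmega

noncomputable section

section

/-! ### Polynomial functions, Laurent monomials and exponential sums on the torus -/

section Polynomials

variable {k : Type u} [Field k] {n : ℕ}

lemma mem_polyFun_iff {f : (Fin n → k) → k} :
    f ∈ polyFun k (Fin n → k) ↔ ∃ q : MvPolynomial (Fin n) k, ∀ v, f v = MvPolynomial.eval v q := by
  have key : polyFun k (Fin n → k) =
      (MvPolynomial.aeval (R := k) (fun i : Fin n => fun v : Fin n → k => v i)).range := by
    rw [← Algebra.adjoin_range_eq_range_aeval]
    refine le_antisymm (Algebra.adjoin_le ?_) (Algebra.adjoin_mono ?_)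
    · rintro _ ⟨φ, rfl⟩
      change (φ : (Fin n → k) → k) ∈
        Algebra.adjoin k (Set.range fun (i : Fin n) (v : Fin n → k) => v i)
      have : (φ : (Fin n → k) → k) =
          ∑ i, φ (Pi.single i 1) • (fun v : Fin n → k => v i) := by
        funext v
        rw [Finset.sum_apply]
        conv_lhs => rw [LinearMap.pi_apply_eq_sum_univ φ v]
        refine Finset.sum_congr rfl fun i _ => ?_
        have hs : (fun j => if i = j then (1 : k) else 0) = Pi.single i 1 := by
          funext j
          simp [Pi.single_apply, eq_comm]
        rw [hs, Pi.smul_apply, smul_eq_mul, smul_eq_mul, mul_comm]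
      rw [this]
      exact Subalgebra.sum_mem _ fun i _ => Subalgebra.smul_mem _
        (Algebra.subset_adjoin
          (Set.mem_range_self (f := fun (i : Fin n) (v : Fin n → k) => v i) i)) _
    · rintro _ ⟨i, rfl⟩
      exact ⟨LinearMap.proj i, rfl⟩
  have ev : ∀ (q : MvPolynomial (Fin n) k) (v : Fin n → k),
      MvPolynomial.aeval (R := k) (fun i : Fin n => fun v : Fin n → k => v i) q v =
        MvPolynomial.eval v q := by
    intro q v
    induction q using MvPolynomial.induction_on with
    | C a => simp [Pi.algebraMap_apply]
    | add p q hp hq => simp only [map_add, Pi.add_apply, hp, hq]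
    | mul_X p i hp => simp only [map_mul, Pi.mul_apply, hp, MvPolynomial.aeval_X,
        MvPolynomial.eval_X]
  rw [key, AlgHom.mem_range]
  constructor
  · rintro ⟨q, rfl⟩
    exact ⟨q, ev q⟩
  · rintro ⟨q, hq⟩
    exact ⟨q, funext fun v => by rw [ev, hq]⟩

/-- The Laurent monomial with exponent vector `a`. -/
def mon (a : Fin n → ℤ) (v : Fin n → k) : k := ∏ i, v i ^ a i

/-- An exponent vector in `ℕ^n`, seen in `ℤ^n`. -/
abbrev natExp (b : Fin n → ℕ) : Fin n → ℤ := fun i => (b i : ℤ)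

lemma natExp_injective : Function.Injective (natExp (n := n)) := fun b c h =>
  funext fun i => by exact_mod_cast congrFun h i

lemma mon_natExp (b : Fin n → ℕ) (v : Fin n → k) : mon (natExp b) v = ∏ i, v i ^ b i := by
  simp [mon]

lemma mon_add {v : Fin n → k} (hv : ∀ i, v i ≠ 0) (a b : Fin n → ℤ) :
    mon (a + b) v = mon a v * mon b v := by
  simp only [mon, Pi.add_apply, ← Finset.prod_mul_distrib]
  exact Finset.prod_congr rfl fun i _ => zpow_add₀ (hv i) _ _

lemma mon_mul (a : Fin n → ℤ) (v w : Fin n → k) : mon a (v * w) = mon a v * mon a w := by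
  simp only [mon, Pi.mul_apply, mul_zpow, Finset.prod_mul_distrib]

lemma mon_zero (v : Fin n → k) : mon (0 : Fin n → ℤ) v = 1 := by simp [mon]

lemma mon_one (a : Fin n → ℤ) : mon a (1 : Fin n → k) = 1 := by simp [mon]

lemma mon_smul (a : Fin n → ℤ) {c : k} (hc : c ≠ 0) (v : Fin n → k) :
    mon a (c • v) = c ^ (∑ i, a i) * mon a v := by
  have h : c ^ (∑ i, a i) = ∏ i, c ^ a i := by
    induction (Finset.univ : Finset (Fin n)) using Finset.induction_on with
    | empty => simp
    | insert i s hi ih => rw [Finset.sum_insert hi, Finset.prod_insert hi, zpow_add₀ hc, ih]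
  simp only [mon, Pi.smul_apply, smul_eq_mul, mul_zpow, Finset.prod_mul_distrib, h]

lemma mon_natExp_mem_polyFun (b : Fin n → ℕ) :
    (fun v : Fin n → k => mon (natExp b) v) ∈ polyFun k (Fin n → k) :=
  mem_polyFun_iff.2 ⟨∏ i, MvPolynomial.X i ^ b i, fun v => by simp [mon_natExp]⟩

section ExpSum

variable {J : Type*} {W : Type*} [AddCommGroup W] [Module k W]

/-- The vector valued exponential sum `∑ v^{ε j} w_j`. -/
def expSum (ε : J → Fin n → ℤ) (v : Fin n → k) : (J →₀ W) →ₗ[k] W :=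
  Finsupp.lsum k fun j => mon (ε j) v • LinearMap.id

lemma expSum_apply (ε : J → Fin n → ℤ) (v : Fin n → k) (G : J →₀ W) :
    expSum ε v G = G.sum fun j w => mon (ε j) v • w := rfl

lemma expSum_single (ε : J → Fin n → ℤ) (v : Fin n → k) (j : J) (w : W) :
    expSum ε v (Finsupp.single j w) = mon (ε j) v • w := by
  simp [expSum]

lemma exists_unit_zpow_ne_one [Infinite k] {m : ℤ} (hm : m ≠ 0) : ∃ u : kˣ, u ^ m ≠ 1 := by
  by_contra! h
  have hN : m.natAbs ≠ 0 := Int.natAbs_ne_zero.2 hm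
  have h' : ∀ u : kˣ, u ^ m.natAbs = 1 := fun u => by
    rcases Int.natAbs_eq m with h1 | h1
    · have := h u
      rw [h1] at this
      exact_mod_cast this
    · have := h u
      rw [h1, zpow_neg, inv_eq_one] at this
      exact_mod_cast this
  have hp : (Polynomial.X ^ m.natAbs - 1 : Polynomial k) * Polynomial.X = 0 := by
    refine Polynomial.funext fun x => ?_
    by_cases hx : x = 0
    · simp [hx]
    · have := congrArg Units.val (h' (Units.mk0 x hx))
      simp at this
      simp [this]
  rcases mul_eq_zero.1 hp with h0 | h0
  · have := congrArg (Polynomial.eval 0) h0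
    simp [hN] at this
  · exact Polynomial.X_ne_zero h0

/-- The character of the torus given by an exponent vector. -/
def torusChar (a : Fin n → ℤ) : (Fin n → kˣ) →* k where
  toFun t := mon a fun i => (t i : k)
  map_one' := by simp [mon]
  map_mul' s t := by
    rw [← mon_mul]
    rfl

lemma torusChar_injective [Infinite k] :
    Function.Injective (torusChar (k := k) (n := n)) := by
  intro a a' h
  funext i
  by_contra hne
  obtain ⟨u, hu⟩ := exists_unit_zpow_ne_one (k := k) (sub_ne_zero.2 hne)
  apply hu
  have ht : ∀ b : Fin n → ℤ, torusChar b (Pi.mulSingle i u) = (u : k) ^ b i := by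
    intro b
    change mon b _ = _
    rw [mon, Finset.prod_eq_single i]
    · simp
    · intro j _ hj
      simp [hj]
    · simp
  have := DFunLike.congr_fun h (Pi.mulSingle i u)
  rw [ht, ht] at this
  rw [zpow_sub, mul_inv_eq_one]
  exact Units.ext (by simpa using this)

/-- Dedekind's independence of characters, applied after composing with each linear functional on
`W`. All comparisons of coefficients in the proof rest on this. -/
lemma expSum_eq_zero [Infinite k] {ε : J → Fin n → ℤ} (hε : Function.Injective ε) {G : J →₀ W}
    (h : ∀ t : Fin n → k, (∀ i, t i ≠ 0) → expSum ε t G = 0) : G = 0 := by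
  have li := (linearIndependent_monoidHom (Fin n → kˣ) k).comp (fun j => torusChar (ε j))
    (torusChar_injective.comp hε)
  ext j
  rw [Finsupp.zero_apply, ← Module.forall_dual_apply_eq_zero_iff k]
  intro ψ
  have := linearIndependent_iff.1 li (G.mapRange ψ (map_zero ψ)) (by
    funext t
    have := congrArg ψ (h (fun i => (t i : k)) fun i => (t i).ne_zero)
    rw [map_zero, expSum_apply, Finsupp.sum, map_sum] at this
    rw [Finsupp.linearCombination_apply, Finsupp.sum_mapRange_index (by simp), Finsupp.sum,
      Finset.sum_apply, Pi.zero_apply, ← this]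
    refine Finset.sum_congr rfl fun j _ => ?_
    rw [map_smul, smul_eq_mul, mul_comm]
    rfl)
  simpa using DFunLike.congr_fun this j

lemma expSum_injective [Infinite k] {ε : J → Fin n → ℤ} (hε : Function.Injective ε)
    {G G' : J →₀ W} (h : ∀ t : Fin n → k, (∀ i, t i ≠ 0) → expSum ε t G = expSum ε t G') :
    G = G' :=
  sub_eq_zero.1 <| expSum_eq_zero hε fun t ht => by rw [map_sub, h t ht, sub_self]

end ExpSum

section PolyMaps

variable {W : Type u} [AddCommGroup W] [Module k W]

lemma IsPolyMap.sum {E : Type u} [AddCommGroup E] [Module k E] {ι : Type*} (s : Finset ι)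
    {f : ι → E → W} (hf : ∀ i ∈ s, IsPolyMap k (f i)) : IsPolyMap k fun v => ∑ i ∈ s, f i v := by
  intro ψ
  simp only [map_sum]
  have h := Subalgebra.sum_mem (polyFun k E) (t := s) (f := fun i v => ψ (f i v))
    fun i hi => hf i hi ψ
  convert h using 1
  funext v
  simp

lemma IsPolyMap.const_smul_mem {E : Type u} [AddCommGroup E] [Module k E] {h : E → k}
    (hh : h ∈ polyFun k E) (w : W) : IsPolyMap k fun v => h v • w := fun ψ => by
  simp only [map_smul, smul_eq_mul, mul_comm _ (ψ w)]
  exact (polyFun k E).smul_mem hh (ψ w)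

lemma IsPolyMap.exists_expansion [Module.Finite k W] {f : (Fin n → k) → W} (hf : IsPolyMap k f) :
    ∃ F : (Fin n → ℕ) →₀ W, ∀ v, f v = expSum natExp v F := by
  let B := Module.finBasis k W
  choose q hq using fun i => mem_polyFun_iff.1 (hf (B.coord i))
  refine ⟨∑ i, ∑ c ∈ (q i).support, Finsupp.single (fun j => c j) ((q i).coeff c • B i),
    fun v => ?_⟩
  simp only [map_sum, expSum_single]
  conv_lhs => rw [← B.sum_repr (f v)]
  refine Finset.sum_congr rfl fun i _ => ?_
  have := hq i v
  rw [Module.Basis.coord_apply] at this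
  rw [this, MvPolynomial.eval_eq', Finset.sum_smul]
  refine Finset.sum_congr rfl fun c _ => ?_
  rw [mon_natExp, smul_smul, mul_comm]

/-- A polynomial map that vanishes on the torus vanishes. -/
lemma IsPolyMap.eq_zero_of_torus [Infinite k] [Module.Finite k W] {f : (Fin n → k) → W}
    (hf : IsPolyMap k f) (h : ∀ t : Fin n → k, (∀ i, t i ≠ 0) → f t = 0) (v : Fin n → k) :
    f v = 0 := by
  obtain ⟨F, hF⟩ := hf.exists_expansion
  have : F = 0 := expSum_eq_zero natExp_injective fun t ht => by rw [← hF, h t ht]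
  rw [hF, this, map_zero]

end PolyMaps

/-! ### Global denominators from the Nullstellensatz -/

section Nullstellensatz

lemma dual_mem_polyFun {E : Type u} [AddCommGroup E] [Module k E] (φ : Module.Dual k E) :
    (fun v => φ v) ∈ polyFun k E := Algebra.subset_adjoin ⟨φ, rfl⟩

lemma prod_mem_polyFun {E : Type u} [AddCommGroup E] [Module k E] {ι : Type*} (s : Finset ι)
    {h : ι → E → k} (hh : ∀ i ∈ s, h i ∈ polyFun k E) :
    (fun v => ∏ i ∈ s, h i v) ∈ polyFun k E := by
  have := Subalgebra.prod_mem (polyFun k E) hh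
  convert this using 1
  funext v
  simp

lemma pow_mem_polyFun {E : Type u} [AddCommGroup E] [Module k E] {h : E → k}
    (hh : h ∈ polyFun k E) (N : ℕ) : (fun v => h v ^ N) ∈ polyFun k E :=
  Subalgebra.pow_mem (polyFun k E) hh N

/-- A function that is locally on `inter ℓ` a quotient of polynomials has a power of the product of
the forms `ℓ i` as a global denominator. -/
lemma exists_global_denominator [IsAlgClosed k] {W : Type u} [AddCommGroup W] [Module k W] {p : ℕ}
    {ℓ : Fin (p + 1) → Module.Dual k (Fin n → k)}
    {f : inter ℓ → W}
    (hf : ∀ v : inter ℓ, ∃ h ∈ polyFun k (Fin n → k), ∃ F : (Fin n → k) → W, IsPolyMap k F ∧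
      h v ≠ 0 ∧ ∀ w : inter ℓ, h w ≠ 0 → h w • f w = F w) :
    ∃ (N : ℕ) (F : (Fin n → k) → W), IsPolyMap k F ∧
      ∀ v : inter ℓ, (∏ i, ℓ i v) ^ N • f v = F v := by
  -- The ideal of denominators of `f`. Its zero locus misses `inter ℓ`, so the product of the `ℓ i`
  -- vanishes on that locus and lies in the radical.
  let I : Ideal (MvPolynomial (Fin n) k) :=
    { carrier := {q | ∃ F : (Fin n → k) → W, IsPolyMap k F ∧
        ∀ w : inter ℓ, MvPolynomial.eval (w : Fin n → k) q • f w = F w}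
      add_mem' := by
        rintro q q' ⟨F, hF, h⟩ ⟨F', hF', h'⟩
        exact ⟨_, hF.add hF', fun w => by rw [map_add, add_smul, h, h']⟩
      zero_mem' := ⟨_, IsPolyMap.zero, fun w => by simp⟩
      smul_mem' := by
        rintro c q ⟨F, hF, h⟩
        exact ⟨_, IsPolyMap.mul (mem_polyFun_iff.2 ⟨c, fun _ => rfl⟩) hF, fun w => by
          rw [smul_eq_mul, map_mul, mul_smul, h]⟩ }
  obtain ⟨m, hm⟩ := mem_polyFun_iff.1
    (prod_mem_polyFun Finset.univ fun i _ => dual_mem_polyFun (ℓ i))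
  have hrad : m ∈ I.radical := by
    rw [← MvPolynomial.vanishingIdeal_zeroLocus_eq_radical (K := k),
      MvPolynomial.mem_vanishingIdeal_iff]
    intro v hv
    rw [MvPolynomial.mem_zeroLocus_iff] at hv
    rw [MvPolynomial.aeval_eq_eval, ← hm v]
    by_contra hne
    have hvU : v ∈ inter ℓ := fun i => (Finset.prod_ne_zero_iff.1 hne) i (Finset.mem_univ i)
    obtain ⟨h, hh, F, hF, h0, H⟩ := hf ⟨v, hvU⟩
    obtain ⟨q, hq⟩ := mem_polyFun_iff.1 hh
    -- The local identity is known only where `h` is nonzero; a second factor `h` makes it hold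
    -- everywhere.
    have hqI : q * q ∈ I := by
      refine ⟨_, IsPolyMap.mul hh hF, fun w => ?_⟩
      rw [map_mul, ← hq, mul_smul]
      by_cases hw : h w = 0
      · rw [hw, zero_smul, zero_smul]
      · rw [H w hw]
    have := hv _ hqI
    rw [MvPolynomial.aeval_eq_eval, map_mul, ← hq] at this
    exact mul_ne_zero h0 h0 this
  obtain ⟨N, F, hF, H⟩ := hrad
  refine ⟨N, F, hF, fun v => ?_⟩
  rw [← H v, map_pow, ← hm]

end Nullstellensatz

end Polynomials

end

section

/-! ### Alternating sums over faces -/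

section AlternatingSums

variable {α N N' : Type*} [AddCommGroup N] [AddCommGroup N']

/-- The alternating sum over the faces of a tuple. -/
def altSum {p : ℕ} : ((Fin (p + 1) → α) → N) →+ ((Fin (p + 2) → α) → N) where
  toFun c σ := ∑ i : Fin (p + 2), (-1 : ℤ) ^ (i : ℕ) • c fun j => σ (i.succAbove j)
  map_zero' := by
    funext σ
    simp
  map_add' c c' := by
    funext σ
    simp [smul_add, Finset.sum_add_distrib]

lemma altSum_apply {p : ℕ} (c : (Fin (p + 1) → α) → N) (σ : Fin (p + 2) → α) :
    altSum c σ = ∑ i : Fin (p + 2), (-1 : ℤ) ^ (i : ℕ) • c fun j => σ (i.succAbove j) := rfl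

lemma altSum_comp {p : ℕ} (f : N →+ N') (c : (Fin (p + 1) → α) → N) (σ : Fin (p + 2) → α) :
    altSum (fun τ => f (c τ)) σ = f (altSum c σ) := by
  simp only [altSum_apply, map_sum, map_zsmul]

lemma altSum_cons_aux {p : ℕ} (c : (Fin (p + 1) → α) → N) (a : α) (σ : Fin (p + 1) → α) :
    altSum c (Fin.cons a σ : Fin (p + 2) → α) = c σ - ∑ i : Fin (p + 1), (-1 : ℤ) ^ (i : ℕ) •
      c fun j => (Fin.cons a σ : Fin (p + 2) → α) (i.succ.succAbove j) := by
  rw [altSum_apply, Fin.sum_univ_succ, sub_eq_add_neg, ← Finset.sum_neg_distrib]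
  congr 1
  · simp
  · refine Finset.sum_congr rfl fun i _ => ?_
    rw [Fin.val_succ, pow_succ, mul_neg_one, neg_smul]

/-- The cone identity: on cocycles, inserting `a` in front is a contracting homotopy. Every
exactness argument below is a variant of it, and it also gives δ² = 0 by induction. -/
lemma altSum_cons {p : ℕ} (c : (Fin (p + 2) → α) → N) (a : α) (σ : Fin (p + 2) → α) :
    altSum c (Fin.cons a σ : Fin (p + 3) → α) =
      c σ - altSum (fun τ : Fin (p + 1) → α => c (Fin.cons a τ)) σ := by
  rw [altSum_cons_aux, altSum_apply]
  congr 1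
  refine Finset.sum_congr rfl fun i _ => ?_
  congr 2
  funext j
  refine Fin.cases ?_ (fun j => ?_) j
  · simp
  · simp

lemma altSum_cons_zero (c : (Fin 1 → α) → N) (a : α) (σ : Fin 1 → α) :
    altSum c (Fin.cons a σ : Fin 2 → α) = c σ - c fun _ => a := by
  rw [altSum_cons_aux]
  congr 1
  rw [Fin.sum_univ_one, Fin.val_zero, pow_zero, one_smul]
  congr 1
  funext j
  obtain rfl : j = 0 := Fin.ext (by omega)
  rfl

lemma altSum_altSum {p : ℕ} (c : (Fin (p + 1) → α) → N) : altSum (altSum c) = 0 := by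
  induction p with
  | zero =>
    funext σ
    rw [← Fin.cons_self_tail σ, altSum_cons]
    simp only [altSum_cons_zero]
    have : (fun τ : Fin 1 → α => c τ - c fun _ => σ 0) = c - fun _ => c fun _ => σ 0 := rfl
    rw [this, map_sub, Pi.sub_apply, sub_sub_cancel, altSum_apply]
    simp [Fin.sum_univ_two]
  | succ p ih =>
    funext σ
    rw [← Fin.cons_self_tail σ, altSum_cons]
    simp only [altSum_cons]
    have : (fun τ : Fin (p + 2) → α => c τ - altSum (fun ρ => c (Fin.cons (σ 0) ρ)) τ) =
      c - altSum (fun ρ => c (Fin.cons (σ 0) ρ)) := rfl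
    rw [this, map_sub, ih, sub_zero, sub_self]
    rfl

lemma altSum_congr {p : ℕ} {c c' : (Fin (p + 1) → α) → N} {σ : Fin (p + 2) → α}
    (h : ∀ i : Fin (p + 2), c (fun j => σ (i.succAbove j)) = c' fun j => σ (i.succAbove j)) :
    altSum c σ = altSum c' σ := by
  simp only [altSum_apply, h]

lemma altSum_congr_apply {β : Type*} {p : ℕ} {c c' : (Fin (p + 1) → α) → β → N}
    {σ : Fin (p + 2) → α} {v : β}
    (h : ∀ i : Fin (p + 2), c (fun j => σ (i.succAbove j)) v = c' (fun j => σ (i.succAbove j)) v) :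
    altSum c σ v = altSum c' σ v := by
  simp only [altSum_apply, Finset.sum_apply, Pi.smul_apply, h]

lemma altSum_apply_apply {β : Type*} {p : ℕ} (c : (Fin (p + 1) → α) → β → N)
    (σ : Fin (p + 2) → α) (v : β) : altSum c σ v = altSum (fun τ => c τ v) σ := by
  simp only [altSum_apply, Finset.sum_apply, Pi.smul_apply]

lemma neg_one_zpow_smul (k : Type*) [Field k] [Module k N] (i : ℕ) (x : N) :
    (-1 : ℤ) ^ i • x = (-1 : k) ^ i • x := by
  rcases Nat.even_or_odd i with h | h
  · simp [h.neg_one_pow]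
  · simp [h.neg_one_pow]

end AlternatingSums

variable {k : Type u} [Field k] (P : FGModuleCat.{u} k ⥤ FGModuleCat.{u} k) (d : ℕ) (e : ℤ)

/-! ### Sections and Čech cochains represented by functions on the whole space -/

section Sections

variable {E : Type u} [AddCommGroup E] [Module k E] [Module.Finite k E]

/-- The restriction of `f` to `U` is a section of `P(Ω)(e)`. -/
def IsSec (U : Set E) (f : E → Val P E) : Prop := (fun v : U => f v) ∈ sections P d e U

variable {P d e} {U U' : Set E} {f g : E → Val P E}

lemma IsSec.zero : IsSec P d e U 0 := (sections P d e U).zero_mem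

lemma IsSec.add (hf : IsSec P d e U f) (hg : IsSec P d e U g) : IsSec P d e U (f + g) :=
  (sections P d e U).add_mem hf hg

lemma IsSec.sub (hf : IsSec P d e U f) (hg : IsSec P d e U g) : IsSec P d e U (f - g) :=
  (sections P d e U).sub_mem hf hg

lemma IsSec.sum {ι : Type*} {s : Finset ι} {f : ι → E → Val P E}
    (hf : ∀ i ∈ s, IsSec P d e U (f i)) : IsSec P d e U (∑ i ∈ s, f i) := by
  have := (sections P d e U).sum_mem hf
  unfold IsSec
  convert this using 1
  funext v
  simp

lemma IsSec.zsmul (a : ℤ) (hf : IsSec P d e U f) : IsSec P d e U (a • f) :=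
  (sections P d e U).toAddSubgroup.zsmul_mem hf a

lemma IsSec.mono (hf : IsSec P d e U f) (h : U' ⊆ U) : IsSec P d e U' f :=
  (restrict P d e h ⟨_, hf⟩).2

lemma IsSec.congr (hf : IsSec P d e U f) (h : ∀ v ∈ U, g v = f v) : IsSec P d e U g := by
  have : (fun v : U => g v) = fun v : U => f v := funext fun v => h v v.2
  unfold IsSec
  rwa [this]

lemma IsSec.map_smul (hf : IsSec P d e U f) (c : kˣ) {v : E} (hv : v ∈ U)
    (hcv : (c : k) • v ∈ U) : f ((c : k) • v) = (c : k) ^ (e - d) • f v :=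
  hf.2.1 c ⟨v, hv⟩ ⟨_, hcv⟩ rfl

lemma IsSec.mem_fibre (hf : IsSec P d e U f) {v : E} (hv : v ∈ U) : f v ∈ fibre P v :=
  hf.2.2 ⟨v, hv⟩

lemma IsSec.of_denominator {h : E → k} {F : E → Val P E} (hh : h ∈ polyFun k E)
    (hF : IsPolyMap k F) (hfF : ∀ v ∈ U, h v ≠ 0 ∧ h v • f v = F v)
    (hom : ∀ (c : kˣ) (v : E), v ∈ U → (c : k) • v ∈ U → f ((c : k) • v) = (c : k) ^ (e - d) • f v)
    (hfib : ∀ v ∈ U, f v ∈ fibre P v) : IsSec P d e U f := by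
  refine ⟨fun v => ⟨h, hh, F, hF, (hfF v v.2).1, fun w _ => (hfF w w.2).2⟩, fun c v w hvw => ?_,
    fun v => hfib v v.2⟩
  have := hom c v v.2 (hvw ▸ w.2)
  rw [← hvw] at this
  exact this

lemma smul_mem_inter {E : Type u} [AddCommGroup E] [Module k E] {p : ℕ}
    {ℓ : Fin (p + 1) → Module.Dual k E} {v : E} {c : k} (hc : c ≠ 0)
    (hv : v ∈ inter ℓ) : c • v ∈ inter ℓ := fun i => by
  rw [_root_.map_smul]
  exact mul_ne_zero hc (hv i)

lemma IsSec.pull {F : Type u} [AddCommGroup F] [Module k F] [Module.Finite k F] (φ : E →ₗ[k] F)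
    {U' : Set F} {f : F → Val P F} (hf : IsSec P d e U' f) (h : ∀ v ∈ U, φ v ∈ U') :
    IsSec P d e U fun v => mapLin P φ.dualMap (f (φ v)) :=
  (pullSection P d e φ h ⟨_, hf⟩).2

end Sections

section Cochains

variable {E : Type u} [AddCommGroup E] [Module k E] [Module.Finite k E] {α : Type*}
  (X : α → Module.Dual k E) {p : ℕ}

/-- Čech cochains for the cover by the sets `D₊(X a)`, represented by functions on `E`. -/
def IsCochain (c : (Fin (p + 1) → α) → E → Val P E) : Prop :=
  ∀ σ, IsSec P d e (inter fun i => X (σ i)) (c σ)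

/-- The Čech cocycle condition. -/
def IsClosed (c : (Fin (p + 1) → α) → E → Val P E) : Prop :=
  ∀ σ : Fin (p + 2) → α, ∀ v ∈ inter fun i => X (σ i), altSum c σ v = 0

/-- Čech coboundaries. -/
def IsCob : ∀ {p : ℕ}, ((Fin (p + 1) → α) → E → Val P E) → Prop
  | 0, c => ∀ σ : Fin 1 → α, ∀ v ∈ inter fun i => X (σ i), c σ v = 0
  | p + 1, c => ∃ b : (Fin (p + 1) → α) → E → Val P E, IsCochain P d e X b ∧
      ∀ σ, ∀ v ∈ inter fun i => X (σ i), c σ v = altSum b σ v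

variable {P d e X}

lemma IsCochain.add {c c' : (Fin (p + 1) → α) → E → Val P E} (hc : IsCochain P d e X c)
    (hc' : IsCochain P d e X c') : IsCochain P d e X (c + c') := fun σ => (hc σ).add (hc' σ)

lemma IsCochain.sub {c c' : (Fin (p + 1) → α) → E → Val P E} (hc : IsCochain P d e X c)
    (hc' : IsCochain P d e X c') : IsCochain P d e X (c - c') := fun σ => (hc σ).sub (hc' σ)

lemma inter_face_mem {E : Type u} [AddCommGroup E] [Module k E] {α : Type*}
    {X : α → Module.Dual k E} {p : ℕ} {σ : Fin (p + 2) → α} {v : E}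
    (hv : v ∈ inter fun i => X (σ i))
    (i : Fin (p + 2)) : v ∈ inter fun j => X (σ (i.succAbove j)) := fun j => hv (i.succAbove j)

lemma IsCochain.altSum {c : (Fin (p + 1) → α) → E → Val P E} (hc : IsCochain P d e X c) :
    IsCochain P d e X (PolyOmega.altSum c) := fun σ => by
  exact IsSec.sum (s := Finset.univ)
    (f := fun i : Fin (p + 2) => (-1 : ℤ) ^ (i : ℕ) • c fun j => σ (i.succAbove j))
    fun i _ => ((hc _).mono fun _ hv => inter_face_mem hv i).zsmul _

lemma IsClosed.sub {c c' : (Fin (p + 1) → α) → E → Val P E} (hc : IsClosed P X c)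
    (hc' : IsClosed P X c') : IsClosed P X (c - c') := fun σ v hv => by
  rw [map_sub, Pi.sub_apply, Pi.sub_apply, hc σ v hv, hc' σ v hv, sub_zero]

lemma isClosed_altSum (c : (Fin (p + 1) → α) → E → Val P E) : IsClosed P X (altSum c) :=
  fun σ v _ => by rw [altSum_altSum]; rfl

lemma IsClosed.congr {c c' : (Fin (p + 1) → α) → E → Val P E} (hc : IsClosed P X c)
    (h : ∀ σ, ∀ v ∈ inter fun i => X (σ i), c' σ v = c σ v) : IsClosed P X c' := fun σ v hv => by
  rw [← hc σ v hv]
  exact altSum_congr_apply fun i => h _ v (inter_face_mem hv i)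

lemma IsCob.congr {c c' : (Fin (p + 1) → α) → E → Val P E} (hc : IsCob P d e X c)
    (h : ∀ σ, ∀ v ∈ inter fun i => X (σ i), c' σ v = c σ v) : IsCob P d e X c' := by
  cases p with
  | zero => exact fun σ v hv => (h σ v hv).trans (hc σ v hv)
  | succ p =>
    obtain ⟨b, hb, hcb⟩ := hc
    exact ⟨b, hb, fun σ v hv => (h σ v hv).trans (hcb σ v hv)⟩

lemma IsCob.add {c c' : (Fin (p + 1) → α) → E → Val P E} (hc : IsCob P d e X c)
    (hc' : IsCob P d e X c') : IsCob P d e X (c + c') := by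
  cases p with
  | zero =>
    intro σ v hv
    have h := hc σ v hv
    have h' := hc' σ v hv
    rw [Pi.add_apply, Pi.add_apply, h, h', add_zero]
  | succ p =>
    obtain ⟨b, hb, hcb⟩ := hc
    obtain ⟨b', hb', hcb'⟩ := hc'
    refine ⟨b + b', hb.add hb', fun σ v hv => ?_⟩
    rw [Pi.add_apply, Pi.add_apply, hcb σ v hv, hcb' σ v hv, map_add, Pi.add_apply, Pi.add_apply]

lemma IsCob.altSum {b : (Fin (p + 1) → α) → E → Val P E} (hb : IsCochain P d e X b) :
    IsCob P d e X (altSum b) := ⟨b, hb, fun _ _ _ => rfl⟩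

end Cochains

/-! ### Translation between function families and the Čech complex of the definition -/

section Comparison

variable {E : Type u} [AddCommGroup E] [Module k E] [Module.Finite k E] {p : ℕ}
  {P d e}

open Classical in
/-- The family of functions underlying a Čech cochain, extended by zero. -/
def cochainFun (c : Cochain P d e E p) : (Fin (p + 1) → Module.Dual k E) → E → Val P E :=
  fun ℓ v => if h : v ∈ inter ℓ then (c ℓ).1 ⟨v, h⟩ else 0

lemma cochainFun_of_mem (c : Cochain P d e E p) {ℓ : Fin (p + 1) → Module.Dual k E} {v : E}
    (h : v ∈ inter ℓ) : cochainFun c ℓ v = (c ℓ).1 ⟨v, h⟩ := dif_pos h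

lemma cochainFun_isCochain (c : Cochain P d e E p) : IsCochain P d e id (cochainFun c) := by
  intro ℓ
  have : (fun v : inter ℓ => cochainFun c ℓ v) = (c ℓ).1 :=
    funext fun v => cochainFun_of_mem c v.2
  change (fun v : inter ℓ => cochainFun c ℓ v) ∈ sections P d e (inter ℓ)
  rw [this]
  exact (c ℓ).2

/-- The Čech cochain given by a family of functions. -/
def IsCochain.toCochain {c : (Fin (p + 1) → Module.Dual k E) → E → Val P E}
    (hc : IsCochain P d e id c) : Cochain P d e E p := fun ℓ => ⟨fun v => c ℓ v, hc ℓ⟩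

lemma cochainFun_delta (c : Cochain P d e E p) (ℓ : Fin (p + 2) → Module.Dual k E) {v : E}
    (hv : v ∈ inter ℓ) :
    cochainFun (delta P d e E p c) ℓ v = altSum (cochainFun c) ℓ v := by
  rw [cochainFun_of_mem _ hv, delta_apply, altSum_apply_apply, altSum_apply]
  refine Finset.sum_congr rfl fun i _ => ?_
  rw [neg_one_zpow_smul k, cochainFun_of_mem c (inter_face ℓ i hv)]

lemma cochain_ext {c c' : Cochain P d e E p}
    (h : ∀ ℓ, ∀ v ∈ inter ℓ, cochainFun c ℓ v = cochainFun c' ℓ v) : c = c' := by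
  funext ℓ
  ext v
  have := h ℓ v v.2
  rwa [cochainFun_of_mem _ v.2, cochainFun_of_mem _ v.2] at this

lemma mem_ker_delta_iff {c : Cochain P d e E p} :
    c ∈ LinearMap.ker (delta P d e E p) ↔ IsClosed P id (cochainFun c) := by
  rw [LinearMap.mem_ker]
  constructor
  · intro h ℓ v hv
    have hv' : v ∈ inter ℓ := hv
    rw [← cochainFun_delta c ℓ hv', h, cochainFun_of_mem _ hv']
    rfl
  · intro h
    refine cochain_ext fun ℓ v hv => ?_
    rw [cochainFun_delta c ℓ hv, h ℓ v hv, cochainFun_of_mem _ hv]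
    rfl

lemma mem_coboundaries_iff {c : Cochain P d e E p} :
    c ∈ coboundaries P d e E p ↔ IsCob P d e id (cochainFun c) := by
  cases p with
  | zero =>
    change c = 0 ↔ _
    constructor
    · rintro rfl ℓ v hv
      exact cochainFun_of_mem (0 : Cochain P d e E 0) hv
    · intro h
      refine cochain_ext fun ℓ v hv => ?_
      rw [h ℓ v hv, cochainFun_of_mem _ hv]
      rfl
  | succ p =>
    constructor
    · rintro ⟨b, rfl⟩
      exact ⟨_, cochainFun_isCochain b, fun ℓ v hv => cochainFun_delta b ℓ hv⟩
    · rintro ⟨b, hb, h⟩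
      refine ⟨hb.toCochain, cochain_ext fun ℓ v hv => ?_⟩
      rw [cochainFun_delta _ ℓ hv, h ℓ v hv]
      exact altSum_congr_apply fun i => cochainFun_of_mem _ (inter_face ℓ i hv)

lemma H_mk_eq_zero_iff (z : LinearMap.ker (delta P d e E p)) :
    (Submodule.Quotient.mk z : H P d e E p) = 0 ↔ IsCob P d e id (cochainFun z.1) := by
  rw [Submodule.Quotient.mk_eq_zero]
  exact mem_coboundaries_iff

lemma cochainFun_sub (c c' : Cochain P d e E p) (ℓ : Fin (p + 1) → Module.Dual k E) {v : E}
    (hv : v ∈ inter ℓ) :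
    cochainFun (c - c') ℓ v = cochainFun c ℓ v - cochainFun c' ℓ v := by
  rw [cochainFun_of_mem _ hv, cochainFun_of_mem _ hv, cochainFun_of_mem _ hv]
  rfl

lemma H_mk_eq_mk_iff (z z' : LinearMap.ker (delta P d e E p)) :
    (Submodule.Quotient.mk z : H P d e E p) = Submodule.Quotient.mk z' ↔
      IsCob P d e id (cochainFun z.1 - cochainFun z'.1) := by
  rw [← sub_eq_zero, ← Submodule.Quotient.mk_sub, H_mk_eq_zero_iff]
  have h : ∀ ℓ, ∀ v ∈ inter (fun i => id (ℓ i)), cochainFun (z - z').1 ℓ v =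
    (cochainFun z.1 - cochainFun z'.1) ℓ v := fun ℓ v hv => cochainFun_sub z.1 z'.1 ℓ hv
  exact ⟨fun hz => hz.congr fun ℓ v hv => (h ℓ v hv).symm, fun hz => hz.congr h⟩

/-- The Čech cocycle given by a family of functions. -/
def IsCochain.toCocycle {c : (Fin (p + 1) → Module.Dual k E) → E → Val P E}
    (hc : IsCochain P d e id c) (hc' : IsClosed P id c) : LinearMap.ker (delta P d e E p) :=
  ⟨hc.toCochain, mem_ker_delta_iff.2 <| hc'.congr fun _ _ hv => cochainFun_of_mem _ hv⟩

lemma IsCochain.cochainFun_toCocycle {c : (Fin (p + 1) → Module.Dual k E) → E → Val P E}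
    (hc : IsCochain P d e id c) (hc' : IsClosed P id c) {ℓ : Fin (p + 1) → Module.Dual k E}
    {v : E} (hv : v ∈ inter ℓ) : cochainFun (hc.toCocycle hc').1 ℓ v = c ℓ v :=
  cochainFun_of_mem _ hv

end Comparison

end

section

variable {k : Type u} [Field k] {n : ℕ}

/-- The coordinate forms on `k^n`. -/
def coordForm (i : Fin n) : Module.Dual k (Fin n → k) := LinearMap.proj i

@[simp] lemma coordForm_apply (i : Fin n) (v : Fin n → k) : coordForm i v = v i := rfl

lemma coord_mem_polyFun (i : Fin n) : (fun v : Fin n → k => v i) ∈ polyFun k (Fin n → k) := by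
  have h := dual_mem_polyFun (coordForm (k := k) i)
  exact h

lemma dual_apply_eq_sum (ℓ : Module.Dual k (Fin n → k)) (v : Fin n → k) :
    ℓ v = ∑ i, ℓ (Pi.single i 1) * v i := by
  conv_lhs => rw [LinearMap.pi_apply_eq_sum_univ ℓ v]
  refine Finset.sum_congr rfl fun i _ => ?_
  have hs : (fun j => if i = j then (1 : k) else 0) = Pi.single i 1 := by
    funext j
    simp [Pi.single_apply, eq_comm]
  rw [hs, smul_eq_mul, mul_comm]

/-! ### Partitions of unity vanishing to high order along coordinate hyperplanes -/

section PartitionOfUnity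

-- A high power of `∑ X_i` lies in the ideal generated by the `X_i ^ (M + 1)`; where the coordinates
-- add up to one, that power evaluates to 1.
variable (k) in
lemma exists_partitionPoly (n M : ℕ) : ∃ g : Fin n → MvPolynomial (Fin n) k, ∀ u : Fin n → k,
    ∑ i, u i = 1 → ∑ i, MvPolynomial.eval u (g i) * u i ^ (M + 1) = 1 := by
  have h := Ideal.sum_pow_mem_span_pow Finset.univ
    (fun i : Fin n => (MvPolynomial.X i : MvPolynomial (Fin n) k)) M
  rw [Finset.coe_univ, Set.image_univ, Ideal.mem_span_range_iff_exists_fun] at h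
  obtain ⟨g, hg⟩ := h
  refine ⟨g, fun u hu => ?_⟩
  have := congrArg (MvPolynomial.eval u) hg
  simpa [hu] using this

/-- The functions `ℓ(e_i) v_i / ℓ(v)`, whose sum is one. -/
def relCoord (ℓ : Module.Dual k (Fin n → k)) (v : Fin n → k) (i : Fin n) : k :=
  ℓ (Pi.single i 1) * v i / ℓ v

/-- A partition of unity on `D₊(ℓ)`; the `j`-th function vanishes to order `M + 1` along the `j`-th
coordinate hyperplane. -/
def partition (M : ℕ) (ℓ : Module.Dual k (Fin n → k)) (j : Fin n) (v : Fin n → k) : k :=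
  MvPolynomial.eval (relCoord ℓ v) ((exists_partitionPoly k n M).choose j) *
    relCoord ℓ v j ^ (M + 1)

variable {M : ℕ} {ℓ : Module.Dual k (Fin n → k)} {v : Fin n → k}

lemma sum_partition (hv : ℓ v ≠ 0) : ∑ j, partition M ℓ j v = 1 := by
  refine (exists_partitionPoly k n M).choose_spec _ ?_
  simp only [relCoord, ← Finset.sum_div, ← dual_apply_eq_sum, div_self hv]

lemma partition_eq_zero {j : Fin n} (hv : v j = 0) : partition M ℓ j v = 0 := by
  simp [partition, relCoord, hv]

lemma relCoord_smul {c : k} (hc : c ≠ 0) : relCoord ℓ (c • v) = relCoord ℓ v := by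
  funext i
  simp only [relCoord, map_smul, Pi.smul_apply, smul_eq_mul]
  rw [mul_left_comm, mul_div_mul_left _ _ hc]

lemma partition_smul {c : k} (hc : c ≠ 0) (j : Fin n) :
    partition M ℓ j (c • v) = partition M ℓ j v := by
  simp only [partition, relCoord_smul hc]

/-- For a multiple of `x_i` all relative coordinates except the `i`-th vanish, so only one term of
the partition remains. The scalar `a` is allowed for the sake of the torus action. -/
lemma partition_coordForm {i : Fin n} {a : k} (ha : a ≠ 0) (hv : v i ≠ 0) (j : Fin n) :
    partition M (a • coordForm i) j v = if j = i then 1 else 0 := by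
  have h : ∀ j, j ≠ i → partition M (a • coordForm i) j v = 0 := fun j hj => by
    simp [partition, relCoord, hj.symm]
  split_ifs with hj
  · have := sum_partition (M := M) (ℓ := a • coordForm i) (v := v) (by simp [ha, hv])
    rw [Finset.sum_eq_single i (fun j _ hj => h j hj) (by simp)] at this
    rw [hj, this]
  · exact h j hj

lemma exists_clear_denominator (ℓ : Module.Dual k (Fin n → k)) (g : MvPolynomial (Fin n) k) :
    ∃ N : ℕ, ∃ r ∈ polyFun k (Fin n → k), ∀ v, ℓ v ≠ 0 →
      ℓ v ^ N * MvPolynomial.eval (relCoord ℓ v) g = r v := by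
  induction g using MvPolynomial.induction_on with
  | C a =>
    exact ⟨0, algebraMap k _ a, Subalgebra.algebraMap_mem _ a, fun v _ => by
      simp [Pi.algebraMap_apply]⟩
  | add p q hp hq =>
    obtain ⟨N, r, hr, h⟩ := hp
    obtain ⟨N', r', hr', h'⟩ := hq
    refine ⟨N + N', fun v => ℓ v ^ N' * r v + ℓ v ^ N * r' v, Subalgebra.add_mem _
      (Subalgebra.mul_mem _ (pow_mem_polyFun (dual_mem_polyFun ℓ) N') hr)
      (Subalgebra.mul_mem _ (pow_mem_polyFun (dual_mem_polyFun ℓ) N) hr'), fun v hv => ?_⟩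
    simp only [← h v hv, ← h' v hv, map_add]
    ring
  | mul_X p i hp =>
    obtain ⟨N, r, hr, h⟩ := hp
    refine ⟨N + 1, fun v => r v * (ℓ (Pi.single i 1) * coordForm i v), Subalgebra.mul_mem _ hr
      (Subalgebra.smul_mem _ (dual_mem_polyFun (coordForm i)) (ℓ (Pi.single i 1))),
      fun v hv => ?_⟩
    simp only [← h v hv, map_mul, MvPolynomial.eval_X, coordForm_apply]
    rw [relCoord]
    field_simp
    ring

/-- The function `ρ` on `U` is regular, homogeneous of degree zero and divisible by `m ^ M`. -/
def DivisibleOn (U : Set (Fin n → k)) (m : (Fin n → k) → k) (M : ℕ) (ρ : (Fin n → k) → k) :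
    Prop :=
  (∃ h ∈ polyFun k (Fin n → k), ∃ r ∈ polyFun k (Fin n → k), ∀ v ∈ U,
    h v ≠ 0 ∧ h v * ρ v = m v ^ M * r v) ∧ ∀ (c : kˣ) (v : Fin n → k), ρ ((c : k) • v) = ρ v

lemma divisibleOn_partition (M : ℕ) (ℓ : Module.Dual k (Fin n → k)) (j : Fin n) :
    DivisibleOn {v | ℓ v ≠ 0} (fun v => v j) (M + 1) (partition M ℓ j) := by
  refine ⟨?_, fun c v => partition_smul c.ne_zero j⟩
  obtain ⟨N, r, hr, H⟩ := exists_clear_denominator ℓ ((exists_partitionPoly k n M).choose j)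
  refine ⟨fun v => ℓ v ^ (N + (M + 1)), pow_mem_polyFun (dual_mem_polyFun ℓ) _,
    fun v => ℓ (Pi.single j 1) ^ (M + 1) * r v,
    Subalgebra.smul_mem _ hr (ℓ (Pi.single j 1) ^ (M + 1)), fun v hv => ⟨pow_ne_zero _ hv, ?_⟩⟩
  have hv' : ℓ v ≠ 0 := hv
  simp only [partition]
  rw [← H v hv', pow_add, show relCoord ℓ v j = ℓ (Pi.single j 1) * v j / ℓ v from rfl, div_pow,
    mul_pow]
  field_simp

lemma DivisibleOn.mono {U U' : Set (Fin n → k)} {m : (Fin n → k) → k} {ρ : (Fin n → k) → k}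
    (h : DivisibleOn U m M ρ) (hU : U' ⊆ U) : DivisibleOn U' m M ρ := by
  obtain ⟨⟨q, hq, r, hr, H⟩, hom⟩ := h
  exact ⟨⟨q, hq, r, hr, fun v hv => H v (hU hv)⟩, hom⟩

lemma DivisibleOn.prod {ι : Type*} {s : Finset ι} {U : Set (Fin n → k)}
    {m : ι → (Fin n → k) → k} {ρ : ι → (Fin n → k) → k}
    (h : ∀ i ∈ s, DivisibleOn U (m i) M (ρ i)) :
    DivisibleOn U (fun v => ∏ i ∈ s, m i v) M fun v => ∏ i ∈ s, ρ i v := by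
  classical
  refine ⟨?_, fun c v => Finset.prod_congr rfl fun i hi => (h i hi).2 c v⟩
  choose! q hq r hr H using fun i (hi : i ∈ s) => (h i hi).1
  refine ⟨_, prod_mem_polyFun s hq, _, prod_mem_polyFun s hr, fun v hv =>
    ⟨Finset.prod_ne_zero_iff.2 fun i hi => (H i hi v hv).1, ?_⟩⟩
  rw [← Finset.prod_mul_distrib, ← Finset.prod_pow, ← Finset.prod_mul_distrib]
  exact Finset.prod_congr rfl fun i hi => (H i hi v hv).2

end PartitionOfUnity

/-! ### Extension by zero and lifting from the coordinate cover to all hyperplanes -/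

section Extension

variable [IsAlgClosed k] {P : FGModuleCat.{u} k ⥤ FGModuleCat.{u} k} {d : ℕ} {e : ℤ}

/-- A section over the complement of the zero set of `m`, multiplied with a function divisible by
a high power of `m`, extends by zero. -/
lemma IsSec.exists_extend {p q : ℕ} {ℓ' : Fin (q + 1) → Module.Dual k (Fin n → k)}
    {f : (Fin n → k) → Val P (Fin n → k)} (hf : IsSec P d e (inter ℓ') f) :
    ∃ N, ∀ (ℓ : Fin (p + 1) → Module.Dual k (Fin n → k)) (m H : (Fin n → k) → k),
      m ∈ polyFun k (Fin n → k) → H ∈ polyFun k (Fin n → k) →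
      (∀ v ∈ inter ℓ, m v ≠ 0 → v ∈ inter ℓ') →
      (∀ v ∈ inter ℓ, H v ≠ 0 ∧ ∏ i, ℓ' i v = m v * H v) →
      ∀ M ≥ N, ∀ ρ, DivisibleOn (inter ℓ) m M ρ →
      IsSec P d e (inter ℓ) fun v => ρ v • f v := by
  -- The exponent comes from `f` alone, before `ℓ`, `m` and `ρ` are chosen. This uniformity matters
  -- because the cover is infinite. The extra 1 below makes `ρ` vanish wherever `m` does.
  obtain ⟨N, F, hF, hN⟩ := exists_global_denominator hf.1
  refine ⟨N + 1, fun ℓ m H hm hH hsub hprod M hM ρ ⟨⟨h, hh, r, hr, hρ⟩, hom⟩ => ?_⟩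
  have hzero : ∀ v ∈ inter ℓ, m v = 0 → ρ v = 0 := fun v hv h0 => by
    obtain ⟨h1, h2⟩ := hρ v hv
    rw [h0, zero_pow (by omega), zero_mul] at h2
    exact (mul_eq_zero.1 h2).resolve_left h1
  refine IsSec.of_denominator (h := fun v => h v * H v ^ N)
    (F := fun v => (m v ^ (M - N) * r v) • F v)
    (Subalgebra.mul_mem _ hh (pow_mem_polyFun hH N))
    (IsPolyMap.mul (Subalgebra.mul_mem _ (pow_mem_polyFun hm _) hr) hF)
    (fun v hv => ⟨mul_ne_zero (hρ v hv).1 (pow_ne_zero _ (hprod v hv).1), ?_⟩)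
    (fun c v hv hcv => ?_) fun v hv => ?_
  · by_cases h0 : m v = 0
    · rw [hzero v hv h0, h0, zero_pow (by omega), zero_mul, zero_smul, zero_smul, smul_zero]
    · have h1 := hN ⟨v, hsub v hv h0⟩
      dsimp only at h1
      rw [← h1, (hprod v hv).2, smul_smul, smul_smul]
      congr 1
      have h2 := (hρ v hv).2
      calc h v * H v ^ N * ρ v = (h v * ρ v) * H v ^ N := by ring
        _ = m v ^ (M - N + N) * r v * H v ^ N := by rw [h2, Nat.sub_add_cancel (by omega)]
        _ = _ := by rw [pow_add, mul_pow]; ring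
  · by_cases h0 : m v = 0
    · have h1 := hzero v hv h0
      rw [hom c v, h1, zero_smul, zero_smul, smul_zero]
    · have h1 := hsub v hv h0
      rw [hom c v, hf.map_smul c h1 (smul_mem_inter c.ne_zero h1), smul_comm]
  · by_cases h0 : m v = 0
    · rw [hzero v hv h0, zero_smul]
      exact Submodule.zero_mem _
    · exact Submodule.smul_mem _ _ (hf.mem_fibre (hsub v hv h0))

end Extension

section Lift

variable {P : FGModuleCat.{u} k ⥤ FGModuleCat.{u} k} {d : ℕ} {e : ℤ} {p : ℕ}

/-- The lift of a cochain for the cover by the coordinate hyperplanes to a cochain for the cover by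
all hyperplanes. -/
def liftCochain (M : ℕ) (c : (Fin (p + 1) → Fin n) → (Fin n → k) → Val P (Fin n → k)) :
    (Fin (p + 1) → Module.Dual k (Fin n → k)) → (Fin n → k) → Val P (Fin n → k) :=
  fun ℓ v => ∑ τ : Fin (p + 1) → Fin n, (∏ i, partition M (ℓ i) (τ i) v) • c τ v

/-- There are only finitely many tuples of coordinates, so a single order of vanishing suffices for
all tuples of linear forms at once. -/
lemma exists_isCochain_lift [IsAlgClosed k]
    {c : (Fin (p + 1) → Fin n) → (Fin n → k) → Val P (Fin n → k)}
    (hc : IsCochain P d e coordForm c) : ∃ M, IsCochain P d e id (liftCochain M c) := by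
  have h : ∀ τ : Fin (p + 1) → Fin n, ∃ N, ∀ M ≥ N,
      ∀ ℓ : Fin (p + 1) → Module.Dual k (Fin n → k), ∀ ρ,
      DivisibleOn (inter ℓ) (fun v => ∏ i, v (τ i)) M ρ →
      IsSec P d e (inter ℓ) fun v => ρ v • c τ v := by
    intro τ
    obtain ⟨N, hN⟩ := (hc τ).exists_extend (p := p)
    refine ⟨N, fun M hM ℓ ρ hρ => hN ℓ _ 1
      (prod_mem_polyFun Finset.univ (h := fun i v => v (τ i)) fun i _ =>
      coord_mem_polyFun (τ i)) (Subalgebra.one_mem _)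
      (fun v _ hm i => Finset.prod_ne_zero_iff.1 hm i (Finset.mem_univ i))
      (fun v _ => ⟨one_ne_zero, by simp⟩) M hM ρ hρ⟩
  choose N hN using h
  refine ⟨∑ τ, N τ, fun ℓ => ?_⟩
  have : liftCochain (∑ τ, N τ) c ℓ = ∑ τ : Fin (p + 1) → Fin n,
      fun v => (∏ i, partition (∑ τ, N τ) (ℓ i) (τ i) v) • c τ v := by
    funext v
    simp [liftCochain]
  rw [this]
  refine IsSec.sum fun τ _ => hN τ (∑ τ, N τ + 1) ?_ _ _ ?_
  · exact (Finset.single_le_sum (f := N) (fun _ _ => Nat.zero_le _) (Finset.mem_univ τ)).trans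
      (Nat.le_succ _)
  · exact DivisibleOn.prod fun i _ => (divisibleOn_partition _ _ _).mono fun v hv => hv i

lemma liftCochain_smul_coordForm (M : ℕ)
    (c : (Fin (p + 1) → Fin n) → (Fin n → k) → Val P (Fin n → k)) (τ : Fin (p + 1) → Fin n)
    {a : Fin n → k} (ha : ∀ i, a i ≠ 0) {v : Fin n → k} (hv : ∀ i, v (τ i) ≠ 0) :
    liftCochain M c (fun i => a (τ i) • coordForm (τ i)) v = c τ v := by
  rw [liftCochain, Finset.sum_eq_single τ]
  · rw [Finset.prod_eq_one fun i _ => by rw [partition_coordForm (ha _) (hv i), if_pos rfl],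
      one_smul]
  · intro τ' _ hne
    obtain ⟨i, hi⟩ := Function.ne_iff.1 hne
    rw [Finset.prod_eq_zero (Finset.mem_univ i)
      (by rw [partition_coordForm (ha _) (hv i), if_neg hi]), zero_smul]
  · simp

lemma liftCochain_coordForm (M : ℕ)
    (c : (Fin (p + 1) → Fin n) → (Fin n → k) → Val P (Fin n → k)) (τ : Fin (p + 1) → Fin n)
    {v : Fin n → k} (hv : ∀ i, v (τ i) ≠ 0) :
    liftCochain M c (fun i => coordForm (τ i)) v = c τ v := by
  have := liftCochain_smul_coordForm M c τ (a := 1) (fun _ => one_ne_zero) hv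
  simpa using this

/-- In the lift of the differential, the term omitting the `i`-th index depends on that index only
through its partition function, and these functions sum to one. -/
lemma altSum_liftCochain (M : ℕ)
    (c : (Fin (p + 1) → Fin n) → (Fin n → k) → Val P (Fin n → k))
    (ℓ : Fin (p + 2) → Module.Dual k (Fin n → k)) {v : Fin n → k} (hv : v ∈ inter ℓ) :
    altSum (liftCochain M c) ℓ v = liftCochain M (altSum c) ℓ v := by
  simp only [liftCochain, altSum_apply, Finset.sum_apply, Pi.smul_apply, Finset.smul_sum]
  conv_rhs => rw [Finset.sum_comm]
  refine Finset.sum_congr rfl fun i _ => ?_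
  conv_rhs =>
    rw [← (Fin.insertNthEquiv (fun _ => Fin n) i).sum_comp, Fintype.sum_prod_type, Finset.sum_comm]
  refine Finset.sum_congr rfl fun τ _ => ?_
  have h : ∀ a : Fin n,
      (∏ j, partition M (ℓ j) (Fin.insertNthEquiv (fun _ => Fin n) i (a, τ) j) v) •
      (-1 : ℤ) ^ (i : ℕ) • c
        (fun j => Fin.insertNthEquiv (fun _ => Fin n) i (a, τ) (i.succAbove j)) v
      = partition M (ℓ i) a v • ((∏ j, partition M (ℓ (i.succAbove j)) (τ j) v) •
        (-1 : ℤ) ^ (i : ℕ) • c τ v) := by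
    intro a
    rw [Fin.prod_univ_succAbove _ i, smul_smul]
    simp [Fin.insertNthEquiv]
  simp only [h]
  rw [← Finset.sum_smul, sum_partition (hv i), one_smul, smul_comm]

lemma isClosed_lift {c : (Fin (p + 1) → Fin n) → (Fin n → k) → Val P (Fin n → k)}
    (hc : IsClosed P coordForm c) (M : ℕ) : IsClosed P id (liftCochain M c) := by
  intro ℓ v hv
  rw [altSum_liftCochain M c ℓ hv]
  refine Finset.sum_eq_zero fun σ _ => ?_
  by_cases h : v ∈ inter fun i => coordForm (k := k) (σ i)
  · rw [hc σ v h, smul_zero]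
  · obtain ⟨i, hi⟩ : ∃ i, v (σ i) = 0 := by
      by_contra! hne
      exact h hne
    rw [Finset.prod_eq_zero (Finset.mem_univ i) (partition_eq_zero hi), zero_smul]

end Lift

end

section

variable {k : Type u} [Field k] {n : ℕ} {P : FGModuleCat.{u} k ⥤ FGModuleCat.{u} k} {d : ℕ}
  {e : ℤ}

lemma isCob_of_eq_zero {E : Type u} [AddCommGroup E] [Module k E] [Module.Finite k E] {α : Type*}
    {X : α → Module.Dual k E} {p : ℕ} {c : (Fin (p + 1) → α) → E → Val P E}
    (h : ∀ σ, ∀ v ∈ inter fun i => X (σ i), c σ v = 0) : IsCob P d e X c := by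
  cases p with
  | zero => exact h
  | succ p =>
    refine ⟨0, fun σ => IsSec.zero, fun σ v hv => ?_⟩
    rw [h σ v hv, map_zero]
    rfl

/-! ### Descent of coboundaries from all hyperplanes to the coordinate cover -/

section Staircase

variable {p : ℕ}

/-- The first `s` entries of the tuple `σ` are coordinate forms. -/
def StartsWithCoords (s : ℕ) (σ : Fin p → Module.Dual k (Fin n → k)) : Prop :=
  ∀ i : Fin p, (i : ℕ) < s → σ i ∈ Set.range (coordForm (k := k) (n := n))

lemma StartsWithCoords.cons {s : ℕ} {σ : Fin p → Module.Dual k (Fin n → k)}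
    (h : StartsWithCoords s σ) (j : Fin n) :
    StartsWithCoords (s + 1) (Fin.cons (coordForm j) σ : Fin (p + 1) → Module.Dual k (Fin n → k)) :=
  fun i => Fin.cases (fun _ => ⟨j, by simp⟩)
    (fun i hi => by simpa using h i (by simpa using hi)) i

lemma cons_mem_inter {σ : Fin (p + 1) → Module.Dual k (Fin n → k)} {v : Fin n → k}
    (hv : v ∈ inter σ) {j : Fin n} (hj : v j ≠ 0) :
    v ∈ inter (Fin.cons (coordForm j) σ : Fin (p + 2) → Module.Dual k (Fin n → k)) :=
  fun i => Fin.cases (by simpa using hj) (fun i => by simpa using hv i) i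

/-- The entries of `σ` from position `s` on. -/
def tailFrom (s : ℕ) (σ : Fin p → Module.Dual k (Fin n → k)) : Fin p → Module.Dual k (Fin n → k) :=
  fun i => if (i : ℕ) < s then 0 else σ i

/-- The first `s` entries range over a finite set, so the order of vanishing can be chosen in terms
of the remaining entries alone. The next lemma needs the same partition on several faces of one
tuple. -/
lemma exists_uniform_extension [IsAlgClosed k]
    {c : (Fin (p + 2) → Module.Dual k (Fin n → k)) → (Fin n → k) → Val P (Fin n → k)}
    (hc : IsCochain P d e id c) {s : ℕ} (hs : s < p + 1)
    (θ : Fin (p + 1) → Module.Dual k (Fin n → k)) :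
    ∃ M, ∀ σ : Fin (p + 1) → Module.Dual k (Fin n → k), StartsWithCoords s σ → tailFrom s σ = θ →
      ∀ j, IsSec P d e (inter σ) fun v =>
        partition M (σ ⟨s, hs⟩) j v • c (Fin.cons (coordForm j) σ) v := by
  let fill : (Fin (p + 1) → Fin n) → Fin (p + 1) → Module.Dual k (Fin n → k) :=
    fun τ i => if (i : ℕ) < s then coordForm (τ i) else θ i
  have h : ∀ (x : (Fin (p + 1) → Fin n) × Fin n), ∃ N, ∀ M ≥ N, ∀ ρ,
      DivisibleOn (inter (fill x.1)) (fun v => v x.2) M ρ →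
      IsSec P d e (inter (fill x.1)) fun v =>
        ρ v • c (Fin.cons (coordForm x.2) (fill x.1)) v := by
    rintro ⟨τ, j⟩
    obtain ⟨N, hN⟩ := (hc (Fin.cons (coordForm j) (fill τ))).exists_extend (p := p)
    refine ⟨N, hN (fill τ) (fun v => v j) (fun v => ∏ i, fill τ i v)
      (coord_mem_polyFun j)
      (prod_mem_polyFun Finset.univ (h := fun i v => fill τ i v) fun i _ => dual_mem_polyFun _)
      (fun v hv hm => cons_mem_inter hv hm) fun v hv =>
        ⟨Finset.prod_ne_zero_iff.2 fun i _ => hv i, ?_⟩⟩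
    rw [Fin.prod_univ_succ]
    simp
  choose N hN using h
  refine ⟨∑ x, N x, fun σ hσ hθ j => ?_⟩
  obtain ⟨τ, rfl⟩ : ∃ τ, fill τ = σ := by
    refine ⟨fun i => if h : (i : ℕ) < s then (hσ i h).choose else j, funext fun i => ?_⟩
    by_cases hi : (i : ℕ) < s
    · simp only [fill, hi, if_true, dif_pos]
      exact (hσ i hi).choose_spec
    · simp only [fill, hi, if_false, ← hθ, tailFrom]
  refine hN (τ, j) (∑ x, N x + 1) ?_ _ ((divisibleOn_partition _ _ _).mono fun v hv => hv _)
  exact (Finset.single_le_sum (f := N) (fun _ _ => Nat.zero_le _)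
    (Finset.mem_univ (τ, j))).trans (Nat.le_succ _)

-- The primitive glues the values of `c` on `(x_j, σ)` by the partition of unity of the entry of `σ`
-- at position `s`. By the cocycle condition on `(x_j, σ)`, the sum over the faces of `σ` of these
-- values returns `c σ` for each `j`, and the partition functions add up to one. Faces omitting an
-- entry from position `s + 1` on do not contribute: prefixed with `x_j` they start with `s + 2`
-- coordinate forms, where `c` vanishes.
open Classical in
lemma staircase_step [IsAlgClosed k]
    {c : (Fin (p + 2) → Module.Dual k (Fin n → k)) → (Fin n → k) → Val P (Fin n → k)}
    (hc : IsCochain P d e id c) (hc' : IsClosed P id c) {s : ℕ} (hs : s < p + 1)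
    (h0 : ∀ σ, StartsWithCoords (s + 2) σ → ∀ v ∈ inter σ, c σ v = 0) :
    ∃ b, IsCochain P d e id b ∧
      ∀ σ, StartsWithCoords (s + 1) σ → ∀ v ∈ inter σ, c σ v = altSum b σ v := by
  choose M hM using exists_uniform_extension hc hs
  let b : (Fin (p + 1) → Module.Dual k (Fin n → k)) → (Fin n → k) → Val P (Fin n → k) := fun σ =>
    if StartsWithCoords s σ ∧ σ ⟨s, hs⟩ ∉ Set.range (coordForm (k := k) (n := n)) then
      ∑ j, fun v => partition (M (tailFrom s σ)) (σ ⟨s, hs⟩) j v • c (Fin.cons (coordForm j) σ) v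
    else 0
  refine ⟨b, fun σ => ?_, fun σ hσ v hv => ?_⟩
  · change IsSec P d e (inter σ) (b σ)
    by_cases h : StartsWithCoords s σ ∧ σ ⟨s, hs⟩ ∉ Set.range (coordForm (k := k) (n := n))
    · simp only [b, if_pos h]
      exact IsSec.sum fun j _ => hM _ σ h.1 rfl j
    · simp only [b, if_neg h]
      exact IsSec.zero
  have face_ge : ∀ i : Fin (p + 2), ¬ (i : ℕ) < s + 1 → ∀ j : Fin (p + 1), (j : ℕ) < s + 1 →
      i.succAbove j = j.castSucc := fun i hi j hj =>
    Fin.succAbove_of_castSucc_lt _ _ (by rw [Fin.lt_def, Fin.val_castSucc]; omega)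
  have face_lt : ∀ i : Fin (p + 2), (i : ℕ) < s + 1 → ∀ j : Fin (p + 1), s ≤ (j : ℕ) →
      i.succAbove j = j.succ := fun i hi j hj =>
    Fin.succAbove_of_le_castSucc _ _ (by rw [Fin.le_def, Fin.val_castSucc]; omega)
  have starts_face : ∀ i : Fin (p + 2), StartsWithCoords s fun j => σ (i.succAbove j) :=
    fun i j hj => hσ _ (by
      have : ((i.succAbove j : Fin (p + 2)) : ℕ) ≤ j + 1 := by
        rw [Fin.succAbove]
        split_ifs <;> simp
      omega)
  have starts_face' : ∀ i : Fin (p + 2), ¬ (i : ℕ) < s + 1 →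
      StartsWithCoords (s + 1) fun j => σ (i.succAbove j) := fun i hi j hj => by
    change σ (i.succAbove j) ∈ _
    rw [face_ge i hi j hj]
    exact hσ _ (by simpa using hj)
  have b_ge : ∀ i : Fin (p + 2), ¬ (i : ℕ) < s + 1 → b (fun j => σ (i.succAbove j)) = 0 :=
    fun i hi => if_neg fun h => h.2 (starts_face' i hi ⟨s, hs⟩ (Nat.lt_succ_self s))
  by_cases hmem : σ ⟨s + 1, by omega⟩ ∈ Set.range (coordForm (k := k) (n := n))
  · rw [h0 σ (fun i hi => ?_) v hv, altSum_apply_apply, altSum_apply]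
    · refine (Finset.sum_eq_zero fun i _ => ?_).symm
      suffices h : b (fun j => σ (i.succAbove j)) = 0 by rw [h]; exact smul_zero _
      by_cases hi : (i : ℕ) < s + 1
      · refine if_neg fun h => h.2 ?_
        change σ (i.succAbove ⟨s, hs⟩) ∈ _
        rw [face_lt i hi ⟨s, hs⟩ le_rfl]
        exact hmem
      · exact b_ge i hi
    · rcases Nat.lt_succ_iff_lt_or_eq.1 hi with h | h
      · exact hσ i h
      · have hi' : i = ⟨s + 1, by omega⟩ := Fin.ext h
        rw [hi']
        exact hmem
  · set ℓ := σ ⟨s + 1, by omega⟩ with hℓ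
    -- All faces omitting one of the first `s + 1` entries have this same tail, hence the same
    -- exponent `M θ` and the same partition functions.
    set θ : Fin (p + 1) → Module.Dual k (Fin n → k) :=
      fun j => if (j : ℕ) < s then 0 else σ j.succ with hθ
    have hb : ∀ i : Fin (p + 2), b (fun j => σ (i.succAbove j)) v =
        ∑ j, partition (M θ) ℓ j v • c (Fin.cons (coordForm j) fun j => σ (i.succAbove j)) v := by
      intro i
      by_cases hi : (i : ℕ) < s + 1
      · have h1 : σ (i.succAbove ⟨s, hs⟩) = ℓ := by rw [face_lt i hi ⟨s, hs⟩ le_rfl]; rfl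
        have h2 : tailFrom s (fun j => σ (i.succAbove j)) = θ := by
          funext j
          simp only [tailFrom, hθ]
          split_ifs with hj
          · rfl
          · rw [face_lt i hi j (not_lt.1 hj)]
        simp only [b]
        rw [if_pos ⟨starts_face i, by rw [h1]; exact hmem⟩, h1, h2, Finset.sum_apply]
      · rw [b_ge i hi]
        refine (Finset.sum_eq_zero fun j _ => ?_).symm
        by_cases hj : v j = 0
        · rw [partition_eq_zero hj, zero_smul]
        · rw [h0 _ ((starts_face' i hi).cons j) v (cons_mem_inter (fun l => hv _) hj), smul_zero]
    have hclosed : ∀ j, v j ≠ 0 →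
        altSum (fun τ : Fin (p + 1) → _ => c (Fin.cons (coordForm j) τ) v) σ = c σ v := by
      intro j hj
      have h1 := hc' (Fin.cons (coordForm j) σ) v (cons_mem_inter hv hj)
      rw [altSum_apply_apply, altSum_cons, sub_eq_zero] at h1
      exact h1.symm
    rw [altSum_apply_apply, altSum_apply]
    simp only [hb, Finset.smul_sum]
    rw [Finset.sum_comm]
    calc c σ v = ∑ j, partition (M θ) ℓ j v • c σ v := by
          rw [← Finset.sum_smul, sum_partition (hv _), one_smul]
      _ = _ := Finset.sum_congr rfl fun j _ => ?_
    by_cases hj : v j = 0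
    · simp [partition_eq_zero hj]
    · rw [← hclosed j hj, altSum_apply, Finset.smul_sum]
      exact Finset.sum_congr rfl fun i _ => smul_comm _ _ _

end Staircase

lemma eq_zero_of_startsWithCoords_one {p : ℕ}
    {c : (Fin (p + 1) → Module.Dual k (Fin n → k)) → (Fin n → k) → Val P (Fin n → k)}
    (hc' : IsClosed P id c) (h0 : ∀ σ, StartsWithCoords 1 σ → ∀ v ∈ inter σ, c σ v = 0)
    (σ : Fin (p + 1) → Module.Dual k (Fin n → k)) {v : Fin n → k} (hv : v ∈ inter σ) :
    c σ v = 0 := by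
  obtain ⟨j, hj⟩ : ∃ j, v j ≠ 0 := by
    by_contra! h
    exact hv 0 (by rw [show v = 0 from funext h, map_zero])
  have hv' := cons_mem_inter hv hj
  have h1 := hc' (Fin.cons (coordForm j) σ) v hv'
  rw [altSum_apply_apply, altSum_cons_aux, Finset.sum_eq_zero, sub_zero] at h1
  · exact h1
  · intro i _
    rw [h0 _ (fun l hl => ?_) v (fun l => hv' _), smul_zero]
    obtain rfl : l = 0 := Fin.ext (by simpa using hl)
    exact ⟨j, by simp⟩

/-- Each staircase step lowers by one the number of leading coordinate forms that force the cocycle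
to vanish. Once a single one suffices, the cone identity makes the cocycle zero. -/
lemma isCob_of_startsWithCoords [IsAlgClosed k] {p : ℕ} (s : ℕ) (hs : s ≤ p) :
    ∀ {c : (Fin (p + 1) → Module.Dual k (Fin n → k)) → (Fin n → k) → Val P (Fin n → k)},
    IsCochain P d e id c → IsClosed P id c →
    (∀ σ, StartsWithCoords (s + 1) σ → ∀ v ∈ inter σ, c σ v = 0) → IsCob P d e id c := by
  induction s with
  | zero =>
    intro c hc hc' h0
    exact isCob_of_eq_zero fun σ v hv => eq_zero_of_startsWithCoords_one hc' h0 σ hv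
  | succ s ih =>
    intro c hc hc' h0
    obtain ⟨p, rfl⟩ : ∃ q, p = q + 1 := ⟨p - 1, by omega⟩
    obtain ⟨b, hb, hcb⟩ := staircase_step hc hc' (s := s) (by omega) h0
    have := (ih (by omega) (hc.sub hb.altSum) (hc'.sub (isClosed_altSum b)) fun σ hσ v hv => by
      rw [Pi.sub_apply, Pi.sub_apply, hcb σ hσ v hv, sub_self]).add (IsCob.altSum hb)
    rwa [sub_add_cancel] at this

/-- A Čech cocycle for the cover by the complements of all hyperplanes is a coboundary if its
restriction to the cover by the complements of the coordinate hyperplanes is a coboundary. -/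
lemma isCob_of_restrict [IsAlgClosed k] {p : ℕ}
    {c : (Fin (p + 1) → Module.Dual k (Fin n → k)) → (Fin n → k) → Val P (Fin n → k)}
    (hc : IsCochain P d e id c) (hc' : IsClosed P id c)
    (h : IsCob P d e coordForm fun τ : Fin (p + 1) → Fin n => c fun i => coordForm (τ i)) :
    IsCob P d e id c := by
  have key : ∀ {c : (Fin (p + 1) → Module.Dual k (Fin n → k)) → (Fin n → k) → Val P (Fin n → k)},
      IsCochain P d e id c → IsClosed P id c →
      (∀ τ : Fin (p + 1) → Fin n, ∀ v, (∀ i, v (τ i) ≠ 0) → c (fun i => coordForm (τ i)) v = 0) →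
      IsCob P d e id c := by
    intro c hc hc' h
    refine isCob_of_startsWithCoords p le_rfl hc hc' fun σ hσ v hv => ?_
    choose τ hτ using fun i => hσ i i.2
    obtain rfl : (fun i => coordForm (τ i)) = σ := funext hτ
    exact h τ v hv
  cases p with
  | zero => exact key hc hc' h
  | succ p =>
    obtain ⟨b, hb, hcb⟩ := h
    -- Subtracting the coboundary of the lifted primitive leaves a cocycle that vanishes on all
    -- tuples of coordinate forms, where the staircase starts.
    obtain ⟨M, hM⟩ := exists_isCochain_lift hb
    have := (key (hc.sub hM.altSum) (hc'.sub (isClosed_altSum _)) fun τ v hv => by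
      have h1 : c (fun i => coordForm (τ i)) v = altSum b τ v := hcb τ v hv
      rw [Pi.sub_apply, Pi.sub_apply, h1, sub_eq_zero]
      rw [altSum_apply_apply b, altSum_apply_apply (liftCochain M b), altSum_apply, altSum_apply]
      exact Finset.sum_congr rfl fun i _ => by
        rw [liftCochain_coordForm M b (fun j => τ (i.succAbove j)) fun j => hv _]).add
          (IsCob.altSum hM)
    rwa [sub_add_cancel] at this

end

section

variable {k : Type u} [Field k] {P : FGModuleCat.{u} k ⥤ FGModuleCat.{u} k} {d : ℕ}

/-! ### The functor on linear maps, and the fibres P(v^⊥) -/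

section Functor

variable {V W : Type u} [AddCommGroup V] [Module k V] [Module.Finite k V]
  [AddCommGroup W] [Module k W] [Module.Finite k W]

lemma isPolyMap_mapLin (hP : IsPolynomialFunctor k P d) {E : Type u} [AddCommGroup E] [Module k E]
    (A : E →ₗ[k] V →ₗ[k] W) : IsPolyMap k fun x => mapLin P (A x) := by
  let L₁ : (V →ₗ[k] W) →ₗ[k] (FGModuleCat.of k V ⟶ FGModuleCat.of k W) :=
    { toFun := fun f => FGModuleCat.ofHom f, map_add' := fun _ _ => rfl,
      map_smul' := fun _ _ => rfl }
  let L₂ : (P.obj (FGModuleCat.of k V) ⟶ P.obj (FGModuleCat.of k W)) →ₗ[k]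
      (P.obj (FGModuleCat.of k V) →ₗ[k] P.obj (FGModuleCat.of k W)) :=
    { toFun := fun f => f.hom.hom, map_add' := fun _ _ => rfl, map_smul' := fun _ _ => rfl }
  exact (hP.polynomial (FGModuleCat.of k V) (FGModuleCat.of k W)).pull (L₁ ∘ₗ A) L₂

lemma mapLin_smul_id (hP : IsPolynomialFunctor k P d) (c : k) :
    mapLin P (c • (LinearMap.id : V →ₗ[k] V)) = c ^ d • LinearMap.id := by
  have h := hP.homogeneous (FGModuleCat.of k V) c
  exact congrArg (fun f => f.hom.hom) h

lemma mapLin_smul (hP : IsPolynomialFunctor k P d) (c : k) (f : V →ₗ[k] W) :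
    mapLin P (c • f) = c ^ d • mapLin P f := by
  have h : c • f = f.comp (c • LinearMap.id) := by ext; simp
  rw [h, mapLin_comp, mapLin_smul_id hP, LinearMap.comp_smul, LinearMap.comp_id]

lemma isPolyMap_mapLin_apply (hP : IsPolynomialFunctor k P d) {E : Type u} [AddCommGroup E]
    [Module k E] (A : E →ₗ[k] V →ₗ[k] W) (y : P.obj (FGModuleCat.of k V)) :
    IsPolyMap k fun x => mapLin P (A x) y :=
  (isPolyMap_mapLin hP A).pull LinearMap.id (LinearMap.applyₗ y)

end Functor

section Fibres

variable {n : ℕ}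

lemma mapLin_mem_fibre {E F : Type u} [AddCommGroup E] [Module k E] [Module.Finite k E]
    [AddCommGroup F] [Module k F] [Module.Finite k F] {v : E} {w : F}
    {f : Module.Dual k E →ₗ[k] Module.Dual k F}
    (hf : ∀ ξ ∈ conormal (k := k) v, f ξ ∈ conormal (k := k) w) {x : Val P E}
    (hx : x ∈ fibre P v) : mapLin P f x ∈ fibre P w := by
  obtain ⟨y, rfl⟩ := hx
  refine ⟨mapLin P (f.restrict hf) y, ?_⟩
  rw [← mapLin_comp_apply, ← mapLin_comp_apply]
  rfl

lemma mapLin_mem_fibre_of_range {E V : Type u} [AddCommGroup E] [Module k E] [Module.Finite k E]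
    [AddCommGroup V] [Module k V] [Module.Finite k V] {v : E}
    {f : V →ₗ[k] Module.Dual k E} (hf : ∀ ξ, f ξ ∈ conormal (k := k) v)
    (x : P.obj (FGModuleCat.of k V)) : mapLin P f x ∈ fibre P v := by
  refine ⟨mapLin P (f.codRestrict _ hf) x, ?_⟩
  rw [← mapLin_comp_apply]
  rfl

lemma mapLin_eq_of_mem_fibre (hP : IsPolynomialFunctor k P d) {E : Type u} [AddCommGroup E]
    [Module k E] [Module.Finite k E] {v : E} {f : Module.Dual k E →ₗ[k] Module.Dual k E} {c : k}
    (hf : ∀ ξ ∈ conormal (k := k) v, f ξ = c • ξ) {x : Val P E} (hx : x ∈ fibre P v) :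
    mapLin P f x = c ^ d • x := by
  obtain ⟨y, rfl⟩ := hx
  have : f.comp (conormal (k := k) v).subtype = c • (conormal (k := k) v).subtype :=
    LinearMap.ext fun ξ => hf ξ ξ.2
  rw [← mapLin_comp_apply, this, mapLin_smul hP]
  rfl

/-- The endomorphism `ξ ↦ v_i ξ - ξ(v) x_i` of the dual space; it is `v_i` times a projection to
the conormal space at `v`. -/
def coordProj (i : Fin n) : (Fin n → k) →ₗ[k]
    Module.Dual k (Fin n → k) →ₗ[k] Module.Dual k (Fin n → k) :=
  LinearMap.mk₂ k (fun v ξ => v i • ξ - ξ v • coordForm i)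
    (fun v w ξ => by rw [map_add, Pi.add_apply]; module)
    (fun c v ξ => by rw [map_smul, Pi.smul_apply, smul_eq_mul, smul_eq_mul]; module)
    (fun v ξ η => by rw [LinearMap.add_apply]; module)
    (fun c v ξ => by rw [LinearMap.smul_apply, smul_eq_mul]; module)

lemma coordProj_apply (i : Fin n) (v : Fin n → k) (ξ : Module.Dual k (Fin n → k)) :
    coordProj i v ξ = v i • ξ - ξ v • coordForm i := rfl

lemma mem_conormal {E : Type u} [AddCommGroup E] [Module k E] {v : E} {ξ : Module.Dual k E} :
    ξ ∈ conormal (k := k) v ↔ ξ v = 0 := Iff.rfl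

lemma mapLin_coordProj_mem_fibre (i : Fin n) (v : Fin n → k) (x : Val P (Fin n → k)) :
    mapLin P (coordProj i v) x ∈ fibre P v :=
  mapLin_mem_fibre_of_range (fun ξ => by
    simp [mem_conormal, coordProj_apply, mul_comm]) x

lemma mapLin_coordProj_of_mem_fibre (hP : IsPolynomialFunctor k P d) (i : Fin n) {v : Fin n → k}
    {x : Val P (Fin n → k)} (hx : x ∈ fibre P v) :
    mapLin P (coordProj i v) x = v i ^ d • x :=
  mapLin_eq_of_mem_fibre hP (fun ξ hξ => by
    rw [coordProj_apply, mem_conormal.1 hξ, zero_smul, sub_zero]) hx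

lemma mem_fibre_of_mapLin_coordProj {i : Fin n} {v : Fin n → k} (hv : v i ≠ 0)
    {x : Val P (Fin n → k)} (hx : mapLin P (coordProj i v) x = v i ^ d • x) : x ∈ fibre P v := by
  have h : x = (v i ^ d)⁻¹ • mapLin P (coordProj i v) x := by
    rw [hx, inv_smul_smul₀ (pow_ne_zero _ hv)]
  rw [h]
  exact Submodule.smul_mem _ _ (mapLin_coordProj_mem_fibre i v x)

end Fibres

/-! ### Torus weights of P((k^n)^∨) -/

section Weights

variable {n : ℕ}

/-- The action of the diagonal matrix with entries `t` on the dual space. -/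
def scaleDual : (Fin n → k) →ₗ[k] Module.Dual k (Fin n → k) →ₗ[k] Module.Dual k (Fin n → k) :=
  Module.Dual.transpose ∘ₗ LinearMap.mul k (Fin n → k)

lemma scaleDual_apply (t v : Fin n → k) (ξ : Module.Dual k (Fin n → k)) :
    scaleDual t ξ v = ξ (t * v) := rfl

lemma scaleDual_one : scaleDual (1 : Fin n → k) = LinearMap.id := by
  ext
  simp [scaleDual_apply]

lemma scaleDual_mul (s t : Fin n → k) :
    scaleDual (s * t) = (scaleDual s).comp (scaleDual t) := by
  refine LinearMap.ext fun ξ => LinearMap.ext fun v => ?_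
  rw [LinearMap.comp_apply, scaleDual_apply, scaleDual_apply, scaleDual_apply,
    mul_assoc, mul_left_comm]

lemma scaleDual_smul_one (c : k) : scaleDual (c • 1 : Fin n → k) = c • LinearMap.id := by
  rw [map_smul, scaleDual_one]

lemma mapLin_scaleDual_mul (s t : Fin n → k) (x : Val P (Fin n → k)) :
    mapLin P (scaleDual (s * t)) x = mapLin P (scaleDual s) (mapLin P (scaleDual t) x) := by
  rw [scaleDual_mul, mapLin_comp_apply]

lemma mapLin_scaleDual_inv {t : Fin n → k} (ht : ∀ i, t i ≠ 0) (x : Val P (Fin n → k)) :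
    mapLin P (scaleDual t⁻¹) (mapLin P (scaleDual t) x) = x := by
  have h : t⁻¹ * t = 1 := funext fun i => inv_mul_cancel₀ (ht i)
  rw [← mapLin_scaleDual_mul, h, scaleDual_one, mapLin_id]
  rfl

lemma mapLin_scaleDual_mem_fibre {t v : Fin n → k} {x : Val P (Fin n → k)}
    (hx : x ∈ fibre P (t * v)) : mapLin P (scaleDual t) x ∈ fibre P v :=
  mapLin_mem_fibre (fun _ hξ => hξ) hx

lemma sum_mon_injective [Infinite k] {J W : Type*} [AddCommGroup W] [Module k W]
    {ε : J → Fin n → ℤ} (hε : Function.Injective ε) {S : Finset J} {G G' : J → W}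
    (h : ∀ t : Fin n → k, (∀ i, t i ≠ 0) →
      ∑ j ∈ S, mon (ε j) t • G j = ∑ j ∈ S, mon (ε j) t • G' j) {j : J} (hj : j ∈ S) :
    G j = G' j := by
  classical
  have := expSum_eq_zero (k := k) hε (G := ∑ j ∈ S, Finsupp.single j (G j - G' j)) fun t ht => by
    simp only [map_sum, expSum_single, smul_sub, Finset.sum_sub_distrib, h t ht, sub_self]
  have h' := DFunLike.congr_fun this j
  rw [Finsupp.finsetSum_apply, Finset.sum_eq_single j (fun i _ hi => by simp [hi.symm])
    (fun h => (h hj).elim)] at h'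
  simpa [sub_eq_zero] using h'




/-- The torus acts through a polynomial map, and the coefficients of its monomials are the weight
projections. Hence all weights lie in ℕ^n, which is what makes negative entries of `a` decisive
later. -/
lemma exists_weightProj (hP : IsPolynomialFunctor k P d) (n : ℕ) :
    ∃ π : (Fin n → ℕ) →₀ Module.End k (Val P (Fin n → k)),
    ∀ t : Fin n → k, mapLin P (scaleDual t) = expSum natExp t π :=
  (isPolyMap_mapLin hP scaleDual).exists_expansion

end Weights

end

/-! ### Weight sections and the decomposition of sections into weights -/

section

variable {k : Type u} [Field k] {P : FGModuleCat.{u} k ⥤ FGModuleCat.{u} k} {d : ℕ} {n : ℕ}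
  (hP : IsPolynomialFunctor k P d)

/-- The projections of `P((k^n)^∨)` to its weight spaces for the diagonal torus. -/
def weightProj (n : ℕ) : (Fin n → ℕ) →₀ Module.End k (Val P (Fin n → k)) :=
  (exists_weightProj hP n).choose

lemma mapLin_scaleDual (t : Fin n → k) (x : Val P (Fin n → k)) :
    mapLin P (scaleDual t) x =
      ∑ b ∈ (weightProj hP n).support, mon (natExp b) t • weightProj hP n b x := by
  rw [(exists_weightProj hP n).choose_spec t, expSum_apply, Finsupp.sum, LinearMap.sum_apply]
  rfl

lemma sum_weightProj (x : Val P (Fin n → k)) :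
    ∑ b ∈ (weightProj hP n).support, weightProj hP n b x = x := by
  have h := mapLin_scaleDual hP 1 x
  rw [scaleDual_one, mapLin_id] at h
  simpa [mon_one] using h.symm

lemma weightProj_of_notMem {b : Fin n → ℕ} (hb : b ∉ (weightProj hP n).support)
    (x : Val P (Fin n → k)) : weightProj hP n b x = 0 := by
  rw [Finsupp.notMem_support_iff.1 hb]
  rfl

lemma mapLin_scaleDual_weightProj [Infinite k] (t : Fin n → k) (b : Fin n → ℕ)
    (x : Val P (Fin n → k)) :
    mapLin P (scaleDual t) (weightProj hP n b x) = mon (natExp b) t • weightProj hP n b x := by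
  by_cases hb : b ∈ (weightProj hP n).support
  · refine sum_mon_injective (k := k) natExp_injective
      (G := fun b => mapLin P (scaleDual t) (weightProj hP n b x))
      (G' := fun b => mon (natExp b) t • weightProj hP n b x) (fun u _ => ?_) hb
    have h := mapLin_scaleDual_mul t u x
    rw [mapLin_scaleDual hP, mapLin_scaleDual hP u, map_sum] at h
    simp only [map_smul] at h
    rw [← h]
    refine Finset.sum_congr rfl fun b _ => ?_
    rw [mon_mul, mul_smul, smul_comm]
  · rw [weightProj_of_notMem hP hb, map_zero, smul_zero]

lemma weightProj_weightProj [Infinite k] (b b' : Fin n → ℕ) (x : Val P (Fin n → k)) :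
    weightProj hP n b (weightProj hP n b' x) = if b = b' then weightProj hP n b' x else 0 := by
  by_cases hb : b ∈ (weightProj hP n).support
  · refine sum_mon_injective (k := k) natExp_injective
      (G := fun b => weightProj hP n b (weightProj hP n b' x))
      (G' := fun b => if b = b' then weightProj hP n b' x else 0) (fun u _ => ?_) hb
    rw [← mapLin_scaleDual, mapLin_scaleDual_weightProj]
    by_cases hb' : b' ∈ (weightProj hP n).support
    · rw [Finset.sum_eq_single b' (fun c _ hc => by rw [if_neg hc, smul_zero])
        (fun h => (h hb').elim), if_pos rfl]
    · rw [weightProj_of_notMem hP hb', smul_zero]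
      simp
  · rw [weightProj_of_notMem hP hb]
    split_ifs with h
    · rw [← h, weightProj_of_notMem hP hb]
    · rfl

lemma sum_natExp_eq [Infinite k] {b : Fin n → ℕ} {x : Val P (Fin n → k)}
    (hx : weightProj hP n b x ≠ 0) : ∑ i, natExp b i = d := by
  by_contra hne
  obtain ⟨u, hu⟩ := exists_unit_zpow_ne_one (k := k) (sub_ne_zero.2 hne)
  have h := mapLin_scaleDual_weightProj hP ((u : k) • 1) b x
  rw [scaleDual_smul_one, mapLin_smul_id hP, mon_smul _ u.ne_zero, mon_one, mul_one,
    LinearMap.smul_apply, LinearMap.id_apply, ← zpow_natCast, ← sub_eq_zero, ← sub_smul] at h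
  rcases smul_eq_zero.1 h with h | h
  · apply hu
    rw [zpow_sub, mul_inv_eq_one]
    exact Units.ext (by simpa using (sub_eq_zero.1 h).symm)
  · exact hx h

/-- The space of values at `(1, …, 1)` of the sections of `P(Ω)` of weight `a` over the complement
of the coordinate hyperplanes with indices in `I`. -/
def coeffSpace (a : Fin n → ℤ) (I : Set (Fin n)) : Submodule k (Val P (Fin n → k)) :=
  fibre P (1 : Fin n → k) ⊓ ⨅ b ∈ {b : Fin n → ℕ | ∃ i ∉ I, a i < b i},
    LinearMap.ker (weightProj hP n b)

variable {hP}

lemma mem_coeffSpace_iff {a : Fin n → ℤ} {I : Set (Fin n)} {x : Val P (Fin n → k)} :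
    x ∈ coeffSpace hP a I ↔ x ∈ fibre P (1 : Fin n → k) ∧
      ∀ b : Fin n → ℕ, ∀ i ∉ I, a i < b i → weightProj hP n b x = 0 := by
  simp only [coeffSpace, Submodule.mem_inf, Submodule.mem_iInf, LinearMap.mem_ker]
  refine and_congr_right fun _ => ⟨fun h b i hi hb => h b ⟨i, hi, hb⟩, ?_⟩
  rintro h b ⟨i, hi, hb⟩
  exact h b i hi hb

lemma coeffSpace_mono {a : Fin n → ℤ} {I I' : Set (Fin n)} (h : I ⊆ I') :
    coeffSpace hP a I ≤ coeffSpace hP a I' := fun x hx => by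
  rw [mem_coeffSpace_iff] at hx ⊢
  exact ⟨hx.1, fun b i hi => hx.2 b i fun hi' => hi (h hi')⟩

/-- Every weight `b` has `b ν ≥ 0 > a ν`, so regularity along the hyperplane `v_ν = 0` kills every
component. -/
lemma coeffSpace_eq_zero {a : Fin n → ℤ} {I : Set (Fin n)} {ν : Fin n} (ha : a ν < 0)
    (hν : ν ∉ I) {x : Val P (Fin n → k)} (hx : x ∈ coeffSpace hP a I) : x = 0 := by
  rw [mem_coeffSpace_iff] at hx
  rw [← sum_weightProj hP x]
  exact Finset.sum_eq_zero fun b _ => hx.2 b ν hν (ha.trans_le (by positivity))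

variable (hP)

/-- The value at `v` of the section of `P(Ω)` of weight `a` with a given value at `(1, …, 1)`. -/
def weightSection (a : Fin n → ℤ) (v : Fin n → k) : Module.End k (Val P (Fin n → k)) :=
  ∑ b ∈ (weightProj hP n).support, mon (a - natExp b) v • weightProj hP n b

lemma weightSection_apply (a : Fin n → ℤ) (v : Fin n → k) (x : Val P (Fin n → k)) :
    weightSection hP a v x =
      ∑ b ∈ (weightProj hP n).support, mon (a - natExp b) v • weightProj hP n b x := by
  simp [weightSection]

lemma weightSection_one (a : Fin n → ℤ) (x : Val P (Fin n → k)) :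
    weightSection hP a 1 x = x := by
  simp only [weightSection_apply, mon_one, one_smul, sum_weightProj]

lemma weightSection_weightProj [Infinite k] (a : Fin n → ℤ) (v : Fin n → k) (b : Fin n → ℕ)
    (x : Val P (Fin n → k)) :
    weightSection hP a v (weightProj hP n b x) = mon (a - natExp b) v • weightProj hP n b x := by
  rw [weightSection_apply]
  by_cases hb : b ∈ (weightProj hP n).support
  · rw [Finset.sum_eq_single b, weightProj_weightProj, if_pos rfl]
    · intro c _ hc
      rw [weightProj_weightProj, if_neg hc, smul_zero]
    · exact fun h => (h hb).elim
  · simp [weightProj_of_notMem hP hb x]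

/-- The torus acts on sections by `s ↦ P(t) (s (t v))`; a weight section is an eigenvector with
character `t^a`. -/
lemma mapLin_scaleDual_weightSection [Infinite k] {t : Fin n → k} (ht : ∀ i, t i ≠ 0)
    (a : Fin n → ℤ) (v : Fin n → k) (x : Val P (Fin n → k)) :
    mapLin P (scaleDual t) (weightSection hP a (t * v) x) = mon a t • weightSection hP a v x := by
  simp only [weightSection_apply, map_sum, map_smul, mapLin_scaleDual_weightProj, Finset.smul_sum,
    smul_smul]
  refine Finset.sum_congr rfl fun b _ => ?_
  rw [mon_mul, mul_right_comm, ← mon_add ht, sub_add_cancel]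

lemma mapLin_scaleDual_weightSection_self [Infinite k] {t : Fin n → k} (ht : ∀ i, t i ≠ 0)
    (a : Fin n → ℤ) (x : Val P (Fin n → k)) :
    mapLin P (scaleDual t) (weightSection hP a t x) = mon a t • x := by
  have := mapLin_scaleDual_weightSection hP ht a 1 x
  rwa [mul_one, weightSection_one] at this

lemma weightSection_mem_fibre_of_torus [Infinite k] {t : Fin n → k} (ht : ∀ i, t i ≠ 0)
    (a : Fin n → ℤ) {x : Val P (Fin n → k)} (hx : x ∈ fibre P (1 : Fin n → k)) :
    weightSection hP a t x ∈ fibre P t := by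
  rw [← mapLin_scaleDual_inv ht (weightSection hP a t x),
    mapLin_scaleDual_weightSection_self hP ht]
  refine mapLin_scaleDual_mem_fibre (Submodule.smul_mem _ _ ?_)
  rwa [show t⁻¹ * t = 1 from funext fun i => inv_mul_cancel₀ (ht i)]

variable {hP}

/-- The denominator `∏_{i ∈ I} v_i^N`. -/
lemma mon_natExp_mul {c : Fin n → ℕ} {v : Fin n → k} (hv : ∀ i, c i ≠ 0 → v i ≠ 0)
    {a : Fin n → ℤ} : mon (natExp c) v * mon a v = mon (natExp c + a) v := by
  simp only [mon, Pi.add_apply, ← Finset.prod_mul_distrib]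
  refine Finset.prod_congr rfl fun i _ => ?_
  by_cases h : c i = 0
  · simp [h, natExp]
  · exact (zpow_add₀ (hv i h) _ _).symm

open Classical in
lemma exists_weightSection_denominator [Infinite k] {a : Fin n → ℤ} {I : Set (Fin n)}
    {x : Val P (Fin n → k)} (hx : x ∈ coeffSpace hP a I) :
    ∃ (c : Fin n → ℕ) (F : (Fin n → k) → Val P (Fin n → k)), (∀ i, c i ≠ 0 → i ∈ I) ∧
      IsPolyMap k F ∧ ∀ v, (∀ i ∈ I, v i ≠ 0) →
        mon (natExp c) v • weightSection hP a v x = F v := by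
  let S := (weightProj hP n).support
  -- A crude common bound for all pole orders `b i - a i`.
  let N : ℕ := ∑ b ∈ S, ∑ i, (b i + (a i).natAbs)
  have hN : ∀ b ∈ S, ∀ i, (b i : ℤ) - a i ≤ N := by
    intro b hb i
    have h1 : b i + (a i).natAbs ≤ N :=
      (Finset.single_le_sum (f := fun i => b i + (a i).natAbs) (fun _ _ => Nat.zero_le _)
        (Finset.mem_univ i)).trans
      (Finset.single_le_sum (f := fun b : Fin n → ℕ => ∑ i, (b i + (a i).natAbs))
        (fun _ _ => Nat.zero_le _) hb)
    omega
  let c : Fin n → ℕ := fun i => if i ∈ I then N else 0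
  have hcI : ∀ i, c i ≠ 0 → i ∈ I := fun i hi => by
    by_contra h
    exact hi (if_neg h)
  refine ⟨c, fun v => ∑ b ∈ S,
    mon (natExp fun i => (c i + a i - b i).toNat) v • weightProj hP n b x, hcI,
    IsPolyMap.sum _ fun b _ => IsPolyMap.const_smul_mem (mon_natExp_mem_polyFun _) _,
    fun v hv => ?_⟩
  rw [weightSection_apply, Finset.smul_sum]
  refine Finset.sum_congr rfl fun b hb => ?_
  by_cases h0 : weightProj hP n b x = 0
  · rw [h0, smul_zero, smul_zero, smul_zero]
  · rw [smul_smul, mon_natExp_mul fun i hi => hv i (hcI i hi)]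
    congr 2
    funext i
    simp only [natExp, Pi.add_apply, Pi.sub_apply]
    rw [Int.toNat_of_nonneg, add_sub_assoc]
    by_cases hi : i ∈ I
    · have := hN b hb i
      simp only [c, if_pos hi]
      omega
    · simp only [c, if_neg hi]
      by_contra hlt
      exact h0 ((mem_coeffSpace_iff.1 hx).2 b i hi (by push_cast at hlt; omega))

lemma isSec_weightSection [Infinite k] {e : ℤ} {a : Fin n → ℤ} {p : ℕ} {τ : Fin (p + 1) → Fin n}
    {x : Val P (Fin n → k)} (hx : x ∈ coeffSpace hP a (Set.range τ)) (ha : ∑ i, a i = e) :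
    IsSec P d e (inter fun i => coordForm (τ i)) fun v => weightSection hP a v x := by
  obtain ⟨c, F, hc, hF, H⟩ := exists_weightSection_denominator hx
  have hU : ∀ v ∈ inter (fun i => coordForm (k := k) (τ i)), ∀ i ∈ Set.range τ, v i ≠ 0 := by
    rintro v hv _ ⟨j, rfl⟩
    exact hv j
  have hne : ∀ v ∈ inter (fun i => coordForm (k := k) (τ i)), mon (natExp c) v ≠ 0 := by
    intro v hv
    rw [mon_natExp]
    refine Finset.prod_ne_zero_iff.2 fun i _ => ?_
    by_cases h : c i = 0
    · simp [h]
    · exact pow_ne_zero _ (hU v hv i (hc i h))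
  refine IsSec.of_denominator (mon_natExp_mem_polyFun c) hF
    (fun v hv => ⟨hne v hv, H v (hU v hv)⟩) (fun s v _ _ => ?_) fun v hv => ?_
  · rw [weightSection_apply, weightSection_apply, Finset.smul_sum]
    refine Finset.sum_congr rfl fun b _ => ?_
    by_cases h0 : weightProj hP n b x = 0
    · rw [h0, smul_zero, smul_zero, smul_zero]
    · rw [mon_smul _ s.ne_zero, smul_smul]
      simp only [Pi.sub_apply, Finset.sum_sub_distrib]
      rw [sum_natExp_eq hP h0, ha]
  · refine mem_fibre_of_mapLin_coordProj (d := d) (i := τ 0) (hv 0) ?_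
    -- Lying in the fibre is a polynomial condition on the numerator `F`. It holds on the torus by
    -- equivariance, hence everywhere.
    have hpoly : IsPolyMap k fun v => mapLin P (coordProj (τ 0) v) (F v) - v (τ 0) ^ d • F v := by
      obtain ⟨G, hG⟩ := hF.exists_expansion
      have h1 : IsPolyMap k fun v => mapLin P (coordProj (τ 0) v) (F v) := by
        simp only [hG, expSum_apply, Finsupp.sum, map_sum, map_smul]
        exact IsPolyMap.sum _ fun b _ => IsPolyMap.mul (mon_natExp_mem_polyFun b)
          (isPolyMap_mapLin_apply hP _ _)
      have h2 := (IsPolyMap.mul (pow_mem_polyFun (coord_mem_polyFun (k := k) (τ 0)) d) hF).smul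
        (-1 : k)
      simpa [sub_eq_add_neg] using h1.add h2
    have hzero := hpoly.eq_zero_of_torus (fun t ht => by
      rw [← H t fun i _ => ht i, map_smul, mapLin_coordProj_of_mem_fibre hP _
        (weightSection_mem_fibre_of_torus hP ht a (mem_coeffSpace_iff.1 hx).1), smul_comm,
        sub_self]) v
    rw [← H v (hU v hv), map_smul, smul_comm, ← smul_sub, smul_eq_zero] at hzero
    exact sub_eq_zero.1 (hzero.resolve_left (hne v hv))

variable (hP)

/-- The value at `v` of the sum of weight sections given by a finitely supported family. -/
def weightSum (v : Fin n → k) : ((Fin n → ℤ) →₀ Val P (Fin n → k)) →ₗ[k] Val P (Fin n → k) :=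
  Finsupp.lsum k fun a => weightSection hP a v

lemma weightSum_apply (v : Fin n → k) (w : (Fin n → ℤ) →₀ Val P (Fin n → k)) :
    weightSum hP v w = ∑ a ∈ w.support, weightSection hP a v (w a) := rfl

lemma weightSum_single (v : Fin n → k) (a : Fin n → ℤ) (x : Val P (Fin n → k)) :
    weightSum hP v (Finsupp.single a x) = weightSection hP a v x := by
  simp [weightSum]

lemma mapLin_scaleDual_weightSum [Infinite k] {t : Fin n → k} (ht : ∀ i, t i ≠ 0)
    (w : (Fin n → ℤ) →₀ Val P (Fin n → k)) :
    mapLin P (scaleDual t) (weightSum hP t w) = expSum id t w := by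
  rw [weightSum_apply, map_sum, expSum_apply, Finsupp.sum]
  exact Finset.sum_congr rfl fun a _ => mapLin_scaleDual_weightSection_self hP ht a _

lemma weightSum_eq_zero [Infinite k] {w : (Fin n → ℤ) →₀ Val P (Fin n → k)}
    (h : ∀ t : Fin n → k, (∀ i, t i ≠ 0) → weightSum hP t w = 0) : w = 0 :=
  expSum_eq_zero (k := k) Function.injective_id fun t ht => by
    rw [← mapLin_scaleDual_weightSum hP ht, h t ht, map_zero]

/-- Families of coefficients of sections of `P(Ω)(e)`. -/
def IsCoeffs (e : ℤ) (I : Set (Fin n)) (w : (Fin n → ℤ) →₀ Val P (Fin n → k)) : Prop :=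
  ∀ a, w a ∈ coeffSpace hP a I ∧ (w a ≠ 0 → ∑ i, a i = e)

variable {hP} {e : ℤ} {p : ℕ} {τ : Fin (p + 1) → Fin n}

lemma IsCoeffs.isSec [Infinite k] {w : (Fin n → ℤ) →₀ Val P (Fin n → k)}
    (hw : IsCoeffs hP e (Set.range τ) w) :
    IsSec P d e (inter fun i => coordForm (τ i)) fun v => weightSum hP v w := by
  have : (fun v => weightSum hP v w) = ∑ a ∈ w.support, fun v => weightSection hP a v (w a) := by
    funext v
    rw [Finset.sum_apply, weightSum_apply]
  rw [this]
  exact IsSec.sum fun a ha =>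
    isSec_weightSection (hw a).1 ((hw a).2 (Finsupp.mem_support_iff.1 ha))

/-- Every section over an intersection of complements of coordinate hyperplanes is a finite sum of
weight sections. -/
lemma IsSec.exists_coeffs [IsAlgClosed k] {f : (Fin n → k) → Val P (Fin n → k)}
    (hf : IsSec P d e (inter fun i => coordForm (τ i)) f) :
    ∃ w, IsCoeffs hP e (Set.range τ) w ∧
      ∀ v ∈ inter fun i => coordForm (k := k) (τ i), f v = weightSum hP v w := by
  obtain ⟨N, F, hF, H⟩ := exists_global_denominator hf.1
  obtain ⟨G, hG⟩ := hF.exists_expansion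
  let c : Fin n → ℕ := fun i => ∑ j, if τ j = i then N else 0
  have hc : ∀ i, c i ≠ 0 → i ∈ Set.range τ := fun i hi => by
    obtain ⟨j, _, hj⟩ := Finset.exists_ne_zero_of_sum_ne_zero hi
    exact ⟨j, by by_contra h; exact hj (if_neg h)⟩
  have hU : ∀ v ∈ inter (fun i => coordForm (k := k) (τ i)), ∀ i, c i ≠ 0 → v i ≠ 0 := by
    intro v hv i hi
    obtain ⟨j, rfl⟩ := hc i hi
    exact hv j
  have hne : ∀ v ∈ inter (fun i => coordForm (k := k) (τ i)), mon (natExp c) v ≠ 0 := by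
    intro v hv
    rw [mon_natExp]
    refine Finset.prod_ne_zero_iff.2 fun i _ => ?_
    by_cases h : c i = 0
    · simp [h]
    · exact pow_ne_zero _ (hU v hv i h)
  have hprod : ∀ v : Fin n → k, (∏ j, coordForm (k := k) (τ j) v) ^ N = mon (natExp c) v := by
    intro v
    rw [mon_natExp, ← Finset.prod_pow]
    simp only [c, ← Finset.prod_pow_eq_pow_sum]
    rw [Finset.prod_comm]
    refine Finset.prod_congr rfl fun j _ => ?_
    rw [Finset.prod_eq_single (τ j)]
    · simp
    · intro i _ hi
      rw [if_neg hi.symm, pow_zero]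
    · simp
  -- A term `v^(c'-c)` with a coefficient of weight `b` is a piece of the weight section for `a = b
  -- + c' - c`. For an index outside the range of `τ` the denominator exponent `c` is zero, so `a i
  -- ≥ b i` there.
  let w : (Fin n → ℤ) →₀ Val P (Fin n → k) := ∑ b ∈ (weightProj hP n).support,
    ∑ c' ∈ G.support, Finsupp.single (natExp b + (natExp c' - natExp c))
      (weightProj hP n b (G c'))
  have hsum : ∀ v ∈ inter fun i => coordForm (k := k) (τ i), f v = weightSum hP v w := by
    intro v hv
    simp only [w, map_sum, weightSum_single, weightSection_weightProj, add_sub_cancel_left]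
    rw [Finset.sum_comm]
    simp only [← Finset.smul_sum, sum_weightProj]
    have h1 := H ⟨v, hv⟩
    dsimp only at h1
    rw [hprod, hG, expSum_apply, Finsupp.sum] at h1
    refine smul_right_injective _ (hne v hv) ?_
    dsimp only
    rw [h1, Finset.smul_sum]
    refine Finset.sum_congr rfl fun c' _ => ?_
    rw [smul_smul, mon_natExp_mul (hU v hv), add_sub_cancel]
  have htorus : ∀ t : Fin n → k, (∀ i, t i ≠ 0) →
      expSum id t w = mapLin P (scaleDual t) (f t) := fun t ht => by
    rw [hsum t fun j => ht _, mapLin_scaleDual_weightSum hP ht]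
  refine ⟨w, fun a => ⟨mem_coeffSpace_iff.2 ⟨?_, fun b i hi hab => ?_⟩, fun ha => ?_⟩, hsum⟩
  -- After transport to the fibre at (1, …, 1), the exponential sum with coefficients `w a` vanishes
  -- modulo that fibre, so each coefficient does.
  · have : w.mapRange (fibre P (1 : Fin n → k)).mkQ (map_zero _) = 0 := by
      refine expSum_eq_zero (k := k) (ε := id) Function.injective_id fun t ht => ?_
      rw [expSum_apply, Finsupp.sum_mapRange_index (by simp)]
      simp only [← _root_.map_smul]
      rw [Finsupp.sum, ← map_sum, Submodule.mkQ_apply, Submodule.Quotient.mk_eq_zero]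
      have h1 := htorus t ht
      rw [expSum_apply, Finsupp.sum] at h1
      rw [h1]
      exact mapLin_scaleDual_mem_fibre (by
        rw [mul_one]
        exact hf.mem_fibre fun j => ht _)
    have h1 := DFunLike.congr_fun this a
    simpa using h1
  · simp only [w, Finsupp.finsetSum_apply, map_sum]
    refine Finset.sum_eq_zero fun b' _ => Finset.sum_eq_zero fun c' _ => ?_
    rw [Finsupp.single_apply]
    split_ifs with h
    · rw [weightProj_weightProj, if_neg]
      rintro rfl
      have h1 := congrFun h i
      have h2 : c i = 0 := by
        by_contra h2
        exact hi (hc i h2)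
      simp only [Pi.add_apply, Pi.sub_apply, natExp, h2] at h1
      push_cast at h1
      omega
    · exact map_zero _
  · by_contra hne'
    obtain ⟨u, hu⟩ := exists_unit_zpow_ne_one (k := k) (sub_ne_zero.2 hne')
    -- Scaling by `u` multiplies the weight `a` part by `u^(∑ a_i)`, while homogeneity multiplies
    -- the whole by `u^e`; the difference of the two has coefficients `w'`.
    let w' : (Fin n → ℤ) →₀ Val P (Fin n → k) :=
      ∑ a ∈ w.support, Finsupp.single a (((u : k) ^ (∑ i, a i) - (u : k) ^ e) • w a)
    have hw' : w' = 0 := by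
      refine expSum_eq_zero (k := k) (ε := id) Function.injective_id fun t ht => ?_
      have h1 := htorus _ fun i => mul_ne_zero u.ne_zero (ht i)
      have h2 : (fun i => (u : k) * t i) = (u : k) • t := rfl
      have h3 : f ((u : k) • t) = (u : k) ^ (e - d) • f t :=
        hf.map_smul u (fun j => ht _) (fun j => mul_ne_zero u.ne_zero (ht _))
      rw [h2, h3,
        show (u : k) • t = ((u : k) • 1) * t by simp, mapLin_scaleDual_mul, scaleDual_smul_one,
        mapLin_smul_id hP, _root_.map_smul, _root_.map_smul, ← htorus t ht, LinearMap.smul_apply,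
        LinearMap.id_apply, smul_smul, ← zpow_natCast, ← zpow_add₀ u.ne_zero, sub_add_cancel,
        expSum_apply, expSum_apply, Finsupp.sum, Finsupp.sum, Finset.smul_sum] at h1
      simp only [w', map_sum, expSum_single]
      simp only [sub_smul, smul_sub, Finset.sum_sub_distrib]
      rw [sub_eq_zero]
      convert h1 using 1
      · refine Finset.sum_congr rfl fun a _ => ?_
        rw [smul_one_mul, id, mon_smul _ u.ne_zero, smul_smul, mul_comm]
      · exact Finset.sum_congr rfl fun a _ => smul_comm _ _ _
    have h3 := DFunLike.congr_fun hw' a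
    simp only [w', Finsupp.finsetSum_apply] at h3
    rw [Finset.sum_eq_single a (fun b _ hb => by simp [hb])
      (fun h => (h (Finsupp.mem_support_iff.2 ha)).elim), Finsupp.single_eq_same,
      Finsupp.zero_apply, smul_eq_zero, sub_eq_zero] at h3
    rcases h3 with h3 | h3
    · apply hu
      rw [zpow_sub, mul_inv_eq_one]
      exact Units.ext (by simpa using h3)
    · exact ha h3

end

section

/-! ### Vanishing of Čech cohomology above the number of open sets -/

section CoefficientSystems

variable {k M ι : Type*} [Field k] [AddCommGroup M] [Module k M]

lemma range_comp_succAbove_subset {p : ℕ} (σ : Fin (p + 2) → ι) (i : Fin (p + 2)) :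
    (Set.range fun j => σ (i.succAbove j)) ⊆ Set.range σ := by
  rintro _ ⟨j, rfl⟩
  exact ⟨_, rfl⟩

lemma range_cons {p : ℕ} (a : ι) (τ : Fin p → ι) :
    Set.range (Fin.cons a τ : Fin (p + 1) → ι) = insert a (Set.range τ) :=
  Fin.range_cons a τ

lemma altSum_mem {p : ℕ} {Q : Set ι → Submodule k M} (hQ : Monotone Q) {A : Set ι}
    {b : (Fin (p + 1) → ι) → M} (hb : ∀ τ, Set.range τ ⊆ A → b τ ∈ Q (Set.range τ))
    (σ : Fin (p + 2) → ι) (hσ : Set.range σ ⊆ A) : altSum b σ ∈ Q (Set.range σ) := by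
  rw [altSum_apply]
  refine Submodule.sum_mem _ fun i _ => ?_
  exact zsmul_mem (hQ (range_comp_succAbove_subset σ i)
    (hb _ ((range_comp_succAbove_subset σ i).trans hσ))) _

open Classical in
/-- Extension by zero of a cochain defined on tuples in `A`. -/
def extendZero {p : ℕ} (A : Set ι) (b : (Fin (p + 1) → ι) → M) : (Fin (p + 1) → ι) → M :=
  fun τ => if Set.range τ ⊆ A then b τ else 0

lemma extendZero_mem {p : ℕ} {Q : Set ι → Submodule k M} {A : Set ι}
    {b : (Fin (p + 1) → ι) → M} (hb : ∀ τ, Set.range τ ⊆ A → b τ ∈ Q (Set.range τ))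
    (τ : Fin (p + 1) → ι) : extendZero A b τ ∈ Q (Set.range τ) := by
  unfold extendZero
  split_ifs with h
  · exact hb τ h
  · exact Submodule.zero_mem _

lemma altSum_extendZero {p : ℕ} {A : Set ι} {b : (Fin (p + 1) → ι) → M} {σ : Fin (p + 2) → ι}
    (hσ : Set.range σ ⊆ A) : altSum (extendZero A b) σ = altSum b σ :=
  altSum_congr fun i => if_pos ((range_comp_succAbove_subset σ i).trans hσ)

/-- The Čech cohomology of a coefficient system on the subsets of a set `A` vanishes in degrees at
least the cardinality of `A`. -/
lemma exists_altSum_eq_of_card_le (m : ℕ) : ∀ (A : Finset ι), A.card = m →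
    ∀ Q : Set ι → Submodule k M, Monotone Q → ∀ p : ℕ, m ≤ p + 1 → ∀ c : (Fin (p + 2) → ι) → M,
    (∀ σ, Set.range σ ⊆ A → c σ ∈ Q (Set.range σ)) →
    (∀ σ, Set.range σ ⊆ A → altSum c σ = 0) →
    ∃ b : (Fin (p + 1) → ι) → M, (∀ τ, Set.range τ ⊆ A → b τ ∈ Q (Set.range τ)) ∧
      ∀ σ, Set.range σ ⊆ A → altSum b σ = c σ := by
  classical
  induction m with
  | zero =>
    intro A hA Q _ p _ c _ _
    rw [Finset.card_eq_zero] at hA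
    subst hA
    refine ⟨0, fun _ _ => Submodule.zero_mem _, fun σ hσ => ?_⟩
    exact absurd (hσ ⟨0, rfl⟩) (by simp)
  | succ m ih =>
    intro A hA Q hQ p hp c hc hcl
    obtain ⟨a, A', ha, rfl, hA'⟩ := Finset.card_eq_succ.1 hA
    have hsub : (A' : Set ι) ⊆ (insert a A' : Finset ι) := by simp
    obtain ⟨b₀, hb₀, hb₀c⟩ := ih A' hA' Q hQ p (by omega) c (fun σ hσ => hc σ (hσ.trans hsub))
      fun σ hσ => hcl σ (hσ.trans hsub)
    set B₀ := extendZero (A' : Set ι) b₀ with hB₀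
    have hB₀m : ∀ τ, B₀ τ ∈ Q (Set.range τ) := extendZero_mem hb₀
    set c₁ := c - altSum B₀ with hc₁
    have hc₁m : ∀ σ, Set.range σ ⊆ (insert a A' : Finset ι) → c₁ σ ∈ Q (Set.range σ) :=
      fun σ hσ => Submodule.sub_mem _ (hc σ hσ) (altSum_mem hQ (fun τ _ => hB₀m τ) σ hσ)
    have hc₁0 : ∀ σ, Set.range σ ⊆ A' → c₁ σ = 0 := fun σ hσ => by
      rw [hc₁, Pi.sub_apply, altSum_extendZero hσ, hb₀c σ hσ, sub_self]
    have hc₁cl : ∀ σ, Set.range σ ⊆ (insert a A' : Finset ι) → altSum c₁ σ = 0 := fun σ hσ => by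
      rw [hc₁, map_sub, altSum_altSum, sub_zero, hcl σ hσ]
    -- The cone on `a` is a primitive of `c₁`, but its values lie only in `Q (insert a (range τ))`.
    -- This is too large precisely for tuples inside `A'`.
    let b₁ : (Fin (p + 1) → ι) → M := fun τ => c₁ (Fin.cons a τ)
    have hcons : ∀ {q : ℕ} {τ : Fin q → ι}, Set.range τ ⊆ (insert a A' : Finset ι) →
        Set.range (Fin.cons a τ : Fin (q + 1) → ι) ⊆ (insert a A' : Finset ι) := fun hτ => by
      rw [range_cons]
      exact Set.insert_subset (by simp) hτ
    have hb₁ : ∀ σ, Set.range σ ⊆ (insert a A' : Finset ι) → altSum b₁ σ = c₁ σ := fun σ hσ => by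
      have h := hc₁cl _ (hcons hσ)
      rw [altSum_cons, sub_eq_zero] at h
      exact h.symm
    have hb₁m : ∀ τ, Set.range τ ⊆ (insert a A' : Finset ι) →
        b₁ τ ∈ Q (insert a (Set.range τ)) := fun τ hτ => by
      rw [← range_cons]
      exact hc₁m _ (hcons hτ)
    have hrange : ∀ {q : ℕ} {τ : Fin q → ι}, Set.range τ ⊆ (insert a A' : Finset ι) →
        ¬ Set.range τ ⊆ A' → insert a (Set.range τ) = Set.range τ := fun hτ hn => by
      refine Set.insert_eq_of_mem ?_
      by_contra h
      refine hn fun x hx => ?_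
      have h1 := hτ hx
      rw [Finset.coe_insert] at h1
      exact h1.resolve_left fun h2 => h (h2 ▸ hx)
    have hQ' : Monotone fun I => Q (insert a I) := fun I J h => hQ (Set.insert_subset_insert h)
    -- On `A'` the cone `b₁` is a cocycle for the system `I ↦ Q (insert a I)`, one degree lower. By
    -- induction it is a coboundary there, and extending the primitive by zero gives a closed
    -- correction that agrees with `b₁` on `A'`.
    obtain ⟨b₂, hb₂, hb₂0, hb₂cl⟩ : ∃ b₂ : (Fin (p + 1) → ι) → M,
        (∀ τ, Set.range τ ⊆ (insert a A' : Finset ι) → b₂ τ ∈ Q (insert a (Set.range τ))) ∧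
        (∀ τ, Set.range τ ⊆ A' → b₂ τ = b₁ τ) ∧ altSum b₂ = 0 := by
      cases p with
      | zero =>
        obtain rfl : A' = ∅ := Finset.card_eq_zero.1 (by omega)
        exact ⟨0, fun τ _ => Submodule.zero_mem _,
          fun τ hτ => absurd (hτ ⟨0, rfl⟩) (by simp), map_zero _⟩
      | succ p =>
        obtain ⟨b, hb, hbc⟩ := ih A' hA' (fun I => Q (insert a I)) hQ' p (by omega) b₁
          (fun σ hσ => hb₁m σ (hσ.trans hsub)) fun σ hσ => by
            rw [hb₁ σ (hσ.trans hsub), hc₁0 σ hσ]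
        exact ⟨altSum (extendZero (A' : Set ι) b), fun τ hτ => altSum_mem
          (Q := fun I => Q (insert a I)) hQ' (fun τ _ =>
            extendZero_mem (Q := fun I => Q (insert a I)) hb τ) τ hτ,
          fun τ hτ => by rw [altSum_extendZero hτ, hbc τ hτ], altSum_altSum _⟩
    refine ⟨B₀ + (b₁ - b₂), fun τ hτ => Submodule.add_mem _ (hB₀m τ) ?_, fun σ hσ => ?_⟩
    · by_cases h : Set.range τ ⊆ A'
      · rw [Pi.sub_apply, hb₂0 τ h, sub_self]
        exact Submodule.zero_mem _
      · rw [← hrange hτ h]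
        exact Submodule.sub_mem _ (hb₁m τ hτ) (hb₂ τ hτ)
    · rw [map_add, map_sub, hb₂cl, sub_zero, Pi.add_apply, hb₁ σ hσ, hc₁, Pi.sub_apply,
        add_sub_cancel]

end CoefficientSystems

variable {k : Type u} [Field k] {P : FGModuleCat.{u} k ⥤ FGModuleCat.{u} k} {d : ℕ} {n : ℕ}
  {hP : IsPolynomialFunctor k P d}

/-! ### Weights and the projection to the fibre at (1, …, 1) -/

section Triangularity

lemma scaleDual_comp_coordProj (ν : Fin n) (t : Fin n → k) :
    (scaleDual t).comp (coordProj ν t) = t ν • (coordProj ν 1).comp (scaleDual t) := by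
  refine LinearMap.ext fun ξ => LinearMap.ext fun v => ?_
  simp only [LinearMap.comp_apply, LinearMap.smul_apply, coordProj_apply, scaleDual_apply,
    LinearMap.sub_apply, coordForm_apply, Pi.mul_apply, Pi.one_apply, smul_eq_mul, mul_one, one_mul]
  ring

variable (hP) in
lemma weightProj_mapLin_scaleDual [Infinite k] (t : Fin n → k) (b : Fin n → ℕ)
    (x : Val P (Fin n → k)) :
    weightProj hP n b (mapLin P (scaleDual t) x) = mon (natExp b) t • weightProj hP n b x := by
  rw [mapLin_scaleDual hP, map_sum]
  simp only [map_smul, weightProj_weightProj]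
  by_cases hb : b ∈ (weightProj hP n).support
  · rw [Finset.sum_eq_single b (fun c _ hc => by rw [if_neg hc.symm, smul_zero])
      (fun h => (h hb).elim), if_pos rfl]
  · rw [weightProj_of_notMem hP hb, smul_zero]
    refine Finset.sum_eq_zero fun c hc => ?_
    rw [if_neg (by rintro rfl; exact hb hc), smul_zero]

variable (hP) in
/-- The weight component of `x`, moved to the fibre at `(1, …, 1)` by the projection along the
coordinate form with index `ν`. -/
def fibreWeight (ν : Fin n) (b : Fin n → ℕ) : Module.End k (Val P (Fin n → k)) :=
  mapLin P (coordProj ν 1) ∘ₗ weightProj hP n b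

lemma fibreWeight_apply (ν : Fin n) (b : Fin n → ℕ) (x : Val P (Fin n → k)) :
    fibreWeight hP ν b x = mapLin P (coordProj ν 1) (weightProj hP n b x) := rfl

lemma sum_fibreWeight (ν : Fin n) {x : Val P (Fin n → k)} (hx : x ∈ fibre P (1 : Fin n → k)) :
    ∑ b ∈ (weightProj hP n).support, fibreWeight hP ν b x = x := by
  simp only [fibreWeight_apply, ← map_sum, sum_weightProj]
  rw [mapLin_coordProj_of_mem_fibre hP ν hx, Pi.one_apply, one_pow, one_smul]

/-- Equivariance of `coordProj` gives `t^b π_b(P(coordProj ν t) y) = t_ν^d t^(b') π_b(P(coordProj ν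
1) y)` for `y` of weight `b'`. The left side is `t^b` times a polynomial in `t`, so a nonzero right
side forces `b ≤ b' + d e_ν`. This triangularity keeps `fibreWeight` inside `coeffSpace` when `ν ∈
I`. -/
lemma le_of_weightProj_fibreWeight [Infinite k] {ν : Fin n} {b b' : Fin n → ℕ}
    {x : Val P (Fin n → k)} (h : weightProj hP n b (fibreWeight hP ν b' x) ≠ 0) {i : Fin n}
    (hi : i ≠ ν) : b i ≤ b' i := by
  by_contra! hlt
  apply h
  set y := weightProj hP n b' x with hy
  set X := weightProj hP n b (fibreWeight hP ν b' x) with hX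
  obtain ⟨A, hA⟩ := ((isPolyMap_mapLin_apply hP (coordProj ν) y).pull LinearMap.id
    (weightProj hP n b)).exists_expansion
  let ε : (Fin n → ℕ) → Fin n → ℤ := fun c => natExp b + natExp c
  let ε₀ : Fin n → ℤ := Pi.single ν (d : ℤ) + natExp b'
  have key : ∀ t : Fin n → k, (∀ i, t i ≠ 0) → expSum ε t A = mon ε₀ t • X := by
    intro t ht
    have h1 : mapLin P (scaleDual t) (mapLin P (coordProj ν t) y) =
        t ν ^ d • mapLin P (coordProj ν 1) (mapLin P (scaleDual t) y) := by
      rw [← mapLin_comp_apply, scaleDual_comp_coordProj, mapLin_smul hP, LinearMap.smul_apply,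
        mapLin_comp_apply]
    have h2 := congrArg (weightProj hP n b) h1
    have h3 : mon (Pi.single ν (d : ℤ)) t = t ν ^ d := by
      rw [mon, Finset.prod_eq_single ν]
      · simp
      · intro j _ hj
        simp [hj]
      · simp
    have h4 := hA t
    rw [LinearMap.id_apply] at h4
    rw [weightProj_mapLin_scaleDual, h4, map_smul, mapLin_scaleDual_weightProj, map_smul, map_smul,
      smul_smul, ← h3, ← mon_add ht, expSum_apply, Finsupp.smul_sum] at h2
    rw [expSum_apply]
    refine Eq.trans (Finsupp.sum_congr fun c _ => ?_) h2
    rw [smul_smul, ← mon_add ht]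
  have hG := expSum_eq_zero (k := k) (ε := id)
    (G := Finsupp.mapDomain ε A - Finsupp.single ε₀ X) Function.injective_id fun t ht => by
      rw [map_sub, expSum_single, id, ← key t ht, expSum_apply, expSum_apply,
        Finsupp.sum_mapDomain_index (by simp) (by simp [smul_add]), sub_eq_zero]
      rfl
  have h5 := DFunLike.congr_fun hG ε₀
  rw [Finsupp.sub_apply, Finsupp.single_eq_same, Finsupp.mapDomain_of_notMem_range, zero_sub,
    Finsupp.zero_apply, neg_eq_zero] at h5
  · exact h5
  · rintro ⟨c, hc⟩
    have h6 := congrFun hc i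
    simp only [ε, ε₀, Pi.add_apply, Pi.single_eq_of_ne hi, natExp] at h6
    omega

/-- The projection `ξ ↦ ξ - ξ(1) x_ν` kills `x_ν`, so it factors through setting the `ν`-th torus
entry to zero, which annihilates weights with `b ν > 0`. -/
lemma eq_zero_of_fibreWeight [Infinite k] {ν : Fin n} {b : Fin n → ℕ} {x : Val P (Fin n → k)}
    (h : fibreWeight hP ν b x ≠ 0) : b ν = 0 := by
  by_contra hb
  apply h
  let κ : Fin n → k := Function.update 1 ν 0
  have h1 : (coordProj ν 1).comp (scaleDual κ) = coordProj ν (1 : Fin n → k) := by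
    refine LinearMap.ext fun ξ => LinearMap.ext fun v => ?_
    have h2 : ∀ w : Fin n → k, κ * w = w - w ν • Pi.single ν 1 := fun w => by
      funext i
      by_cases hi : i = ν
      · subst hi
        simp [κ]
      · simp [κ, hi]
    simp only [LinearMap.comp_apply, coordProj_apply, LinearMap.sub_apply, LinearMap.smul_apply,
      scaleDual_apply, h2, map_sub, map_smul, coordForm_apply, smul_eq_mul, Pi.one_apply]
    ring
  rw [fibreWeight_apply, ← h1, mapLin_comp_apply, mapLin_scaleDual_weightProj, map_smul]
  have h2 : mon (natExp b) κ = 0 := by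
    rw [mon_natExp]
    exact Finset.prod_eq_zero (Finset.mem_univ ν) (by simp [κ, hb])
  rw [h2, zero_smul]

lemma fibreWeight_mem_coeffSpace [Infinite k] {ν : Fin n} {b : Fin n → ℕ} {a : Fin n → ℤ}
    {I : Set (Fin n)} {x : Val P (Fin n → k)} (hν : ν ∈ I)
    (h : ∀ i ∉ I, a i < b i → weightProj hP n b x = 0) :
    fibreWeight hP ν b x ∈ coeffSpace hP a I := by
  rw [mem_coeffSpace_iff]
  refine ⟨mapLin_coordProj_mem_fibre ν 1 _, fun b' i hi hlt => ?_⟩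
  by_contra hne
  have hle := le_of_weightProj_fibreWeight hne (i := i) (by rintro rfl; exact hi hν)
  apply hne
  rw [fibreWeight_apply, h i hi (by omega), map_zero, map_zero]

end Triangularity

/-! ### Exactness of the weight pieces -/

section Exactness

variable {ν : Fin n} {a : Fin n → ℤ}

lemma fibreWeight_eq_zero_of_forall [Infinite k] {p : ℕ} {b : Fin n → ℕ}
    (hb : ∀ i, i ≠ ν → a i < b i) {τ : Fin (p + 1) → Fin n} {x : Val P (Fin n → k)}
    (hx : x ∈ coeffSpace hP a (Set.range τ)) (hν : ν ∉ Set.range τ → x = 0)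
    (hnum : p + 1 < n ∨ (d : ℤ) < ∑ i, a i - a ν + n - 1) : fibreWeight hP ν b x = 0 := by
  by_contra hne
  rcases hnum with hp | hd
  · obtain ⟨i, hi⟩ : ∃ i, i ∉ Set.range τ := by
      by_contra! h
      have := Fintype.card_le_of_surjective τ h
      simp at this
      omega
    apply hne
    by_cases hiν : i = ν
    · rw [hν (hiν ▸ hi), map_zero]
    · rw [fibreWeight_apply, (mem_coeffSpace_iff.1 hx).2 b i hi (hb i hiν), map_zero]
  · have h0 : b ν = 0 := eq_zero_of_fibreWeight hne
    have h1 : ∑ i, natExp b i = d := sum_natExp_eq hP (x := x) fun h => hne (by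
      rw [fibreWeight_apply, h, map_zero])
    rw [← Finset.add_sum_erase _ _ (Finset.mem_univ ν)] at h1 hd
    have h2 : ∑ i ∈ Finset.univ.erase ν, (a i + 1) ≤ ∑ i ∈ Finset.univ.erase ν, natExp b i :=
      Finset.sum_le_sum fun i hi => by
        have := hb i (Finset.ne_of_mem_erase hi)
        simp only [natExp]
        omega
    rw [Finset.sum_add_distrib, Finset.sum_const, Finset.card_erase_of_mem (Finset.mem_univ ν),
      Finset.card_univ, Fintype.card_fin, nsmul_eq_mul, mul_one] at h2
    have hn : 1 ≤ n := by have := ν.2; omega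
    rw [Nat.cast_sub hn] at h2
    simp only [natExp, h0] at h1 h2
    push_cast at h1 h2
    omega

/-- Exactness of the complex of weight `a` cochains supported on the tuples that contain `ν`. -/
lemma exists_altSum_eq_of_supported [Infinite k] {p : ℕ}
    {c : (Fin (p + 2) → Fin n) → Val P (Fin n → k)}
    (hc : ∀ σ, c σ ∈ coeffSpace hP a (Set.range σ)) (hν : ∀ σ, ν ∉ Set.range σ → c σ = 0)
    (hcl : altSum c = 0) (hnum : p + 2 < n ∨ (d : ℤ) < ∑ i, a i - a ν + n - 1) :
    ∃ g : (Fin (p + 1) → Fin n) → Val P (Fin n → k),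
      (∀ τ, g τ ∈ coeffSpace hP a (Set.range τ)) ∧ (∀ τ, ν ∉ Set.range τ → g τ = 0) ∧
      altSum g = c := by
  have key : ∀ b : Fin n → ℕ, ∃ g : (Fin (p + 1) → Fin n) → Val P (Fin n → k),
      (∀ τ, g τ ∈ coeffSpace hP a (Set.range τ)) ∧ (∀ τ, ν ∉ Set.range τ → g τ = 0) ∧
      ∀ σ, altSum g σ = fibreWeight hP ν b (c σ) := by
    intro b
    by_cases hb : ∀ i, i ≠ ν → a i < b i
    · refine ⟨0, fun _ => Submodule.zero_mem _, fun _ _ => rfl, fun σ => ?_⟩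
      rw [fibreWeight_eq_zero_of_forall hb (hc σ) (hν σ) hnum, map_zero]
      rfl
    · push Not at hb
      obtain ⟨i₀, hi₀, hb⟩ := hb
      have h0 : ∀ τ : Fin (p + 1) → Fin n, ν ∉ Set.range τ →
          fibreWeight hP ν b (c (Fin.cons i₀ τ)) = 0 := fun τ hτ => by
        rw [hν, map_zero]
        rw [range_cons]
        rintro (h | h)
        · exact hi₀ h.symm
        · exact hτ h
      -- Since `b i₀ ≤ a i₀`, membership in `coeffSpace` imposes no condition on the weight `b` at
      -- `i₀`, so removing `i₀` from the index set is harmless. Since `i₀ ≠ ν`, the support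
      -- condition persists.
      refine ⟨fun τ => fibreWeight hP ν b (c (Fin.cons i₀ τ)), fun τ => ?_, h0, fun σ => ?_⟩
      · by_cases hτ : ν ∈ Set.range τ
        · refine fibreWeight_mem_coeffSpace hτ fun i hi hlt => ?_
          refine (mem_coeffSpace_iff.1 (hc _)).2 b i ?_ hlt
          rw [range_cons]
          rintro (h | h)
          · subst h
            omega
          · exact hi h
        · dsimp only
          rw [h0 τ hτ]
          exact Submodule.zero_mem _
      · have h1 := altSum_cons c i₀ σ
        rw [hcl, Pi.zero_apply, eq_comm, sub_eq_zero] at h1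
        rw [h1]
        exact altSum_comp (fibreWeight hP ν b).toAddMonoidHom _ σ
  choose g hg hg0 hgc using key
  refine ⟨∑ b ∈ (weightProj hP n).support, g b, fun τ => ?_, fun τ hτ => ?_, funext fun σ => ?_⟩
  · rw [Finset.sum_apply]
    exact Submodule.sum_mem _ fun b _ => hg b τ
  · rw [Finset.sum_apply]
    exact Finset.sum_eq_zero fun b _ => hg0 b τ hτ
  · rw [map_sum, Finset.sum_apply]
    simp only [hgc]
    exact sum_fibreWeight ν (mem_coeffSpace_iff.1 (hc σ)).1

lemma eq_zero_of_supported [Infinite k] {c : (Fin 1 → Fin n) → Val P (Fin n → k)}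
    (hc : ∀ σ, c σ ∈ coeffSpace hP a (Set.range σ)) (hν : ∀ σ, ν ∉ Set.range σ → c σ = 0)
    (hcl : altSum c = 0) (hnum : 1 < n ∨ (d : ℤ) < ∑ i, a i - a ν + n - 1) : c = 0 := by
  funext σ
  rw [Pi.zero_apply, ← sum_fibreWeight (hP := hP) ν (mem_coeffSpace_iff.1 (hc σ)).1]
  refine Finset.sum_eq_zero fun b _ => ?_
  by_cases hb : ∀ i, i ≠ ν → a i < b i
  · exact fibreWeight_eq_zero_of_forall hb (hc σ) (hν σ) (by simpa using hnum)
  · push Not at hb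
    obtain ⟨i₀, hi₀, hb⟩ := hb
    have h1 := altSum_cons_zero c i₀ σ
    rw [hcl, Pi.zero_apply, eq_comm, sub_eq_zero] at h1
    rw [h1, hν, map_zero]
    rintro ⟨_, h⟩
    exact hi₀ h

variable (hP) in
/-- The complex of weight `a` cochains is exact in degree `p`. -/
def CoeffExact (a : Fin n → ℤ) : ℕ → Prop
  | 0 => ∀ c : (Fin 1 → Fin n) → Val P (Fin n → k),
      (∀ σ, c σ ∈ coeffSpace hP a (Set.range σ)) → altSum c = 0 → c = 0
  | p + 1 => ∀ c : (Fin (p + 2) → Fin n) → Val P (Fin n → k),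
      (∀ σ, c σ ∈ coeffSpace hP a (Set.range σ)) → altSum c = 0 →
      ∃ g : (Fin (p + 1) → Fin n) → Val P (Fin n → k),
        (∀ τ, g τ ∈ coeffSpace hP a (Set.range τ)) ∧ altSum g = c

lemma coeffExact_of_neg [Infinite k] {p : ℕ} (ha : a ν < 0)
    (hnum : p + 1 < n ∨ (d : ℤ) < ∑ i, a i - a ν + n - 1) : CoeffExact hP a p := by
  cases p with
  | zero =>
    exact fun c hc hcl => eq_zero_of_supported hc
      (fun σ hσ => coeffSpace_eq_zero ha hσ (hc σ)) hcl (by simpa using hnum)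
  | succ p =>
    intro c hc hcl
    obtain ⟨g, hg, _, hgc⟩ := exists_altSum_eq_of_supported hc
      (fun σ hσ => coeffSpace_eq_zero ha hσ (hc σ)) hcl hnum
    exact ⟨g, hg, hgc⟩

lemma coeffExact_of_le {p : ℕ} (hp : n ≤ p) : CoeffExact hP a p := by
  cases p with
  | zero =>
    obtain rfl : n = 0 := by omega
    intro c _ _
    funext σ
    exact (σ 0).elim0
  | succ p =>
    intro c hc hcl
    obtain ⟨b, hb, hbc⟩ := exists_altSum_eq_of_card_le n (Finset.univ : Finset (Fin n)) (by simp)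
      (coeffSpace hP a) (fun _ _ h => coeffSpace_mono h) p hp c (fun σ _ => hc σ)
      fun σ _ => by rw [hcl]; rfl
    exact ⟨b, fun τ => hb τ (by simp), funext fun σ => hbc σ (by simp)⟩

end Exactness

end

section

variable {k : Type u} [Field k] {P : FGModuleCat.{u} k ⥤ FGModuleCat.{u} k}
  {d : ℕ} {n p : ℕ} {hP : IsPolynomialFunctor k P d} {e : ℤ}

/-! ### From exactness of weight pieces to cochains of sections -/

section Assembly

lemma altSum_finsupp_apply {α J M : Type*} [AddCommGroup M] {p : ℕ}
    (w : (Fin (p + 1) → α) → J →₀ M) (σ : Fin (p + 2) → α) (a : J) :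
    altSum w σ a = altSum (fun τ => w τ a) σ :=
  (altSum_comp (Finsupp.applyAddHom a) w σ).symm

lemma altSum_weightSum (w : (Fin (p + 1) → Fin n) → (Fin n → ℤ) →₀ Val P (Fin n → k))
    (σ : Fin (p + 2) → Fin n) (v : Fin n → k) :
    altSum (fun τ v => weightSum hP v (w τ)) σ v = weightSum hP v (altSum w σ) := by
  rw [altSum_apply_apply]
  exact altSum_comp (weightSum hP v).toAddMonoidHom w σ

lemma IsCoeffs.altSum {w : (Fin (p + 1) → Fin n) → (Fin n → ℤ) →₀ Val P (Fin n → k)}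
    (hw : ∀ τ, IsCoeffs hP e (Set.range τ) (w τ)) (σ : Fin (p + 2) → Fin n) :
    IsCoeffs hP e (Set.range σ) (altSum w σ) := fun a => by
  rw [altSum_finsupp_apply]
  refine ⟨altSum_mem (A := Set.univ) (fun _ _ h => coeffSpace_mono h) (fun τ _ => (hw τ a).1) σ
    (Set.subset_univ _), fun h => ?_⟩
  rw [PolyOmega.altSum_apply] at h
  obtain ⟨i, _, hi⟩ := Finset.exists_ne_zero_of_sum_ne_zero h
  exact (hw _ a).2 fun h0 => hi (by rw [h0, smul_zero])

lemma IsCoeffs.add {I : Set (Fin n)} {w w' : (Fin n → ℤ) →₀ Val P (Fin n → k)}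
    (hw : IsCoeffs hP e I w) (hw' : IsCoeffs hP e I w') : IsCoeffs hP e I (w + w') := fun a => by
  refine ⟨Submodule.add_mem _ (hw a).1 (hw' a).1, fun h => ?_⟩
  by_cases h0 : w a = 0
  · refine (hw' a).2 fun h1 => h ?_
    rw [Finsupp.add_apply, h0, h1, add_zero]
  · exact (hw a).2 h0

lemma IsCoeffs.sub {I : Set (Fin n)} {w w' : (Fin n → ℤ) →₀ Val P (Fin n → k)}
    (hw : IsCoeffs hP e I w) (hw' : IsCoeffs hP e I w') : IsCoeffs hP e I (w - w') := fun a => by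
  refine ⟨Submodule.sub_mem _ (hw a).1 (hw' a).1, fun h => ?_⟩
  by_cases h0 : w a = 0
  · refine (hw' a).2 fun h1 => h ?_
    rw [Finsupp.sub_apply, h0, h1, sub_zero]
  · exact (hw a).2 h0

lemma IsCoeffs.single {I : Set (Fin n)} {a : Fin n → ℤ} {x : Val P (Fin n → k)}
    (hx : x ∈ coeffSpace hP a I) (ha : ∑ i, a i = e) :
    IsCoeffs hP e I (Finsupp.single a x) := fun b => by
  classical
  rw [Finsupp.single_apply]
  split_ifs with h
  · subst h
    exact ⟨hx, fun _ => ha⟩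
  · exact ⟨Submodule.zero_mem _, fun h => (h rfl).elim⟩

/-- Weightwise exactness implies exactness. -/
lemma exists_coeffs_altSum_eq {w : (Fin (p + 2) → Fin n) → (Fin n → ℤ) →₀ Val P (Fin n → k)}
    (hw : ∀ σ, IsCoeffs hP e (Set.range σ) (w σ)) {R : (Fin (p + 1) → Fin n) → Prop}
    (hex : ∀ a, ∑ i, a i = e → (∃ σ, w σ a ≠ 0) →
      ∃ g : (Fin (p + 1) → Fin n) → Val P (Fin n → k),
        (∀ τ, g τ ∈ coeffSpace hP a (Set.range τ)) ∧ (∀ τ, R τ → g τ = 0) ∧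
        altSum g = fun σ => w σ a) :
    ∃ g : (Fin (p + 1) → Fin n) → (Fin n → ℤ) →₀ Val P (Fin n → k),
      (∀ τ, IsCoeffs hP e (Set.range τ) (g τ)) ∧ (∀ τ, R τ → g τ = 0) ∧ altSum g = w := by
  classical
  have h : ∀ a, ∃ g : (Fin (p + 1) → Fin n) → Val P (Fin n → k),
      (∀ τ, g τ ∈ coeffSpace hP a (Set.range τ)) ∧ (∀ τ, R τ → g τ = 0) ∧
      (altSum g = fun σ => w σ a) ∧ ((∀ σ, w σ a = 0) → g = 0) ∧
      ((∃ σ, w σ a ≠ 0) → ∑ i, a i = e) := by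
    intro a
    by_cases ha : ∃ σ, w σ a ≠ 0
    · obtain ⟨σ, hσ⟩ := ha
      obtain ⟨g, h1, h2, h3⟩ := hex a ((hw σ a).2 hσ) ⟨σ, hσ⟩
      exact ⟨g, h1, h2, h3, fun h => (hσ (h σ)).elim, fun _ => (hw σ a).2 hσ⟩
    · push Not at ha
      exact ⟨0, fun _ => Submodule.zero_mem _, fun _ _ => rfl,
        by rw [map_zero]; exact funext fun σ => (ha σ).symm, fun _ => rfl,
        fun ⟨σ, hσ⟩ => (hσ (ha σ)).elim⟩
  choose g hg hgR hgw hg0 hge using h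
  -- Only finitely many weights occur, and the primitives were chosen to be zero for all others, so
  -- they assemble to finite sums.
  let S : Finset (Fin n → ℤ) := Finset.univ.biUnion fun σ => (w σ).support
  let G : (Fin (p + 1) → Fin n) → (Fin n → ℤ) →₀ Val P (Fin n → k) :=
    fun τ => ∑ a ∈ S, Finsupp.single a (g a τ)
  have hG : ∀ τ a, G τ a = g a τ := by
    intro τ a
    simp only [G, Finsupp.finsetSum_apply]
    by_cases ha : a ∈ S
    · rw [Finset.sum_eq_single a (fun b _ hb => Finsupp.single_eq_of_ne hb.symm)
        (fun h => (h ha).elim), Finsupp.single_eq_same]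
    · rw [hg0 a, Finset.sum_eq_zero]
      · rfl
      · intro b hb
        exact Finsupp.single_eq_of_ne (by rintro rfl; exact ha hb)
      · intro σ
        by_contra h
        exact ha (Finset.mem_biUnion.2 ⟨σ, Finset.mem_univ σ, Finsupp.mem_support_iff.2 h⟩)
  refine ⟨G, fun τ a => ?_, fun τ hτ => ?_, ?_⟩
  · rw [hG]
    refine ⟨hg a τ, fun h => hge a ?_⟩
    by_contra! h'
    exact h (by rw [hg0 a h']; rfl)
  · ext a
    rw [hG, hgR a τ hτ]
    rfl
  · funext σ
    ext a
    rw [altSum_finsupp_apply]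
    simp only [hG]
    exact congrFun (hgw a) σ

lemma exists_coeffs_cochain [IsAlgClosed k]
    {c : (Fin (p + 1) → Fin n) → (Fin n → k) → Val P (Fin n → k)}
    (hc : IsCochain P d e coordForm c) :
    ∃ w : (Fin (p + 1) → Fin n) → (Fin n → ℤ) →₀ Val P (Fin n → k),
      (∀ σ, IsCoeffs hP e (Set.range σ) (w σ)) ∧
      ∀ σ, ∀ v ∈ inter fun i => coordForm (σ i), c σ v = weightSum hP v (w σ) := by
  choose w hw h using fun σ => (hc σ).exists_coeffs (hP := hP)
  exact ⟨w, hw, h⟩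

lemma altSum_apply_eq_weightSum [IsAlgClosed k]
    {c : (Fin (p + 1) → Fin n) → (Fin n → k) → Val P (Fin n → k)}
    {w : (Fin (p + 1) → Fin n) → (Fin n → ℤ) →₀ Val P (Fin n → k)}
    (h : ∀ σ, ∀ v ∈ inter fun i => coordForm (σ i), c σ v = weightSum hP v (w σ))
    (σ : Fin (p + 2) → Fin n) {v : Fin n → k} (hv : v ∈ inter fun i => coordForm (σ i)) :
    altSum c σ v = weightSum hP v (altSum w σ) := by
  rw [← altSum_weightSum]
  exact altSum_congr_apply fun i => h _ v (inter_face_mem hv i)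

lemma altSum_coeffs_eq_zero [IsAlgClosed k]
    {c : (Fin (p + 1) → Fin n) → (Fin n → k) → Val P (Fin n → k)}
    (hc : IsClosed P coordForm c)
    {w : (Fin (p + 1) → Fin n) → (Fin n → ℤ) →₀ Val P (Fin n → k)}
    (h : ∀ σ, ∀ v ∈ inter fun i => coordForm (σ i), c σ v = weightSum hP v (w σ)) :
    altSum w = 0 := funext fun σ => weightSum_eq_zero hP fun t ht => by
  rw [← altSum_apply_eq_weightSum h σ fun i => ht _]
  exact hc σ t fun i => ht _

lemma isCochain_weightSum [Infinite k]
    {w : (Fin (p + 1) → Fin n) → (Fin n → ℤ) →₀ Val P (Fin n → k)}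
    (hw : ∀ σ, IsCoeffs hP e (Set.range σ) (w σ)) :
    IsCochain P d e coordForm fun σ v => weightSum hP v (w σ) := fun σ => (hw σ).isSec

lemma isClosed_weightSum {w : (Fin (p + 1) → Fin n) → (Fin n → ℤ) →₀ Val P (Fin n → k)}
    (hw : altSum w = 0) : IsClosed P coordForm fun σ v => weightSum hP v (w σ) :=
  fun σ v _ => by rw [altSum_weightSum, hw, Pi.zero_apply, map_zero]

lemma isCob_weightSum [IsAlgClosed k] {w : (Fin (p + 1) → Fin n) → (Fin n → ℤ) →₀ Val P (Fin n → k)}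
    (hw : ∀ σ, IsCoeffs hP e (Set.range σ) (w σ)) (hcl : altSum w = 0)
    (hex : ∀ a, ∑ i, a i = e → (∃ σ, w σ a ≠ 0) → CoeffExact hP a p) :
    IsCob P d e coordForm fun σ v => weightSum hP v (w σ) := by
  have hcl' : ∀ a, altSum (fun σ => w σ a) = 0 := fun a => funext fun σ => by
    rw [← altSum_finsupp_apply, hcl]
    rfl
  cases p with
  | zero =>
    refine isCob_of_eq_zero fun σ v _ => ?_
    suffices h : w σ = 0 by rw [h, map_zero]
    ext a
    by_contra hne
    exact hne (congrFun (hex a ((hw σ a).2 hne) ⟨σ, hne⟩ (fun σ => w σ a) (fun σ => (hw σ a).1)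
      (hcl' a)) σ)
  | succ p =>
    obtain ⟨g, hg, _, hgw⟩ := exists_coeffs_altSum_eq hw (R := fun _ => False)
      fun a ha hne => by
        obtain ⟨g, hg, hgc⟩ := hex a ha hne (fun σ => w σ a) (fun σ => (hw σ a).1) (hcl' a)
        exact ⟨g, hg, fun _ h => h.elim, hgc⟩
    exact ⟨_, isCochain_weightSum hg, fun σ v _ => by rw [altSum_weightSum, hgw]⟩

end Assembly

/-! ### Representing classes on the coordinate cover -/

section Representatives

/-- The small Čech cochain underlying a Čech cochain. -/
def smallCochain (c : Cochain P d e (Fin n → k) p) :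
    (Fin (p + 1) → Fin n) → (Fin n → k) → Val P (Fin n → k) :=
  fun τ => cochainFun c fun i => coordForm (τ i)

lemma smallCochain_isCochain (c : Cochain P d e (Fin n → k) p) :
    IsCochain P d e coordForm (smallCochain c) := fun τ =>
  cochainFun_isCochain c fun i => coordForm (τ i)

lemma smallCochain_isClosed (z : LinearMap.ker (delta P d e (Fin n → k) p)) :
    IsClosed P coordForm (smallCochain z.1) := fun σ v hv =>
  mem_ker_delta_iff.1 z.2 (fun i => coordForm (σ i)) v hv

/-- Two classes agree if the restrictions of representatives to the cover by the complements of the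
coordinate hyperplanes differ by a coboundary. -/
lemma H_mk_eq_mk [IsAlgClosed k] (z z' : LinearMap.ker (delta P d e (Fin n → k) p))
    (h : IsCob P d e coordForm (smallCochain z.1 - smallCochain z'.1)) :
    (Submodule.Quotient.mk z : H P d e (Fin n → k) p) = Submodule.Quotient.mk z' :=
  (H_mk_eq_mk_iff z z').2 <| isCob_of_restrict
    ((cochainFun_isCochain z.1).sub (cochainFun_isCochain z'.1))
    ((mem_ker_delta_iff.1 z.2).sub (mem_ker_delta_iff.1 z'.2)) h

lemma isCob_smallCochain {z : LinearMap.ker (delta P d e (Fin n → k) p)}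
    (h : (Submodule.Quotient.mk z : H P d e (Fin n → k) p) = 0) :
    IsCob P d e coordForm (smallCochain z.1) := by
  rw [H_mk_eq_zero_iff] at h
  cases p with
  | zero => exact fun σ v hv => h (fun i => coordForm (σ i)) v hv
  | succ p =>
    obtain ⟨b, hb, hc⟩ := h
    exact ⟨fun τ => b fun i => coordForm (τ i), fun τ => hb fun i => coordForm (τ i),
      fun σ v hv => hc (fun i => coordForm (σ i)) v hv⟩

/-- Every cocycle for the cover by the complements of the coordinate hyperplanes extends to all
hyperplanes, in such a way that the extension does not change if the coordinates are scaled. -/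
lemma exists_cocycle_extension [IsAlgClosed k]
    {c : (Fin (p + 1) → Fin n) → (Fin n → k) → Val P (Fin n → k)}
    (hc : IsCochain P d e coordForm c) (hc' : IsClosed P coordForm c) :
    ∃ z : LinearMap.ker (delta P d e (Fin n → k) p), ∀ (τ : Fin (p + 1) → Fin n) (a : Fin n → k)
      (v : Fin n → k), (∀ i, a i ≠ 0) → (∀ i, v (τ i) ≠ 0) →
      cochainFun z.1 (fun i => a (τ i) • coordForm (τ i)) v = c τ v := by
  obtain ⟨M, hM⟩ := exists_isCochain_lift hc
  refine ⟨hM.toCocycle (isClosed_lift hc' M), fun τ a v ha hv => ?_⟩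
  rw [hM.cochainFun_toCocycle _ fun i => mul_ne_zero (ha _) (hv i)]
  exact liftCochain_smul_coordForm M c τ ha hv

lemma exists_cocycle_small {c : (Fin (p + 1) → Fin n) → (Fin n → k) → Val P (Fin n → k)}
    {z : LinearMap.ker (delta P d e (Fin n → k) p)}
    (hz : ∀ (τ : Fin (p + 1) → Fin n) (a : Fin n → k)
      (v : Fin n → k), (∀ i, a i ≠ 0) → (∀ i, v (τ i) ≠ 0) →
      cochainFun z.1 (fun i => a (τ i) • coordForm (τ i)) v = c τ v)
    (τ : Fin (p + 1) → Fin n) {v : Fin n → k} (hv : ∀ i, v (τ i) ≠ 0) :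
    smallCochain z.1 τ v = c τ v := by
  have := hz τ 1 v (fun _ => one_ne_zero) hv
  simp only [Pi.one_apply, one_smul] at this
  exact this

lemma H_subsingleton [IsAlgClosed k] (hP : IsPolynomialFunctor k P d)
    (hex : ∀ a : Fin n → ℤ, ∑ i, a i = e → CoeffExact hP a p) :
    Subsingleton (H P d e (Fin n → k) p) := by
  refine subsingleton_of_forall_eq 0 fun x => ?_
  obtain ⟨z, rfl⟩ := Submodule.Quotient.mk_surjective _ x
  rw [H_mk_eq_zero_iff]
  refine isCob_of_restrict (cochainFun_isCochain z.1) (mem_ker_delta_iff.1 z.2) ?_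
  obtain ⟨w, hw, h⟩ := exists_coeffs_cochain (hP := hP) (smallCochain_isCochain z.1)
  exact (isCob_weightSum hw (altSum_coeffs_eq_zero (smallCochain_isClosed z) h)
    fun a ha _ => hex a ha).congr h

lemma exists_neg_of_sum_neg {a : Fin n → ℤ} (h : ∑ i, a i < 0) : ∃ i, a i < 0 := by
  by_contra! hn
  exact absurd (Finset.sum_nonneg fun i _ => hn i) (not_le.2 h)

lemma exists_neg_of_sum_zero {a : Fin n → ℤ} (h : ∑ i, a i = 0) (ha : a ≠ 0) : ∃ i, a i < 0 := by
  by_contra! hn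
  exact ha (funext fun i => (Finset.sum_eq_zero_iff_of_nonneg fun i _ => hn i).1 h i
    (Finset.mem_univ i))

/-- Every cocycle of `P(Ω)` has weight zero up to a coboundary, in degrees less than `n - 1`, and in
all degrees if `d ≤ n - 1`. -/
lemma exists_weight_zero [IsAlgClosed k] (hP : IsPolynomialFunctor k P d)
    {c : (Fin (p + 1) → Fin n) → (Fin n → k) → Val P (Fin n → k)}
    (hc : IsCochain P d 0 coordForm c) (hc' : IsClosed P coordForm c)
    (hnum : p + 1 < n ∨ d + 1 ≤ n) :
    ∃ x : (Fin (p + 1) → Fin n) → Val P (Fin n → k),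
      (∀ σ, x σ ∈ coeffSpace hP 0 (Set.range σ)) ∧ altSum x = 0 ∧
      IsCob P d 0 coordForm (c - fun σ v => weightSum hP v (Finsupp.single 0 (x σ))) := by
  obtain ⟨w, hw, h⟩ := exists_coeffs_cochain (hP := hP) hc
  have hcl := altSum_coeffs_eq_zero hc' h
  have hx : altSum (fun σ => w σ 0) = 0 := funext fun σ => by
    rw [← altSum_finsupp_apply, hcl]
    rfl
  have hs : altSum (fun σ => Finsupp.single (0 : Fin n → ℤ) (w σ 0)) = 0 := funext fun σ => by
    have := altSum_comp (Finsupp.singleAddHom (0 : Fin n → ℤ)) (fun σ => w σ 0) σ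
    rw [hx] at this
    simpa using this
  refine ⟨fun σ => w σ 0, fun σ => (hw σ 0).1, hx, ?_⟩
  have hcob := isCob_weightSum (hP := hP) (e := 0)
    (w := fun σ => w σ - Finsupp.single (0 : Fin n → ℤ) (w σ 0))
    (fun σ => (hw σ).sub (IsCoeffs.single (hw σ 0).1 (by simp)))
    (by
      have : (fun σ => w σ - Finsupp.single (0 : Fin n → ℤ) (w σ 0)) =
        w - fun σ => Finsupp.single (0 : Fin n → ℤ) (w σ 0) := rfl
      rw [this, map_sub, hcl, hs, sub_zero])
    fun a ha ⟨σ, hσ⟩ => by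
      have ha0 : a ≠ 0 := by
        rintro rfl
        simp at hσ
      -- With `e = 0` and `a ν ≤ -1`, the bound `e - a ν + n - 1` is at least `n`, which exceeds `d`
      -- in the second case.
      obtain ⟨ν, hν⟩ := exists_neg_of_sum_zero ha ha0
      refine coeffExact_of_neg hν ?_
      rw [ha]
      omega
  refine hcob.congr fun σ v hv => ?_
  rw [Pi.sub_apply, Pi.sub_apply, h σ v hv, map_sub]

end Representatives

/-! ### Pullback on representatives -/

section Pullbacks

variable {E F : Type u} [AddCommGroup E] [Module k E] [Module.Finite k E]
  [AddCommGroup F] [Module k F] [Module.Finite k F]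

lemma cochainFun_pullCochain (φ : E →ₗ[k] F) (r : F →ₗ[k] E) (hr : r.comp φ = LinearMap.id)
    (c : Cochain P d e F p) (ℓ : Fin (p + 1) → Module.Dual k E) {v : E} (hv : v ∈ inter ℓ) :
    cochainFun (pullCochain P d e φ r hr p c) ℓ v =
      mapLin P φ.dualMap (cochainFun c (fun i => (ℓ i).comp r) (φ v)) := by
  have hφ : φ v ∈ inter fun i => (ℓ i).comp r := fun i => by
    have h : r (φ v) = v := LinearMap.congr_fun hr v
    rw [LinearMap.comp_apply, h]
    exact hv i
  rw [cochainFun_of_mem _ hv, cochainFun_of_mem _ hφ]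
  rfl

lemma pullH_mk (φ : E →ₗ[k] F) (r : F →ₗ[k] E) (hr : r.comp φ = LinearMap.id)
    (z : LinearMap.ker (delta P d e F p)) :
    pullH P d e φ r hr p (Submodule.Quotient.mk z) =
      Submodule.Quotient.mk (pullCocycle P d e φ r hr p z) := rfl

end Pullbacks

/-! ### Triviality of the action of GL_n -/

section Action

open Matrix

/-- Each class has a representative of weight zero on the coordinate cover. A diagonal matrix only
rescales the coordinate forms, and the lift of a cocycle is insensitive to this; so pulling back
acts by the character of weight zero, which is trivial. -/
lemma action_diagonal [IsAlgClosed k] (hP : IsPolynomialFunctor k P d)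
    (hnum : p + 1 < n ∨ d + 1 ≤ n)
    (g : GeneralLinearGroup (Fin n) k) {t : Fin n → k} (hg : g.1 = diagonal t) :
    action P d 0 n p g = LinearMap.id := by
  have ht : ∀ i, t i ≠ 0 := fun i hi => by
    have h : g.1.det ≠ 0 := (g.1.isUnit_iff_isUnit_det.1 g.isUnit).ne_zero
    rw [hg, det_diagonal] at h
    exact h (Finset.prod_eq_zero (Finset.mem_univ i) hi)
  have hginv : (g⁻¹).1 = diagonal t⁻¹ := by
    have h : g.1 * diagonal t⁻¹ = 1 := by
      rw [hg, diagonal_mul_diagonal, ← diagonal_one]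
      congr 1
      funext i
      exact mul_inv_cancel₀ (ht i)
    calc (g⁻¹).1 = (g⁻¹).1 * (g.1 * diagonal t⁻¹) := by rw [h, mul_one]
      _ = _ := by rw [← mul_assoc, Units.inv_mul, one_mul]
  have hφ : mulVecLin (g⁻¹).1 = LinearMap.mul k (Fin n → k) t⁻¹ := by
    refine LinearMap.ext fun v => funext fun i => ?_
    rw [hginv, mulVecLin_apply, mulVec_diagonal]
    rfl
  have hr : ∀ i, (coordForm (k := k) i).comp (mulVecLin g.1) = t i • coordForm i := fun i => by
    refine LinearMap.ext fun v => ?_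
    rw [hg, LinearMap.comp_apply, mulVecLin_apply, coordForm_apply, mulVec_diagonal]
    rfl
  have ht' : ∀ i, t⁻¹ i ≠ 0 := fun i => inv_ne_zero (ht i)
  refine LinearMap.ext fun x => ?_
  obtain ⟨z, rfl⟩ := Submodule.Quotient.mk_surjective _ x
  obtain ⟨x, hx, hxcl, hcob⟩ := exists_weight_zero hP (smallCochain_isCochain z.1)
    (smallCochain_isClosed z) hnum
  have hs : altSum (fun σ => Finsupp.single (0 : Fin n → ℤ) (x σ)) = 0 := funext fun σ => by
    have := altSum_comp (Finsupp.singleAddHom (0 : Fin n → ℤ)) x σ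
    rw [hxcl] at this
    simpa using this
  obtain ⟨z', hz'⟩ := exists_cocycle_extension (d := d) (e := 0)
    (isCochain_weightSum (hP := hP) fun σ => IsCoeffs.single (hx σ) (by simp))
    (isClosed_weightSum hs)
  have hzz' : (Submodule.Quotient.mk z : H P d 0 (Fin n → k) p) = Submodule.Quotient.mk z' :=
    H_mk_eq_mk z z' <| hcob.congr fun σ v hv => by
      rw [Pi.sub_apply, Pi.sub_apply, Pi.sub_apply, Pi.sub_apply,
        exists_cocycle_small hz' σ hv]
  rw [hzz', LinearMap.id_apply]
  refine H_mk_eq_mk _ z' (isCob_of_eq_zero fun σ v hv => ?_)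
  rw [Pi.sub_apply, Pi.sub_apply, sub_eq_zero, exists_cocycle_small hz' σ hv]
  refine (cochainFun_pullCochain _ _
    (by rw [← mulVecLin_mul, Units.mul_inv, mulVecLin_one]) z'.1 _ hv).trans ?_
  simp only [hr]
  rw [hφ, hz' σ t _ ht fun i => mul_ne_zero (ht' _) (hv i), weightSum_single, weightSum_single]
  have := mapLin_scaleDual_weightSection hP ht' 0 v (x σ)
  rw [mon_zero, one_smul] at this
  exact this

/-- `GL_n(k)` is the only normal subgroup that contains the diagonal matrices. -/
lemma normal_eq_top_of_diagonal {k : Type*} [Field k] [Infinite k] {n : ℕ}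
    (N : Subgroup (GeneralLinearGroup (Fin n) k)) [N.Normal]
    (hN : ∀ (g : GeneralLinearGroup (Fin n) k) (t : Fin n → k), g.1 = diagonal t → g ∈ N) :
    N = ⊤ := by
  refine eq_top_iff.2 fun g _ => ?_
  suffices h : ∀ A : Matrix (Fin n) (Fin n) k, A.det ≠ 0 →
      ∀ g : GeneralLinearGroup (Fin n) k, g.1 = A → g ∈ N from
    h g.1 (g.1.isUnit_iff_isUnit_det.1 g.isUnit).ne_zero g rfl
  intro A hA
  refine diagonal_transvection_induction_of_det_ne_zero
    (fun A => ∀ g : GeneralLinearGroup (Fin n) k, g.1 = A → g ∈ N) A hA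
    (fun t _ g hg => hN g t hg) (fun T g hg => ?_) fun A B hA hB ihA ihB g hg => ?_
  · obtain ⟨t, ht⟩ := (Set.finite_singleton (0 : k)).union (Set.finite_singleton 1)
      |>.exists_notMem
    have ht0 : t ≠ 0 := fun h => ht (Or.inl h)
    have ht1 : t - 1 ≠ 0 := sub_ne_zero.2 fun h => ht (Or.inr h)
    have hT (c : k) : IsUnit (transvection T.i T.j c).det := by
      rw [det_transvection_of_ne _ _ T.hij]
      exact isUnit_one
    let D := GeneralLinearGroup.mkOfDetNeZero (diagonal (Function.update 1 T.i t)) (by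
      rw [det_diagonal, Finset.prod_update_of_mem (Finset.mem_univ _)]
      simpa using ht0)
    -- Conjugation by `D` multiplies the off-diagonal entry by `t`, so the commutator `D S D⁻¹ S⁻¹`
    -- has entry `(t - 1) * (c / (t - 1)) = c`.
    let S := GeneralLinearGroup.mkOfDetNeZero (transvection T.i T.j (T.c / (t - 1))) (hT _).ne_zero
    have hD : D ∈ N := hN D _ rfl
    have hgS : D * S = g * S * D := by
      refine Units.ext ?_
      change diagonal _ * transvection _ _ _ = g.1 * transvection _ _ _ * diagonal _
      rw [hg, TransvectionStruct.toMatrix, transvection_mul_transvection_same _ _ T.hij]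
      ext i j
      rw [diagonal_mul, mul_diagonal]
      by_cases hij : T.i = i ∧ T.j = j
      · obtain ⟨rfl, rfl⟩ := hij
        rw [Function.update_self, Function.update_of_ne T.hij.symm]
        simp only [transvection, Matrix.add_apply, one_apply_ne T.hij, single_apply_same,
          Pi.one_apply]
        field_simp
        ring
      · simp only [transvection, Matrix.add_apply, single_apply_of_ne _ _ _ _ _ hij, add_zero]
        by_cases h : i = j
        · rw [h, mul_comm]
        · rw [one_apply_ne h, mul_zero, zero_mul]
    have : g = D * (S * D⁻¹ * S⁻¹) := by
      rw [← mul_assoc, ← mul_assoc, hgS]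
      group
    rw [this]
    exact N.mul_mem hD (Subgroup.Normal.conj_mem inferInstance _ (N.inv_mem hD) S)
  · have : g = GeneralLinearGroup.mkOfDetNeZero A hA * GeneralLinearGroup.mkOfDetNeZero B hB :=
      Units.ext hg
    rw [this]
    exact N.mul_mem (ihA _ rfl) (ihB _ rfl)

lemma action_isTrivial [IsAlgClosed k] (hP : IsPolynomialFunctor k P d)
    (hnum : p + 1 < n ∨ d + 1 ≤ n) :
    (action P d 0 n p).IsTrivial := by
  let N := (MonoidHom.ker (action P d 0 n p : _ →* _))
  have hN : N = ⊤ := normal_eq_top_of_diagonal N fun g t hg =>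
    (MonoidHom.mem_ker).2 (action_diagonal hP hnum g hg)
  refine ⟨fun g => ?_⟩
  have : g ∈ N := hN ▸ Subgroup.mem_top g
  exact (MonoidHom.mem_ker).1 this

end Action

end

section

variable {k : Type u} [Field k] {P : FGModuleCat.{u} k ⥤ FGModuleCat.{u} k}
  {d : ℕ} {n p : ℕ} {hP : IsPolynomialFunctor k P d} {e : ℤ}

/-! ### Restriction to a hyperplane and pullback along the projection from a point -/

section Hyperplane

variable (k n) in
/-- The inclusion of the hyperplane where the last coordinate vanishes. -/
def hyperplaneIncl : (Fin n → k) →ₗ[k] (Fin (n + 1) → k) :=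
  Function.ExtendByZero.linearMap k Fin.castSucc

variable (k n) in
/-- The projection that forgets the last coordinate. -/
def forgetLast : (Fin (n + 1) → k) →ₗ[k] (Fin n → k) := LinearMap.funLeft k k Fin.castSucc

/-- Scaling the last coordinate. -/
def lastScaling (n : ℕ) (s : k) : Fin (n + 1) → k := Function.update 1 (Fin.last n) s

lemma lastScaling_last (s : k) : lastScaling n s (Fin.last n) = s := Function.update_self ..

lemma lastScaling_castSucc (s : k) (i : Fin n) : lastScaling n s i.castSucc = 1 :=
  Function.update_of_ne (Fin.castSucc_lt_last i).ne ..

lemma mon_lastScaling (a : Fin (n + 1) → ℤ) (s : k) :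
    mon a (lastScaling n s) = s ^ a (Fin.last n) := by
  rw [mon, Fin.prod_univ_castSucc]
  simp [lastScaling_last, lastScaling_castSucc]

lemma hyperplaneIncl_castSucc (v : Fin n → k) (i : Fin n) :
    hyperplaneIncl k n v i.castSucc = v i :=
  (Fin.castSucc_injective n).extend_apply v 0 i

lemma hyperplaneIncl_last (v : Fin n → k) : hyperplaneIncl k n v (Fin.last n) = 0 :=
  Function.extend_apply' _ _ _ fun ⟨i, hi⟩ => (Fin.castSucc_lt_last i).ne hi

lemma forgetLast_apply (v : Fin (n + 1) → k) (i : Fin n) : forgetLast k n v i = v i.castSucc := rfl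

lemma forgetLast_hyperplaneIncl (v : Fin n → k) : forgetLast k n (hyperplaneIncl k n v) = v :=
  funext fun i => hyperplaneIncl_castSucc v i

lemma forgetLast_comp_hyperplaneIncl :
    (forgetLast k n).comp (hyperplaneIncl k n) = LinearMap.id :=
  LinearMap.ext forgetLast_hyperplaneIncl

lemma hyperplaneIncl_forgetLast (v : Fin (n + 1) → k) :
    hyperplaneIncl k n (forgetLast k n v) = lastScaling n 0 * v := by
  funext i
  refine Fin.lastCases ?_ (fun i => ?_) i
  · rw [hyperplaneIncl_last, Pi.mul_apply, lastScaling_last, zero_mul]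
  · rw [hyperplaneIncl_castSucc, forgetLast_apply, Pi.mul_apply,
      lastScaling_castSucc, one_mul]

lemma last_notMem_range_castSucc (τ : Fin p → Fin n) :
    Fin.last n ∉ Set.range (Fin.castSucc ∘ τ) := by
  rintro ⟨i, hi⟩
  exact (Fin.castSucc_lt_last (τ i)).ne hi

lemma exists_eq_castSucc_comp {σ : Fin p → Fin (n + 1)} (h : Fin.last n ∉ Set.range σ) :
    ∃ τ : Fin p → Fin n, σ = Fin.castSucc ∘ τ := by
  choose τ hτ using fun i => Fin.exists_castSucc_eq.2 fun hi => h ⟨i, hi⟩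
  exact ⟨τ, funext fun i => (hτ i).symm⟩

lemma mapLin_hyperplaneIncl_forgetLast (x : Val P (Fin n → k)) :
    mapLin P (hyperplaneIncl k n).dualMap (mapLin P (forgetLast k n).dualMap x) = x := by
  rw [← mapLin_comp_apply, LinearMap.dualMap_comp_dualMap, forgetLast_comp_hyperplaneIncl,
    LinearMap.dualMap_id, mapLin_id]
  rfl

lemma mapLin_forgetLast_hyperplaneIncl (x : Val P (Fin (n + 1) → k)) :
    mapLin P (forgetLast k n).dualMap (mapLin P (hyperplaneIncl k n).dualMap x) =
      mapLin P (scaleDual (lastScaling n 0)) x := by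
  rw [← mapLin_comp_apply]
  congr 2
  refine LinearMap.ext fun ξ => LinearMap.ext fun v => ?_
  rw [scaleDual_apply, ← hyperplaneIncl_forgetLast]
  rfl

/-- Pullback of small cochains along the inclusion of a hyperplane. -/
def hyperplanePull (c : (Fin (p + 1) → Fin (n + 1)) → (Fin (n + 1) → k) →
    Val P (Fin (n + 1) → k)) : (Fin (p + 1) → Fin n) → (Fin n → k) → Val P (Fin n → k) :=
  fun τ v => mapLin P (hyperplaneIncl k n).dualMap (c (Fin.castSucc ∘ τ) (hyperplaneIncl k n v))

lemma hyperplaneIncl_mem_inter {τ : Fin (p + 1) → Fin n} {v : Fin n → k}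
    (hv : v ∈ inter fun i => coordForm (τ i)) :
    hyperplaneIncl k n v ∈ inter fun i => coordForm ((Fin.castSucc ∘ τ) i) := fun i => by
  change hyperplaneIncl k n v (τ i).castSucc ≠ 0
  rw [hyperplaneIncl_castSucc]
  exact hv i

lemma hyperplanePull_sub (c c' : (Fin (p + 1) → Fin (n + 1)) → (Fin (n + 1) → k) →
    Val P (Fin (n + 1) → k)) :
    hyperplanePull (c - c') = hyperplanePull c - hyperplanePull c' :=
  funext fun _ => funext fun _ => map_sub _ _ _

lemma altSum_hyperplanePull (c : (Fin (p + 1) → Fin (n + 1)) → (Fin (n + 1) → k) →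
    Val P (Fin (n + 1) → k)) : altSum (hyperplanePull c) = hyperplanePull (altSum c) := by
  funext τ v
  rw [hyperplanePull, altSum_apply_apply, altSum_apply_apply]
  exact altSum_comp (mapLin P (hyperplaneIncl k n).dualMap).toAddMonoidHom
    (fun τ => c (Fin.castSucc ∘ τ) (hyperplaneIncl k n v)) τ

lemma IsCochain.hyperplanePull {c : (Fin (p + 1) → Fin (n + 1)) → (Fin (n + 1) → k) →
    Val P (Fin (n + 1) → k)} (hc : IsCochain P d e coordForm c) :
    IsCochain P d e coordForm (PolyOmega.hyperplanePull c) := fun _ =>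
  (hc _).pull _ fun _ hv => hyperplaneIncl_mem_inter hv

lemma IsCob.hyperplanePull {c : (Fin (p + 1) → Fin (n + 1)) → (Fin (n + 1) → k) →
    Val P (Fin (n + 1) → k)} (hc : IsCob P d e coordForm c) :
    IsCob P d e coordForm (PolyOmega.hyperplanePull c) := by
  cases p with
  | zero =>
    intro τ v hv
    rw [PolyOmega.hyperplanePull, hc _ _ (hyperplaneIncl_mem_inter hv), map_zero]
  | succ p =>
    obtain ⟨b, hb, hcb⟩ := hc
    refine ⟨PolyOmega.hyperplanePull b, hb.hyperplanePull, fun τ v hv => ?_⟩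
    rw [altSum_hyperplanePull, PolyOmega.hyperplanePull,
      hcb _ _ (hyperplaneIncl_mem_inter hv), PolyOmega.hyperplanePull]

lemma IsCob.sub {E : Type u} [AddCommGroup E] [Module k E] [Module.Finite k E] {α : Type*}
    {X : α → Module.Dual k E} {c c' : (Fin (p + 1) → α) → E → Val P E} (hc : IsCob P d e X c)
    (hc' : IsCob P d e X c') : IsCob P d e X (c - c') := by
  cases p with
  | zero => exact fun σ v hv => by rw [Pi.sub_apply, Pi.sub_apply, hc σ v hv, hc' σ v hv, sub_zero]
  | succ p =>
    obtain ⟨b, hb, hcb⟩ := hc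
    obtain ⟨b', hb', hcb'⟩ := hc'
    refine ⟨b - b', hb.sub hb', fun σ v hv => ?_⟩
    rw [Pi.sub_apply, Pi.sub_apply, hcb σ v hv, hcb' σ v hv, map_sub, Pi.sub_apply, Pi.sub_apply]

lemma smallCochain_pullCocycle (z : LinearMap.ker (delta P d e (Fin (n + 1) → k) p))
    (τ : Fin (p + 1) → Fin n) {v : Fin n → k} (hv : v ∈ inter fun i => coordForm (τ i)) :
    smallCochain (pullCocycle P d e (hyperplaneIncl k n) (forgetLast k n)
      forgetLast_comp_hyperplaneIncl p z).1 τ v = hyperplanePull (smallCochain z.1) τ v :=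
  cochainFun_pullCochain _ _ forgetLast_comp_hyperplaneIncl z.1 _ hv

/-- The pullback of a small cochain along the projection that forgets the last coordinate, extended
by zero. -/
def conePull (b : (Fin (p + 1) → Fin n) → (Fin n → k) → Val P (Fin n → k)) :
    (Fin (p + 1) → Fin (n + 1)) → (Fin (n + 1) → k) → Val P (Fin (n + 1) → k) :=
  Function.extend (fun τ => Fin.castSucc ∘ τ)
    (fun τ v => mapLin P (forgetLast k n).dualMap (b τ (forgetLast k n v))) 0

lemma conePull_castSucc (b : (Fin (p + 1) → Fin n) → (Fin n → k) → Val P (Fin n → k))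
    (τ : Fin (p + 1) → Fin n) (v : Fin (n + 1) → k) :
    conePull b (Fin.castSucc ∘ τ) v =
      mapLin P (forgetLast k n).dualMap (b τ (forgetLast k n v)) :=
  congrFun (((Fin.castSucc_injective n).comp_left).extend_apply _ _ τ) v

lemma conePull_of_mem (b : (Fin (p + 1) → Fin n) → (Fin n → k) → Val P (Fin n → k))
    {σ : Fin (p + 1) → Fin (n + 1)} (h : Fin.last n ∈ Set.range σ) : conePull b σ = 0 :=
  Function.extend_apply' _ _ _ (by rintro ⟨τ, rfl⟩; exact last_notMem_range_castSucc τ h)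

lemma isCochain_conePull {b : (Fin (p + 1) → Fin n) → (Fin n → k) → Val P (Fin n → k)}
    (hb : IsCochain P d e coordForm b) : IsCochain P d e coordForm (conePull b) := fun σ => by
  by_cases h : Fin.last n ∈ Set.range σ
  · rw [conePull_of_mem b h]
    exact IsSec.zero
  · obtain ⟨τ, rfl⟩ := exists_eq_castSucc_comp h
    exact ((hb τ).pull (forgetLast k n) (U := inter fun i => coordForm ((Fin.castSucc ∘ τ) i))
      fun _ hv => hv).congr fun v _ => conePull_castSucc b τ v

lemma altSum_conePull_castSucc (b : (Fin (p + 1) → Fin n) → (Fin n → k) → Val P (Fin n → k))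
    (τ : Fin (p + 2) → Fin n) (v : Fin (n + 1) → k) :
    altSum (conePull b) (Fin.castSucc ∘ τ) v =
      mapLin P (forgetLast k n).dualMap (altSum b τ (forgetLast k n v)) := by
  rw [altSum_apply_apply, altSum_apply_apply]
  refine Eq.trans ?_ (altSum_comp (mapLin P (forgetLast k n).dualMap).toAddMonoidHom
    (fun τ => b τ (forgetLast k n v)) τ)
  rw [altSum_apply, altSum_apply]
  exact Finset.sum_congr rfl fun i _ => congrArg _ (conePull_castSucc b _ v)

lemma mapLin_scaleDual_conePull (b : (Fin (p + 1) → Fin n) → (Fin n → k) → Val P (Fin n → k))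
    (σ : Fin (p + 1) → Fin (n + 1)) (s : k) (v : Fin (n + 1) → k) :
    mapLin P (scaleDual (lastScaling n s))
      (conePull b σ (lastScaling n s * v)) = conePull b σ v := by
  by_cases h : Fin.last n ∈ Set.range σ
  · rw [conePull_of_mem b h, Pi.zero_apply, Pi.zero_apply, map_zero]
  · have hs : ∀ v : Fin (n + 1) → k,
        forgetLast k n (lastScaling n s * v) = forgetLast k n v := fun v => by
      funext i
      rw [forgetLast_apply, Pi.mul_apply, lastScaling_castSucc, one_mul,
        forgetLast_apply]
    obtain ⟨τ, rfl⟩ := exists_eq_castSucc_comp h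
    rw [conePull_castSucc, conePull_castSucc, hs, ← mapLin_comp_apply]
    congr 2
    exact LinearMap.ext fun ξ => LinearMap.ext fun v => congrArg ξ (hs v)

end Hyperplane

/-! ### Weights of sections pulled back from the hyperplane -/

section Coefficients

lemma mon_eq_one_of_expSum_mul [Infinite k] {W : Type*} [AddCommGroup W] [Module k W]
    {s : Fin n → k} {w : (Fin n → ℤ) →₀ W}
    (h : ∀ t : Fin n → k, (∀ i, t i ≠ 0) → expSum id (s * t) w = expSum id t w)
    {a : Fin n → ℤ} (ha : w a ≠ 0) : mon a s = 1 := by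
  classical
  let w' : (Fin n → ℤ) →₀ W := Finsupp.onFinset w.support (fun a => mon a s • w a) fun a ha =>
    Finsupp.mem_support_iff.2 fun h => ha (by rw [h, smul_zero])
  have hw : w' = w := expSum_injective (k := k) Function.injective_id fun t ht => by
    rw [← h t ht, expSum_apply, expSum_apply,
      Finsupp.sum_of_support_subset _ (Finsupp.support_onFinset_subset) _ fun _ _ => smul_zero _]
    refine Finset.sum_congr rfl fun a _ => ?_
    change mon a t • mon a s • w a = mon a (s * t) • w a
    rw [mon_mul, smul_smul, mul_comm]
  have := DFunLike.congr_fun hw a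
  rw [Finsupp.onFinset_apply] at this
  by_contra hne
  refine ha ((smul_eq_zero.1 (?_ : (mon a s - 1) • w a = 0)).resolve_left (sub_ne_zero.2 hne))
  rw [sub_smul, this, one_smul, sub_self]

/-- A cochain pulled back from the hyperplane is invariant under scaling the last coordinate, so
only weights trivial on that one-parameter subgroup occur. -/
lemma coeffs_conePull [Infinite k] {b : (Fin (p + 1) → Fin n) → (Fin n → k) → Val P (Fin n → k)}
    {w : (Fin (p + 1) → Fin (n + 1)) → (Fin (n + 1) → ℤ) →₀ Val P (Fin (n + 1) → k)}
    (h : ∀ σ, ∀ v ∈ inter fun i => coordForm (σ i), conePull b σ v = weightSum hP v (w σ))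
    {σ : Fin (p + 1) → Fin (n + 1)} {a : Fin (n + 1) → ℤ} (ha : w σ a ≠ 0) :
    a (Fin.last n) = 0 := by
  by_contra hne
  obtain ⟨u, hu⟩ := exists_unit_zpow_ne_one (k := k) hne
  have hs : ∀ i, lastScaling n (u : k) i ≠ 0 := fun i => by
    refine Fin.lastCases ?_ (fun i => ?_) i
    · rw [lastScaling_last]
      exact u.ne_zero
    · rw [lastScaling_castSucc]
      exact one_ne_zero
  have := mon_eq_one_of_expSum_mul (s := lastScaling n (u : k)) (fun t ht => ?_) ha
  · rw [mon_lastScaling] at this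
    exact hu (Units.ext (by rw [Units.val_zpow_eq_zpow_val, this, Units.val_one]))
  · have hst := fun i => mul_ne_zero (hs i) (ht i)
    rw [← mapLin_scaleDual_weightSum hP (t := lastScaling n (u : k) * t) hst,
      ← mapLin_scaleDual_weightSum hP ht,
      ← h σ _ fun i => hst _, ← h σ t fun i => ht _, mul_comm, mapLin_scaleDual_mul,
      mul_comm, mapLin_scaleDual_conePull]

/-- A section of weight zero over an open set that is a cone over an open subset of the hyperplane
is determined by its restriction to the hyperplane. -/
lemma mapLin_weightSection_hyperplane [Infinite k] {I : Set (Fin (n + 1))} (hI : Fin.last n ∉ I)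
    {x : Val P (Fin (n + 1) → k)} (hx : x ∈ coeffSpace hP 0 I) (v : Fin (n + 1) → k) :
    mapLin P (forgetLast k n).dualMap (mapLin P (hyperplaneIncl k n).dualMap
      (weightSection hP 0 (hyperplaneIncl k n (forgetLast k n v)) x)) =
      weightSection hP 0 v x := by
  rw [mapLin_forgetLast_hyperplaneIncl, hyperplaneIncl_forgetLast, weightSection_apply,
    weightSection_apply, map_sum]
  refine Finset.sum_congr rfl fun b _ => ?_
  by_cases hb : 0 < b (Fin.last n)
  · rw [(mem_coeffSpace_iff.1 hx).2 b (Fin.last n) hI (by simpa using hb), smul_zero, smul_zero,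
      map_zero]
  · have h0 : b (Fin.last n) = 0 := by omega
    rw [map_smul, mapLin_scaleDual_weightProj, mon_mul, mon_lastScaling, mon_lastScaling]
    simp [natExp, h0]

end Coefficients

/-! ### Stabilization -/

section Stabilization

/-- The pullback of a cocycle along the projection, extended by zero, is closed on tuples without
the last index. Its differential is thus supported on tuples containing that index and is cancelled
by a cochain with the same support, which the restriction to the hyperplane does not see. -/
lemma pullH_hyperplane_surjective [IsAlgClosed k] (hP : IsPolynomialFunctor k P d)
    (hnum : p + 1 < n ∨ d + 1 ≤ n) :
    Function.Surjective (pullH P d 0 (hyperplaneIncl k n) (forgetLast k n)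
      forgetLast_comp_hyperplaneIncl p) := by
  intro y
  obtain ⟨z, rfl⟩ := Submodule.Quotient.mk_surjective _ y
  obtain ⟨w, hw, h⟩ := exists_coeffs_cochain (hP := hP)
    (isCochain_conePull (smallCochain_isCochain z.1))
  obtain ⟨g, hg, hg0, hgw⟩ := exists_coeffs_altSum_eq (w := altSum w) (IsCoeffs.altSum hw)
    (R := fun τ => Fin.last n ∉ Set.range τ) fun a ha ⟨σ, hσ⟩ => by
      have ha0 : a (Fin.last n) = 0 := by
        rw [altSum_finsupp_apply, altSum_apply] at hσ
        obtain ⟨i, _, hi⟩ := Finset.exists_ne_zero_of_sum_ne_zero hσ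
        exact coeffs_conePull (hP := hP) h fun h0 => hi (by rw [h0, smul_zero])
      refine exists_altSum_eq_of_supported (fun σ => (IsCoeffs.altSum hw σ a).1) (fun σ hσ => ?_)
        ?_ (by rw [ha, ha0]; push_cast; omega)
      · obtain ⟨τ, rfl⟩ := exists_eq_castSucc_comp hσ
        refine DFunLike.congr_fun (weightSum_eq_zero hP fun t ht => ?_ : altSum w _ = 0) a
        rw [← altSum_apply_eq_weightSum h _ fun i => ht _, altSum_conePull_castSucc,
          smallCochain_isClosed z τ _ fun i => ht _, map_zero]
      · funext σ
        rw [← altSum_finsupp_apply, altSum_altSum]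
        rfl
  have hW : ∀ σ, IsCoeffs hP 0 (Set.range σ) ((w - g) σ) := fun σ => (hw σ).sub (hg σ)
  obtain ⟨z', hz'⟩ := exists_cocycle_extension (isCochain_weightSum hW)
    (isClosed_weightSum (hP := hP) (w := w - g) (by rw [map_sub, hgw, sub_self]))
  refine ⟨Submodule.Quotient.mk z', ?_⟩
  rw [pullH_mk]
  refine H_mk_eq_mk _ _ (isCob_of_eq_zero fun τ v hv => ?_)
  have hv' := hyperplaneIncl_mem_inter hv
  rw [Pi.sub_apply, Pi.sub_apply, smallCochain_pullCocycle z' τ hv, hyperplanePull,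
    exists_cocycle_small hz' _ (v := hyperplaneIncl k n v) hv', Pi.sub_apply, hg0 _
      (last_notMem_range_castSucc τ), sub_zero,
    ← h _ _ hv', conePull_castSucc, forgetLast_hyperplaneIncl, mapLin_hyperplaneIncl_forgetLast,
    sub_self]

/-- A cocycle of weight zero is a coboundary if its restriction to a hyperplane is. -/
lemma isCob_of_hyperplanePull [IsAlgClosed k]
    {x : (Fin (p + 1) → Fin (n + 1)) → Val P (Fin (n + 1) → k)}
    (hx : ∀ σ, x σ ∈ coeffSpace hP 0 (Set.range σ)) (hcl : altSum x = 0)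
    (hnum : p + 1 < n ∨ d + 1 ≤ n)
    (h : IsCob P d 0 coordForm (hyperplanePull fun σ v => weightSection hP 0 v (x σ))) :
    IsCob P d 0 coordForm fun σ v => weightSection hP 0 v (x σ) := by
  have hr : ∀ (τ : Fin (p + 1) → Fin n) (v : Fin (n + 1) → k),
      weightSection hP 0 v (x (Fin.castSucc ∘ τ)) = mapLin P (forgetLast k n).dualMap
        (hyperplanePull (fun σ v => weightSection hP 0 v (x σ)) τ (forgetLast k n v)) :=
    fun τ v => (mapLin_weightSection_hyperplane (last_notMem_range_castSucc τ) (hx _) v).symm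
  cases p with
  | zero =>
    have h0 : x = 0 := eq_zero_of_supported (ν := Fin.last n) hx (fun σ hσ => by
      obtain ⟨τ, rfl⟩ := exists_eq_castSucc_comp hσ
      rw [← weightSection_one (hP := hP) 0 (x _), hr, h τ _ fun i => one_ne_zero, map_zero]) hcl
      (by simp; omega)
    exact isCob_of_eq_zero fun σ v _ => by rw [h0, Pi.zero_apply, map_zero]
  | succ p =>
    obtain ⟨b, hb, hxb⟩ := h
    obtain ⟨w, hw, hwb⟩ := exists_coeffs_cochain (hP := hP) (isCochain_conePull hb)
    have hs : altSum (fun σ => Finsupp.single (0 : Fin (n + 1) → ℤ) (x σ)) = 0 :=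
      funext fun σ => by
        have := altSum_comp (Finsupp.singleAddHom (0 : Fin (n + 1) → ℤ)) x σ
        rw [hcl] at this
        simpa using this
    -- After subtracting the coboundary of the pulled-back primitive, the cocycle vanishes on tuples
    -- without the last index, because there a weight zero section is pulled back from the
    -- hyperplane. Its weights have last entry zero, so the exactness lemma applies with `ν` the
    -- last index.
    let y : (Fin (p + 2) → Fin (n + 1)) → (Fin (n + 1) → ℤ) →₀ Val P (Fin (n + 1) → k) :=
      (fun σ => Finsupp.single 0 (x σ)) - altSum w
    have hy : ∀ σ, IsCoeffs hP 0 (Set.range σ) (y σ) := fun σ =>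
      (IsCoeffs.single (hx σ) (by simp)).sub (IsCoeffs.altSum hw σ)
    have hycl : altSum y = 0 := by rw [map_sub, hs, altSum_altSum, sub_zero]
    have hy0 : ∀ σ, Fin.last n ∉ Set.range σ → y σ = 0 := fun σ hσ => by
      obtain ⟨τ, rfl⟩ := exists_eq_castSucc_comp hσ
      refine weightSum_eq_zero hP fun t ht => ?_
      change weightSum hP t (Finsupp.single 0 (x _) - altSum w _) = 0
      rw [map_sub, weightSum_single, ← altSum_apply_eq_weightSum hwb _ fun i => ht _,
        altSum_conePull_castSucc, hr, hxb τ _ fun i => ht _, sub_self]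
    obtain ⟨g, hg, _, hgy⟩ := exists_coeffs_altSum_eq hy (R := fun _ => False)
      fun a ha ⟨σ, hσ⟩ => by
        have ha0 : a (Fin.last n) = 0 := by
          by_contra hne
          refine hσ ?_
          have h0 : (0 : Fin (n + 1) → ℤ) ≠ a := by
            rintro rfl
            exact hne rfl
          change Finsupp.single 0 (x σ) a - altSum w σ a = 0
          rw [Finsupp.single_eq_of_ne h0.symm, altSum_finsupp_apply, altSum_apply, zero_sub,
            neg_eq_zero]
          refine Finset.sum_eq_zero fun i _ => ?_
          rw [of_not_not fun hi => hne (coeffs_conePull (hP := hP) hwb hi), smul_zero]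
        obtain ⟨g, hg, _, hgy⟩ := exists_altSum_eq_of_supported (ν := Fin.last n)
          (c := fun σ => y σ a) (fun σ => (hy σ a).1) (fun σ hσ => by rw [hy0 σ hσ]; rfl)
          (funext fun σ => by rw [← altSum_finsupp_apply, hycl]; rfl)
          (by rw [ha, ha0]; push_cast; omega)
        exact ⟨g, hg, fun _ h => h.elim, hgy⟩
    refine ⟨_, isCochain_weightSum (hP := hP) (w := w + g) fun σ => (hw σ).add (hg σ),
      fun σ v _ => ?_⟩
    rw [altSum_weightSum, map_add, hgy, add_sub_cancel, weightSum_single]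

lemma pullH_hyperplane_injective [IsAlgClosed k] (hP : IsPolynomialFunctor k P d)
    (hnum : p + 1 < n ∨ d + 1 ≤ n) :
    Function.Injective (pullH P d 0 (hyperplaneIncl k n) (forgetLast k n)
      forgetLast_comp_hyperplaneIncl p) := by
  refine (injective_iff_map_eq_zero _).2 fun y hy => ?_
  obtain ⟨z, rfl⟩ := Submodule.Quotient.mk_surjective _ y
  rw [pullH_mk] at hy
  obtain ⟨x, hx, hcl, hcob⟩ := exists_weight_zero hP (smallCochain_isCochain z.1)
    (smallCochain_isClosed z) (by omega)
  simp only [weightSum_single] at hcob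
  have h : IsCob P d 0 coordForm (hyperplanePull fun σ v => weightSection hP 0 v (x σ)) := by
    refine ((isCob_smallCochain hy).sub hcob.hyperplanePull).congr fun τ v hv => ?_
    rw [hyperplanePull_sub, Pi.sub_apply, Pi.sub_apply, Pi.sub_apply, Pi.sub_apply,
      smallCochain_pullCocycle z τ hv, sub_sub_cancel]
  rw [H_mk_eq_zero_iff]
  refine isCob_of_restrict (cochainFun_isCochain z.1) (mem_ker_delta_iff.1 z.2)
    ((hcob.add (isCob_of_hyperplanePull hx hcl hnum h)).congr fun σ v _ => ?_)
  rw [sub_add_cancel]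
  rfl

lemma extendByZero_castLE_succ {m n : ℕ} (hmn : m ≤ n) (v : Fin m → k) :
    Function.ExtendByZero.linearMap k (Fin.castLE (hmn.trans n.le_succ)) v =
      hyperplaneIncl k n (Function.ExtendByZero.linearMap k (Fin.castLE hmn) v) := by
  have h : ∀ i, Fin.castLE (hmn.trans n.le_succ) i = (Fin.castLE hmn i).castSucc := fun _ => rfl
  funext i
  refine Fin.lastCases ?_ (fun i => ?_) i
  · rw [hyperplaneIncl_last]
    exact Function.extend_apply' v (0 : Fin (n + 1) → k) _ fun ⟨j, hj⟩ =>
      (Fin.castSucc_lt_last (Fin.castLE hmn j)).ne hj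
  · rw [hyperplaneIncl_castSucc]
    by_cases hi : ∃ j, Fin.castLE hmn j = i
    · obtain ⟨j, rfl⟩ := hi
      exact ((Fin.castLE_injective (hmn.trans n.le_succ)).extend_apply v 0 j).trans
        ((Fin.castLE_injective hmn).extend_apply v 0 j).symm
    · exact (Function.extend_apply' v (0 : Fin (n + 1) → k) _ fun ⟨j, hj⟩ =>
        hi ⟨j, Fin.castSucc_injective n hj⟩).trans
          (Function.extend_apply' v (0 : Fin n → k) i hi).symm

lemma coordPull_succ {m n : ℕ} (hmn : m ≤ n) (j : ℕ) :
    coordPull P d 0 (hmn.trans n.le_succ) j = (coordPull P d 0 hmn j).comp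
      (pullH P d 0 (hyperplaneIncl k n) (forgetLast k n) forgetLast_comp_hyperplaneIncl j) :=
  pullH_comp P d 0 (Function.ExtendByZero.linearMap k (Fin.castLE hmn))
    (LinearMap.funLeft k k (Fin.castLE hmn)) _ (hyperplaneIncl k n) (forgetLast k n)
    forgetLast_comp_hyperplaneIncl
    (Function.ExtendByZero.linearMap k (Fin.castLE (hmn.trans n.le_succ)))
    (LinearMap.funLeft k k (Fin.castLE (hmn.trans n.le_succ))) _
    (LinearMap.ext (extendByZero_castLE_succ hmn)) rfl j

lemma coordPull_self (n j : ℕ) : coordPull P d e (le_refl n) j = LinearMap.id :=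
  pullH_id P d e _ _ _ (LinearMap.ext fun v => funext fun i =>
    (Fin.castLE_injective le_rfl).extend_apply v 0 i) rfl j

lemma coordPull_bijective [IsAlgClosed k] (hP : IsPolynomialFunctor k P d) {m n : ℕ} (hmn : m ≤ n)
    {j : ℕ}
    (hnum : j + 1 < m ∨ d + 1 ≤ m) : Function.Bijective (coordPull P d 0 hmn j) := by
  induction n, hmn using Nat.le_induction with
  | base =>
    rw [coordPull_self]
    exact Function.bijective_id
  | succ n hmn ih =>
    rw [coordPull_succ hmn, LinearMap.coe_comp]
    exact ih.comp ⟨pullH_hyperplane_injective hP (by omega),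
      pullH_hyperplane_surjective hP (by omega)⟩

end Stabilization

end

end

end PolyOmega

theorem theorem4p2 {k : Type u} [Field k] [IsAlgClosed k]
    (P : FGModuleCat.{u} k ⥤ FGModuleCat.{u} k) (d : ℕ)
    (hP : PolyOmega.IsPolynomialFunctor k P d) :
    -- `GL_n` acts trivially on `H^j(ℙ^{n-1}, P(Ω))` for `j < n - 1`
    (∀ n j : ℕ, j + 1 < n → (PolyOmega.action P d 0 n j).IsTrivial) ∧
    -- and, if `d ≤ n - 1`, also for `j = n - 1`
    (∀ n j : ℕ, j + 1 = n → d + 1 ≤ n → (PolyOmega.action P d 0 n j).IsTrivial) ∧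
    -- `H^j(ℙ^{n-1}, P(Ω)(e)) = 0` if `e < 0` and `j < n - 1`
    (∀ (n j : ℕ) (e : ℤ), e < 0 → j + 1 < n → Subsingleton (PolyOmega.H P d e (Fin n → k) j)) ∧
    -- `H^{n-1}(ℙ^{n-1}, P(Ω)(e)) = 0` if `d - n + 1 ≤ e ≤ -1`
    (∀ (n j : ℕ) (e : ℤ), j + 1 = n → (d : ℤ) - n + 1 ≤ e → e ≤ -1 →
      Subsingleton (PolyOmega.H P d e (Fin n → k) j)) ∧
    -- `H^j(ℙ^{n-1}, P(Ω)) → H^j(ℙ^{m-1}, P(Ω))` is bijective if `j < m - 1`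
    (∀ (m n : ℕ) (hmn : m ≤ n) (j : ℕ), j + 1 < m →
      Function.Bijective (PolyOmega.coordPull P d 0 hmn j)) ∧
    -- and, for all `j`, if `d ≤ m - 1`
    (∀ (m n : ℕ) (hmn : m ≤ n) (j : ℕ), d + 1 ≤ m →
      Function.Bijective (PolyOmega.coordPull P d 0 hmn j)) ∧
    -- `H^j(ℙ^{n-1}, P(Ω)) = 0` if `j > d`
    (∀ n j : ℕ, d < j → Subsingleton (PolyOmega.H P d 0 (Fin n → k) j)) := by
  have neg : ∀ (n j : ℕ) (e : ℤ), e < 0 → (j + 1 < n ∨ (d : ℤ) - n + 1 ≤ e) →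
      Subsingleton (PolyOmega.H P d e (Fin n → k) j) := fun n j e he hnum =>
    PolyOmega.H_subsingleton hP fun a ha => by
      -- From `a ν ≤ -1` and `e ≥ d - n + 1` one gets `e - a ν + n - 1 ≥ e + n > d`.
      obtain ⟨ν, hν⟩ := PolyOmega.exists_neg_of_sum_neg (ha.trans_lt he)
      refine PolyOmega.coeffExact_of_neg hν ?_
      rw [ha]
      omega
  refine ⟨fun n j h => PolyOmega.action_isTrivial hP (Or.inl h),
    fun n j _ h => PolyOmega.action_isTrivial hP (Or.inr h),
    fun n j e he h => neg n j e he (Or.inl h), fun n j e _ h he => neg n j e (by omega) (Or.inr h),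
    fun m n hmn j h => PolyOmega.coordPull_bijective hP hmn (Or.inl h),
    fun m n hmn j h => PolyOmega.coordPull_bijective hP hmn (Or.inr h), fun n j h => ?_⟩
  -- For `n ≤ j` the coordinate cover has too few open sets. Otherwise `d + 1 ≤ j < n`, and
  -- restriction to ℙ^d, covered by `d + 1` sets, is injective.
  rcases le_or_gt n j with hn | hn
  · exact PolyOmega.H_subsingleton hP fun a _ => PolyOmega.coeffExact_of_le hn
  · have : Subsingleton (PolyOmega.H P d 0 (Fin (d + 1) → k) j) :=
      PolyOmega.H_subsingleton hP fun a _ => PolyOmega.coeffExact_of_le h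
    exact (PolyOmega.coordPull_bijective hP (m := d + 1) (by omega) (Or.inr le_rfl)).1.subsingleton
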